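/- All manifolds are smooth, Hausdorff, second countable, finite dimensional and without boundary. A (singular) foliation on $M$ is a locally finitely generated $C^\infty(M)$-submodule $\mathcal F$ of $C_c^\infty(M;TM)$ that is stable under Lie brackets. For a submersion $p:U\to M$, the pull-back $p^{-1}(\mathcal F)$ is the set of $Y\in C_c^\infty(U;TU)$ such that $dp(Y)$ is a finite sum $\sum_i f_i\,(X_i\circ p)$ with $f_i\in C_c^\infty(U)$ and $X_i\in\mathcal F$. A bi-submersion of $(M,\mathcal F)$ is a manifold $U$ with two submersions $t,s:U\to M$ such that $s^{-1}(\mathcal F)=t^{-1}(\mathcal F)$ and $s^{-1}(\mathcal F)=C_c^\infty(U;\ker ds)+C_c^\infty(U;\ker dt)$. An identity bisection of $(U,t,s)$ is an embedded submanifold $V\subset U$ on which $s$ and $t$ coincide and restrict to étale maps (local diffeomorphisms) $V\to M$. A bi-submersion $(U',t',s')$ is adapted to $(U,t,s)$ if every $u'\in U'$ has an open neighbourhood $W\subset U'$ with a smooth map $f:W\to U$ such that $s\circ f=s'$ and $t\circ f=t'$ on $W$. The adiabatic foliation $\mathcal{TF}$ on $M\times\mathbb R$ is the set of finite sums $\sum_i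 \lambda f_i\,(X_i\otimes 1)$ with $f_i\in C_c^\infty(M\times\mathbb R)$ and $X_i\in\mathcal F$, where $\lambda(x,\beta)=\beta$ and $X\otimes 1$ is the extension of $X$ to $M\times\mathbb R$ tangent along $M$. For a submanifold $V\subset U$ with normal bundle $N=TU|_V/TV$, let $D(U,V)=U\times\mathbb R^*\,\cup\,N\times\{0\}$ be the deformation to the normal cone, with its usual smooth structure, and let $q:D(U,V)\to U\times\mathbb R$ be the identity on $U\times\mathbb R^*$ and $q(y,0)=(v,0)$ for $y\in N_v$. For $p:U\to M$, write $p\circ q$ for $(p\times\mathrm{id}_{\mathbb R})\circ q:D(U,V)\to M\times\mathbb R$. **Proposition.** Let $(U,t,s)$ be a bi-submersion of a foliated manifold $(M,\mathcal F)$ and let $V\subset U$ be a closed identity bisection. (a) $\mathcal{TF}$ is a foliation on $M\times\mathbb R$, and $(D(U,V),\,t\circ q,\,s\circ q)$ is a bi-submersion of $(M\times\mathbb R,\mathcal{TF})$. (b) If $(U',t',s')$ is a bi-submersion of $(M,\mathcal F)$ adapted to $(U,t,s)$, and $V'\subset U'$ is any closed identity bisection of $(U',t',s')$ such that $s'(V')\subset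 s(V)$, then $(D(U',V'),t'\circ q',s'\circ q')$ is adapted to $(D(U,V),t\circ q,s\circ q)$, where $q':D(U',V')\to U'\times\mathbb R$ is the corresponding map. -/

import Mathlib

open scoped Manifold ContDiff Topology
open Set Manifold

universe u v w z

/-! ### Two analytic facts behind the smooth structure of the deformation -/

namespace NormalConeDeformation

/-- Differentiation under the integral sign, finite order. -/
theorem contDiff_integral_param {P : Type u} [NormedAddCommGroup P] [NormedSpace ℝ P]
    [FiniteDimensional ℝ P] (n : ℕ) :
    ∀ {G : Type u} [NormedAddCommGroup G] [NormedSpace ℝ G] [CompleteSpace G] (A : P × ℝ → G),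
      ContDiff ℝ n A → ContDiff ℝ n (fun p => ∫ τ in (0 : ℝ)..1, A (p, τ)) := by
  induction n with
  | zero =>
    intro G _ _ _ A hA
    rw [Nat.cast_zero, contDiff_zero] at hA ⊢
    exact intervalIntegral.continuous_parametric_intervalIntegral_of_continuous' (by simpa [Function.uncurry_def] using hA) _ _
  | succ n ih =>
    intro G _ _ _ A hA
    have hA1 : ContDiff ℝ 1 A := hA.of_le (by exact_mod_cast Nat.le_add_left 1 n)
    let A' : P × ℝ → (P →L[ℝ] G) := fun q => (fderiv ℝ A q).comp (ContinuousLinearMap.inl ℝ P ℝ)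
    have hA' : ContDiff ℝ n A' :=
      (hA.fderiv_right (m := n) (by norm_cast)).clm_comp contDiff_const
    have hA'c : Continuous A' := hA'.continuous
    have key : ∀ p, HasFDerivAt (fun p => ∫ τ in (0 : ℝ)..1, A (p, τ))
        (∫ τ in (0 : ℝ)..1, A' (p, τ)) p := by
      intro p
      have hcomp : IsCompact (Metric.closedBall p 1 ×ˢ Icc (0 : ℝ) 1) :=
        (isCompact_closedBall p 1).prod isCompact_Icc
      obtain ⟨C, hC⟩ := hcomp.exists_bound_of_continuousOn hA'c.continuousOn
      refine intervalIntegral.hasFDerivAt_integral_of_dominated_of_fderiv_le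
        (F := fun p τ => A (p, τ)) (F' := fun p τ => A' (p, τ)) (bound := fun _ => C)
        (s := Metric.ball p 1) (Metric.ball_mem_nhds p one_pos) ?_ ?_ ?_ ?_ ?_ ?_
      · exact Filter.Eventually.of_forall fun x =>
          (hA1.continuous.comp (Continuous.prodMk_right x)).aestronglyMeasurable
      · exact (hA1.continuous.comp (Continuous.prodMk_right p)).intervalIntegrable _ _
      · exact (hA'c.comp (Continuous.prodMk_right p)).aestronglyMeasurable
      · refine Filter.Eventually.of_forall fun τ hτ x hx => hC _ ⟨?_, ?_⟩
        · exact Metric.ball_subset_closedBall hx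
        · rw [uIoc_of_le zero_le_one] at hτ
          exact ⟨hτ.1.le, hτ.2⟩
      · exact intervalIntegrable_const
      · refine Filter.Eventually.of_forall fun τ _ x _ => ?_
        have h1 : HasFDerivAt A (fderiv ℝ A (x, τ)) (x, τ) :=
          (hA1.differentiable one_ne_zero _).hasFDerivAt
        exact h1.comp x (hasFDerivAt_prodMk_left x τ)
    rw [Nat.cast_add, Nat.cast_one, contDiff_succ_iff_hasFDerivAt]
    exact ⟨_, ih A' hA', key⟩

theorem contDiff_integral_param_infty {P G : Type u} [NormedAddCommGroup P] [NormedSpace ℝ P]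
    [FiniteDimensional ℝ P] [NormedAddCommGroup G] [NormedSpace ℝ G] [CompleteSpace G]
    {A : P × ℝ → G} (hA : ContDiff ℝ ∞ A) :
    ContDiff ℝ ∞ (fun p => ∫ τ in (0 : ℝ)..1, A (p, τ)) :=
  contDiff_infty.2 fun n => contDiff_integral_param n A (contDiff_infty.1 hA n)

/-- Hadamard's lemma: if `g` vanishes on the slice `{y | π y = y}`, then
`(y, β) ↦ β⁻¹ g (π y + β (y - π y))` extends smoothly across `β = 0`, by the transverse derivative
of `g`. -/
theorem contDiffAt_deformation {E : Type u} [NormedAddCommGroup E] [NormedSpace ℝ E]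
    [FiniteDimensional ℝ E] (π : E →L[ℝ] E) {O : Set E} (hO : IsOpen O) {g : E → E}
    (hg : ContDiffOn ℝ ∞ g O) (h0 : ∀ y, π y ∈ O → g (π y) = 0) {G : E × ℝ → E}
    (hG : ∀ y β, β ≠ 0 → G (y, β) = β⁻¹ • g (π y + β • (y - π y)))
    (hG0 : ∀ y, π y ∈ O → G (y, 0) = fderiv ℝ g (π y) (y - π y))
    {y₀ : E} (hy₀ : π y₀ ∈ O) : ContDiffAt ℝ ∞ G (y₀, 0) := by
  obtain ⟨r, hr, hrO⟩ := Metric.isOpen_iff.1 hO _ hy₀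
  let χ : ContDiffBump (π y₀) := ⟨r / 4, r / 2, by positivity, by linarith⟩
  have hχO : tsupport χ ⊆ O := by
    rw [χ.tsupport_eq]
    exact (Metric.closedBall_subset_ball (by simp only [χ]; linarith)).trans hrO
  let k : E → E := fun y => χ y • g y
  have hk : ContDiff ℝ ∞ k := by
    refine contDiff_iff_contDiffAt.2 fun x => ?_
    by_cases hx : x ∈ tsupport (χ : E → ℝ)
    · exact χ.contDiffAt.smul (hg.contDiffAt (hO.mem_nhds (hχO hx)))
    · refine (contDiffAt_const (c := (0 : E))).congr_of_eventuallyEq ?_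
      filter_upwards [notMem_tsupport_iff_eventuallyEq.1 hx] with y hy
      simp only [Pi.zero_apply] at hy
      simp [k, hy]
  have hk0 : ∀ y, k (π y) = 0 := fun y => by
    by_cases hy : π y ∈ O
    · simp [k, h0 y hy]
    · have : χ (π y) = 0 := image_eq_zero_of_notMem_tsupport fun h => hy (hχO h)
      simp [k, this]
  have hkg : k =ᶠ[𝓝 (π y₀)] g := χ.eventuallyEq_one.mono fun y hy => by
    simp only [Pi.one_apply] at hy
    simp [k, hy]
  let A : (E × ℝ) × ℝ → E := fun q =>
    fderiv ℝ k (π q.1.1 + (q.2 * q.1.2) • (q.1.1 - π q.1.1)) (q.1.1 - π q.1.1)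
  have hA : ContDiff ℝ ∞ A := by
    have h1 : ContDiff ℝ ∞ (fderiv ℝ k) := hk.fderiv_right (by norm_cast)
    have h2 : ContDiff ℝ ∞ (fun q : (E × ℝ) × ℝ =>
      π q.1.1 + (q.2 * q.1.2) • (q.1.1 - π q.1.1)) := by fun_prop
    have h3 : ContDiff ℝ ∞ (fun q : (E × ℝ) × ℝ => q.1.1 - π q.1.1) := by fun_prop
    exact (h1.comp h2).clm_apply h3
  refine (contDiff_integral_param_infty hA).contDiffAt.congr_of_eventuallyEq ?_
  have e1 : ∀ᶠ p : E × ℝ in 𝓝 (y₀, 0), k (π p.1 + p.2 • (p.1 - π p.1)) =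
      g (π p.1 + p.2 • (p.1 - π p.1)) := by
    have hc : ContinuousAt (fun p : E × ℝ => π p.1 + p.2 • (p.1 - π p.1)) (y₀, 0) := by fun_prop
    exact hc.eventually (p := fun z => k z = g z) (by
      simpa using (show ∀ᶠ z in 𝓝 (π y₀), k z = g z from hkg))
  have e2 : ∀ᶠ p : E × ℝ in 𝓝 (y₀, 0), k =ᶠ[𝓝 (π p.1)] g := by
    have hc : ContinuousAt (fun p : E × ℝ => π p.1) (y₀, 0) := by fun_prop
    exact hc.eventually (eventually_eventually_nhds.2 hkg)
  have e3 : ∀ᶠ p : E × ℝ in 𝓝 (y₀, 0), π p.1 ∈ O := by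
    have hc : ContinuousAt (fun p : E × ℝ => π p.1) (y₀, 0) := by fun_prop
    exact hc.eventually (hO.mem_nhds hy₀)
  filter_upwards [e1, e2, e3] with ⟨y, β⟩ h1 h2 h3
  by_cases hβ : β = 0
  · subst hβ
    simp [hG0 y h3, A, h2.fderiv_eq]
  · have hd : ∀ τ : ℝ, HasDerivAt (fun τ : ℝ => β⁻¹ • k (π y + (τ * β) • (y - π y)))
        (A ((y, β), τ)) τ := fun τ => by
      have a1 : HasDerivAt (fun τ : ℝ => π y + (τ * β) • (y - π y)) (β • (y - π y)) τ := by
        simpa using (((hasDerivAt_id τ).mul_const β).smul_const (y - π y)).const_add (π y)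
      have a2 := ((hk.differentiable (by simp)
        (π y + (τ * β) • (y - π y))).hasFDerivAt.comp_hasDerivAt τ a1).const_smul β⁻¹
      simpa [A, smul_smul, hβ, Function.comp_def, Pi.smul_def] using a2
    have hi := intervalIntegral.integral_eq_sub_of_hasDerivAt (a := 0) (b := 1)
      (fun τ _ => hd τ)
      ((hA.continuous.comp (Continuous.prodMk_right (y, β))).intervalIntegrable _ _)
    rw [hi, hG y β hβ, ← h1]
    simp [hk0]

end NormalConeDeformation

/-! ### Submanifolds, normal spaces, adapted charts -/

/-- A smooth submanifold of `U`, given by a manifold `V` with a smooth embedding `V → U` (a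
topological embedding that is an immersion). -/
structure EmbeddedSubmanifold (EV : Type v) [NormedAddCommGroup EV] [NormedSpace ℝ EV]
    (EU : Type u) [NormedAddCommGroup EU] [NormedSpace ℝ EU]
    (V : Type w) [TopologicalSpace V] [ChartedSpace EV V]
    (U : Type z) [TopologicalSpace U] [ChartedSpace EU U] where
  incl : V → U
  isSmoothEmbedding : IsSmoothEmbedding 𝓘(ℝ, EV) 𝓘(ℝ, EU) ∞ incl

namespace EmbeddedSubmanifold

variable {EV : Type v} [NormedAddCommGroup EV] [NormedSpace ℝ EV]
  {EU : Type u} [NormedAddCommGroup EU] [NormedSpace ℝ EU]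
  {V : Type w} [TopologicalSpace V] [ChartedSpace EV V]
  {U : Type z} [TopologicalSpace U] [ChartedSpace EU U]

/-- The normal space `N_v = T_v U / T_v V`. -/
abbrev NormalSpace (j : EmbeddedSubmanifold EV EU V U) (v : V) : Type u :=
  TangentSpace 𝓘(ℝ, EU) (j.incl v) ⧸ (mfderiv 𝓘(ℝ, EV) 𝓘(ℝ, EU) j.incl v).range

/-- A smooth chart `ψ` of `U` adapted to `V`: the set `ψ(V)` is the part of the image of `ψ` in the
range `{y | π y = y}` of a linear projection `π` of the model space (so `π` and `1 - π` give the
coordinates along `V` and transverse to `V`). -/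
structure SliceChart (j : EmbeddedSubmanifold EV EU V U) where
  chart : OpenPartialHomeomorph U EU
  mem_maximalAtlas : chart ∈ IsManifold.maximalAtlas 𝓘(ℝ, EU) ∞ U
  proj : EU →L[ℝ] EU
  proj_proj : ∀ y, proj (proj y) = proj y
  mem_range_iff : ∀ u ∈ chart.source, u ∈ range j.incl ↔ proj (chart u) = chart u

variable (j : EmbeddedSubmanifold EV EU V U)

theorem exists_immersionChart (v : V) :
    ∃ (φ : OpenPartialHomeomorph V EV) (ψ : OpenPartialHomeomorph U EU)
      (e : EV →L[ℝ] EU) (r : EU →L[ℝ] EV),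
      φ ∈ IsManifold.maximalAtlas 𝓘(ℝ, EV) ∞ V ∧ ψ ∈ IsManifold.maximalAtlas 𝓘(ℝ, EU) ∞ U ∧
      v ∈ φ.source ∧ (∀ x ∈ φ.source, j.incl x ∈ ψ.source) ∧ (∀ a, r (e a) = a) ∧
      ∀ x ∈ φ.source, ψ (j.incl x) = e (φ x) := by
  have h := j.isSmoothEmbedding.isImmersion.isImmersionAt v
  refine ⟨h.domChart, h.codChart, h.equiv.toContinuousLinearMap.comp
      (ContinuousLinearMap.inl ℝ EV h.complement),
    (ContinuousLinearMap.fst ℝ EV h.complement).comp h.equiv.symm.toContinuousLinearMap,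
    h.domChart_mem_maximalAtlas, h.codChart_mem_maximalAtlas, h.mem_domChart_source,
    h.source_subset_preimage_source, by simp, fun x hx => ?_⟩
  have hx' : h.domChart x ∈ (h.domChart.extend 𝓘(ℝ, EV)).target := by
    simpa only [mfld_simps] using h.domChart.map_source hx
  have hw := h.writtenInCharts hx'
  simpa [h.domChart.left_inv hx] using hw

theorem mdifferentiable_of_mem_maximalAtlas {E : Type*} [NormedAddCommGroup E] [NormedSpace ℝ E]
    {U : Type*} [TopologicalSpace U] [ChartedSpace E U] {ψ : OpenPartialHomeomorph U E}
    (hψ : ψ ∈ IsManifold.maximalAtlas 𝓘(ℝ, E) ∞ U) :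
    ψ.MDifferentiable 𝓘(ℝ, E) 𝓘(ℝ, E) :=
  ⟨(contMDiffOn_of_mem_maximalAtlas hψ).mdifferentiableOn (by simp),
    (contMDiffOn_symm_of_mem_maximalAtlas hψ).mdifferentiableOn (by simp)⟩

theorem exists_sliceChart (v : V) : ∃ c : SliceChart j, j.incl v ∈ c.chart.source := by
  obtain ⟨φ, ψ, e, r, hφ, hψ, hv, hs, hre, hw⟩ := j.exists_immersionChart v
  obtain ⟨O, hO, hOφ⟩ := j.isSmoothEmbedding.isEmbedding.isInducing.isOpen_iff.1 φ.open_source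
  let S : Set U := O ∩ (ψ.source ∩ ψ ⁻¹' (r ⁻¹' φ.target))
  have hS : IsOpen S :=
    hO.inter (ψ.isOpen_inter_preimage (φ.open_target.preimage r.continuous))
  have hmem : ∀ x, x ∈ φ.source ↔ j.incl x ∈ O := fun x => by rw [← hOφ]; rfl
  refine ⟨⟨ψ.restr S, restr_mem_maximalAtlas _ hψ hS, e.comp r, by simp [hre], ?_⟩, ?_⟩
  · rintro u hu
    rw [ψ.restr_source' S hS] at hu
    obtain ⟨hu1, hu2, -, hu3⟩ := hu
    constructor
    · rintro ⟨x, rfl⟩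
      simp [hw x ((hmem x).2 hu2), hre]
    · intro h
      have h' : e (r (ψ u)) = ψ u := by simpa using h
      refine ⟨φ.symm (r (ψ u)), ?_⟩
      have hx := φ.map_target hu3
      refine ψ.injOn (hs _ hx) hu1 ?_
      rw [hw _ hx, φ.right_inv hu3, h']
  · rw [ψ.restr_source' S hS]
    refine ⟨hs v hv, (hmem v).1 hv, hs v hv, ?_⟩
    simp [hw v hv, hre, φ.map_source hv]

variable {j}

theorem SliceChart.mem_range_mfderiv_iff (c : SliceChart j) {v : V}
    (hv : j.incl v ∈ c.chart.source) (w : TangentSpace 𝓘(ℝ, EU) (j.incl v)) :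
    w ∈ (mfderiv 𝓘(ℝ, EV) 𝓘(ℝ, EU) j.incl v).range ↔
      c.proj (mfderiv 𝓘(ℝ, EU) 𝓘(ℝ, EU) c.chart (j.incl v) w) =
        mfderiv 𝓘(ℝ, EU) 𝓘(ℝ, EU) c.chart (j.incl v) w := by
  obtain ⟨φ, ψ, e, r, hφ, hψ, hvφ, hs, hre, hw⟩ := j.exists_immersionChart v
  have hc := mdifferentiable_of_mem_maximalAtlas c.mem_maximalAtlas
  have hψd := mdifferentiable_of_mem_maximalAtlas hψ
  have hφd := mdifferentiable_of_mem_maximalAtlas hφ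
  have hj : MDifferentiableAt 𝓘(ℝ, EV) 𝓘(ℝ, EU) j.incl v :=
    (j.isSmoothEmbedding.contMDiff.mdifferentiable (by simp)) v
  have hD := (hc.mdifferentiableAt hv).hasMFDerivAt
  have hD0 := (hψd.mdifferentiableAt (hs v hvφ)).hasMFDerivAt
  have hP := (hφd.mdifferentiableAt hvφ).hasMFDerivAt
  constructor
  · rintro ⟨a, rfl⟩
    have h1 : HasMFDerivAt 𝓘(ℝ, EV) 𝓘(ℝ, EU) (fun x => c.chart (j.incl x)) v _ :=
      hD.comp v hj.hasMFDerivAt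
    have h2 : HasMFDerivAt 𝓘(ℝ, EV) 𝓘(ℝ, EU) (fun x => c.proj (c.chart (j.incl x))) v _ :=
      (c.proj.hasMFDerivAt (x := c.chart (j.incl v))).comp v h1
    have h3 : (fun x => c.chart (j.incl x)) =ᶠ[𝓝 v] fun x => c.proj (c.chart (j.incl x)) := by
      have : ∀ᶠ x in 𝓝 v, j.incl x ∈ c.chart.source :=
        hj.continuousAt.eventually (c.chart.open_source.mem_nhds hv)
      filter_upwards [this] with x hx
      exact ((c.mem_range_iff _ hx).1 ⟨x, rfl⟩).symm
    have h4 := hasMFDerivAt_unique (h2.congr_of_eventuallyEq h3) h1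
    exact congrArg (fun f => f a) h4
  · intro h
    set y₀ := c.chart (j.incl v) with hy₀
    set d : EU := mfderiv 𝓘(ℝ, EU) 𝓘(ℝ, EU) c.chart (j.incl v) w with hd
    have hy₀t : y₀ ∈ c.chart.target := c.chart.map_source hv
    have hsymm := (hc.mdifferentiableAt_symm hy₀t).hasMFDerivAt
    have hpt : c.chart.symm y₀ = j.incl v := c.chart.left_inv hv
    have hT : HasMFDerivAt 𝓘(ℝ, EU) 𝓘(ℝ, EU) (fun y => ψ (c.chart.symm y)) y₀
        ((mfderiv 𝓘(ℝ, EU) 𝓘(ℝ, EU) ψ (j.incl v)).comp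
          (mfderiv 𝓘(ℝ, EU) 𝓘(ℝ, EU) c.chart.symm y₀)) := by
      have hD0' : HasMFDerivAt 𝓘(ℝ, EU) 𝓘(ℝ, EU) ψ (c.chart.symm y₀)
        (mfderiv 𝓘(ℝ, EU) 𝓘(ℝ, EU) ψ (j.incl v)) := by rw [hpt]; exact hD0
      exact hD0'.comp y₀ hsymm
    have hT' := hT.hasFDerivAt
    have hline := hT'.hasLineDerivAt d
    have hev : ∀ᶠ t : ℝ in 𝓝 0, e (r (ψ (c.chart.symm (y₀ + t • d)))) =
        ψ (c.chart.symm (y₀ + t • d)) := by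
      obtain ⟨O, hO, hOφ⟩ := j.isSmoothEmbedding.isEmbedding.isInducing.isOpen_iff.1 φ.open_source
      have hmem : ∀ x, x ∈ φ.source ↔ j.incl x ∈ O := fun x => by rw [← hOφ]; rfl
      have hcurve : ContinuousAt (fun t : ℝ => y₀ + t • d) 0 := by fun_prop
      have h0 : y₀ + (0 : ℝ) • d = y₀ := by simp
      have e1 : ∀ᶠ t : ℝ in 𝓝 0, y₀ + t • d ∈ c.chart.target :=
        hcurve.eventually (c.chart.open_target.mem_nhds (by simpa using hy₀t))
      have e2 : ∀ᶠ t : ℝ in 𝓝 0, c.chart.symm (y₀ + t • d) ∈ O := by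
        have hcs : ContinuousAt c.chart.symm (y₀ + (0 : ℝ) • d) := by
          rw [h0]; exact c.chart.continuousAt_symm hy₀t
        have := ContinuousAt.comp (f := fun t : ℝ => y₀ + t • d) hcs hcurve
        refine this.eventually (hO.mem_nhds ?_)
        simp only [Function.comp_apply, h0, hpt]
        exact (hmem v).1 hvφ
      filter_upwards [e1, e2] with t h1 h2
      have hπ : c.proj (y₀ + t • d) = y₀ + t • d := by
        have := (c.mem_range_iff _ hv).1 ⟨v, rfl⟩
        rw [map_add, map_smul]
        exact congrArg₂ (fun a b => a + t • b) this h
      obtain ⟨x, hx⟩ := (c.mem_range_iff _ (c.chart.map_target h1)).2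
        (by rw [c.chart.right_inv h1]; exact hπ)
      rw [← hx] at h2 ⊢
      rw [hw x ((hmem x).2 h2), hre]
    have hwd : mfderiv 𝓘(ℝ, EU) 𝓘(ℝ, EU) c.chart.symm y₀ d = w :=
      congrArg (fun f => f w) (hc.symm_comp_deriv hv)
    set p : EU := mfderiv 𝓘(ℝ, EU) 𝓘(ℝ, EU) ψ (j.incl v) w with hp
    have hline' : HasLineDerivAt ℝ (fun y => ψ (c.chart.symm y)) p y₀ d := by
      exact HasDerivAt.congr_deriv hline
        (congrArg (fun x => mfderiv 𝓘(ℝ, EU) 𝓘(ℝ, EU) ψ (j.incl v) x) hwd)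
    have her : e (r p) = p := by
      have h1 : HasDerivAt (fun t : ℝ => ψ (c.chart.symm (y₀ + t • d))) p 0 := hline'
      have h2 : HasDerivAt (fun t : ℝ => e (r (ψ (c.chart.symm (y₀ + t • d))))) (e (r p)) 0 :=
        (e.comp r).hasFDerivAt.comp_hasDerivAt (0 : ℝ) h1
      exact (h2.congr_of_eventuallyEq (hev.mono fun t ht => ht.symm)).unique h1
    obtain ⟨a, ha⟩ := hφd.mfderiv_surjective hvφ (r p)
    refine ⟨a, hψd.mfderiv_injective (hs v hvφ) ?_⟩
    have h1 : HasMFDerivAt 𝓘(ℝ, EV) 𝓘(ℝ, EU) (fun x => ψ (j.incl x)) v _ :=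
      hD0.comp v hj.hasMFDerivAt
    have h2 : HasMFDerivAt 𝓘(ℝ, EV) 𝓘(ℝ, EU) (fun x => e (φ x)) v _ :=
      (e.hasMFDerivAt (x := φ v)).comp v hP
    have h3 : (fun x => ψ (j.incl x)) =ᶠ[𝓝 v] fun x => e (φ x) := by
      filter_upwards [φ.open_source.mem_nhds hvφ] with x hx using hw x hx
    have h4 := congrArg (fun f => f a) (hasMFDerivAt_unique h1 (h2.congr_of_eventuallyEq h3))
    have h5 : mfderiv 𝓘(ℝ, EU) 𝓘(ℝ, EU) ψ (j.incl v)
        (mfderiv 𝓘(ℝ, EV) 𝓘(ℝ, EU) j.incl v a) =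
        e (mfderiv 𝓘(ℝ, EV) 𝓘(ℝ, EV) φ v a) := h4
    rw [ha] at h5
    exact h5.trans her

end EmbeddedSubmanifold

open EmbeddedSubmanifold

section Deformation

variable {EV : Type v} [NormedAddCommGroup EV] [NormedSpace ℝ EV]
  {EU : Type u} [NormedAddCommGroup EU] [NormedSpace ℝ EU]
  {V : Type w} [TopologicalSpace V] [ChartedSpace EV V]
  {U : Type z} [TopologicalSpace U] [ChartedSpace EU U]

/-- The deformation to the normal cone `D(U, V)`, as a set the disjoint union of `U × ℝ^*` and of
the total space `N` of the normal bundle, placed over `β = 0`. -/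
inductive NormalConeDeformation (j : EmbeddedSubmanifold EV EU V U) : Type (max u w z)
  | off (p : U) (β : ℝ) (hβ : β ≠ 0) : NormalConeDeformation j
  | normal (v : V) (n : j.NormalSpace v) : NormalConeDeformation j

namespace NormalConeDeformation

variable {j : EmbeddedSubmanifold EV EU V U}

/-- The map `q : D(U, V) → U × ℝ`: the identity on `U × ℝ^*`, and the bundle projection of `N`
followed by `v ↦ (v, 0)` on `N`. -/
def proj : NormalConeDeformation j → U × ℝ
  | off p β _ => (p, β)
  | normal v _ => (j.incl v, 0)

/-- Multiplication of the transverse coordinate by `β`. -/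
def scale (π : EU →L[ℝ] EU) (β : ℝ) (y : EU) : EU := π y + β • (y - π y)

theorem proj_scale {π : EU →L[ℝ] EU} (hπ : ∀ y, π (π y) = π y) (β : ℝ) (y : EU) :
    π (scale π β y) = π y := by simp [scale, hπ]

theorem scale_scale {π : EU →L[ℝ] EU} (hπ : ∀ y, π (π y) = π y) {β γ : ℝ} (h : β * γ = 1) (y : EU) :
    scale π β (scale π γ y) = y := by
  simp [scale, hπ, smul_smul, h]

@[simp] theorem scale_zero (π : EU →L[ℝ] EU) (y : EU) : scale π 0 y = π y := by simp [scale]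

/-- The transverse coordinate of a normal vector `n`: it is `(1 - π) (dψ w)` for a representative `w`
of `n`, and does not depend on the representative (`normalCoord_mk`). -/
noncomputable def normalCoord (c : SliceChart j) (v : V) (n : j.NormalSpace v) : EU :=
  let d : EU := mfderiv 𝓘(ℝ, EU) 𝓘(ℝ, EU) c.chart (j.incl v)
    (Function.surjInv (Submodule.mkQ_surjective _) n)
  d - c.proj d

theorem normalCoord_mk (c : SliceChart j) {v : V} (hv : j.incl v ∈ c.chart.source)
    (w : TangentSpace 𝓘(ℝ, EU) (j.incl v)) (d : EU)
    (hd : mfderiv 𝓘(ℝ, EU) 𝓘(ℝ, EU) c.chart (j.incl v) w = d) :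
    normalCoord c v (Submodule.mkQ _ w) = d - c.proj d := by
  set w' := Function.surjInv (Submodule.mkQ_surjective _)
    (Submodule.mkQ (mfderiv 𝓘(ℝ, EV) 𝓘(ℝ, EU) j.incl v).range w) with hw'
  have h1 : Submodule.mkQ (mfderiv 𝓘(ℝ, EV) 𝓘(ℝ, EU) j.incl v).range w' =
    Submodule.mkQ _ w := Function.surjInv_eq _ _
  have h2 : w' - w ∈ (mfderiv 𝓘(ℝ, EV) 𝓘(ℝ, EU) j.incl v).range :=
    (Submodule.Quotient.eq _).1 h1
  rw [c.mem_range_mfderiv_iff hv, map_sub] at h2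
  set d' : EU := mfderiv 𝓘(ℝ, EU) 𝓘(ℝ, EU) c.chart (j.incl v) w' with hd'
  have h3 : c.proj (d' - d) = d' - d := by
    rw [← hd]; exact h2
  change d' - c.proj d' = d - c.proj d
  rw [map_sub] at h3
  rw [sub_eq_sub_iff_sub_eq_sub, ← h3]

theorem normalCoord_injective (c : SliceChart j) {v : V} (hv : j.incl v ∈ c.chart.source) :
    Function.Injective (normalCoord c v) := by
  intro n n' h
  obtain ⟨w, rfl⟩ := Submodule.mkQ_surjective _ n
  obtain ⟨w', rfl⟩ := Submodule.mkQ_surjective _ n'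
  rw [normalCoord_mk c hv w _ rfl, normalCoord_mk c hv w' _ rfl] at h
  refine (Submodule.Quotient.eq _).2 ?_
  rw [c.mem_range_mfderiv_iff hv, map_sub]
  set d : EU := mfderiv 𝓘(ℝ, EU) 𝓘(ℝ, EU) c.chart (j.incl v) w
  set d' : EU := mfderiv 𝓘(ℝ, EU) 𝓘(ℝ, EU) c.chart (j.incl v) w'
  have : c.proj (d - d') = d - d' := by
    rw [map_sub]
    rw [sub_eq_sub_iff_sub_eq_sub] at h
    exact h.symm
  exact this

theorem proj_normalCoord (c : SliceChart j) (v : V) (n : j.NormalSpace v) :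
    c.proj (normalCoord c v n) = 0 := by
  have key : ∀ d : EU, c.proj (d - c.proj d) = 0 := fun d => by
    rw [map_sub, c.proj_proj, sub_self]
  exact key _

/-- With `ψ = (ψ₁, ψ₂)` split along and transverse to `V`, the map
`(p, β) ↦ (ψ₁ p, ψ₂ p / β, β)` for `β ≠ 0` and `(v, n) ↦ (ψ₁ v, dψ₂ n, 0)` on `N`. -/
noncomputable def sliceFun (c : SliceChart j) : NormalConeDeformation j → EU × ℝ
  | off p β _ => (scale c.proj β⁻¹ (c.chart p), β)
  | normal v n => (c.chart (j.incl v) + normalCoord c v n, 0)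

theorem sliceFun_snd (c : SliceChart j) (x : NormalConeDeformation j) :
    (sliceFun c x).2 = x.proj.2 := by cases x <;> rfl

theorem scale_sliceFun (c : SliceChart j) {x : NormalConeDeformation j}
    (hx : x.proj.1 ∈ c.chart.source) :
    scale c.proj (sliceFun c x).2 (sliceFun c x).1 = c.chart x.proj.1 := by
  cases x with
  | off p β hβ => exact scale_scale c.proj_proj (mul_inv_cancel₀ hβ) _
  | normal v n =>
    have : c.proj (c.chart (j.incl v)) = c.chart (j.incl v) :=
      (c.mem_range_iff _ hx).1 ⟨v, rfl⟩
    simp [sliceFun, proj_normalCoord, this, proj]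

theorem exists_normal (c : SliceChart j) {y : EU} (hy : c.proj y ∈ c.chart.target) :
    ∃ (v : V) (w : TangentSpace 𝓘(ℝ, EU) (j.incl v)), j.incl v ∈ c.chart.source ∧
      c.chart (j.incl v) = c.proj y ∧
      mfderiv 𝓘(ℝ, EU) 𝓘(ℝ, EU) c.chart (j.incl v) w = y - c.proj y ∧
      sliceFun c (normal v (Submodule.mkQ _ w)) = (y, 0) := by
  have hs := c.chart.map_target hy
  obtain ⟨v, hv⟩ := (c.mem_range_iff _ hs).2 (by rw [c.chart.right_inv hy, c.proj_proj])
  rw [← hv] at hs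
  have hv' : c.chart (j.incl v) = c.proj y := by rw [hv, c.chart.right_inv hy]
  obtain ⟨w, hw⟩ := (mdifferentiable_of_mem_maximalAtlas c.mem_maximalAtlas).mfderiv_surjective hs
    (y - c.proj y)
  refine ⟨v, w, hs, hv', hw, ?_⟩
  simp only [sliceFun]
  rw [normalCoord_mk c hs w _ hw, hv', map_sub, c.proj_proj, sub_self, sub_zero,
    add_sub_cancel]

theorem bijOn_sliceFun (c : SliceChart j) :
    BijOn (sliceFun c) {x | x.proj.1 ∈ c.chart.source}
      {p | scale c.proj p.2 p.1 ∈ c.chart.target} := by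
  refine ⟨fun x hx => ?_, fun x hx x' hx' h => ?_, fun p hp => ?_⟩
  · change scale c.proj _ _ ∈ c.chart.target
    rw [scale_sliceFun c hx]
    exact c.chart.map_source hx
  · have h1 : x.proj.1 = x'.proj.1 := by
      refine c.chart.injOn hx hx' ?_
      rw [← scale_sliceFun c hx, ← scale_sliceFun c hx', h]
    have h2 : x.proj.2 = x'.proj.2 := by rw [← sliceFun_snd c, ← sliceFun_snd c, h]
    cases x with
    | off p β hβ =>
      cases x' with
      | off p' β' hβ' =>
        simp only [proj] at h1 h2
        subst h1 h2
        rfl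
      | normal v n => exact absurd h2 hβ
    | normal v n =>
      cases x' with
      | off p' β' hβ' => exact absurd h2.symm hβ'
      | normal v' n' =>
        have h3 := j.isSmoothEmbedding.isEmbedding.injective h1
        subst h3
        have h4 := congrArg Prod.fst h
        simp only [sliceFun, add_right_inj] at h4
        rw [normalCoord_injective c hx h4]
  · obtain ⟨y, β⟩ := p
    by_cases hβ : β = 0
    · subst hβ
      obtain ⟨v, w, h1, -, -, h2⟩ := exists_normal c (y := y) (by simpa using hp)
      exact ⟨_, h1, h2⟩
    · refine ⟨off (c.chart.symm (scale c.proj β y)) β hβ, c.chart.map_target hp, ?_⟩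
      simp only [sliceFun]
      rw [c.chart.right_inv hp, scale_scale c.proj_proj (inv_mul_cancel₀ hβ)]

/-- The chart of `D(U, V)` defined by an adapted chart `ψ` of `U`: its domain is the preimage of the
domain of `ψ`, its image is `{(y₁, y₂, β) | (y₁, β y₂) in the image of ψ}`. -/
noncomputable def sliceChart (c : SliceChart j) :
    PartialEquiv (NormalConeDeformation j) (EU × ℝ) :=
  haveI : Nonempty (NormalConeDeformation j) := ⟨off (c.chart.symm 0) 1 one_ne_zero⟩
  (bijOn_sliceFun c).toPartialEquiv _ _ _

open Classical in
/-- The chart `ψ × id` on the part `U × ℝ^*` of `D(U, V)`. -/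
noncomputable def offChart (j : EmbeddedSubmanifold EV EU V U) (ψ : OpenPartialHomeomorph U EU) :
    PartialEquiv (NormalConeDeformation j) (EU × ℝ) where
  toFun x := (ψ x.proj.1, x.proj.2)
  invFun p := if h : p.2 ≠ 0 then off (ψ.symm p.1) p.2 h else off (ψ.symm p.1) 1 one_ne_zero
  source := {x | x.proj.1 ∈ ψ.source ∧ x.proj.2 ≠ 0}
  target := {p | p.1 ∈ ψ.target ∧ p.2 ≠ 0}
  map_source' x hx := ⟨ψ.map_source hx.1, hx.2⟩
  map_target' p hp := by
    rw [dif_pos hp.2]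
    exact ⟨ψ.map_target hp.1, hp.2⟩
  left_inv' x hx := by
    rw [dif_pos hx.2]
    cases x with
    | off p β hβ =>
      have : ψ.symm (ψ p) = p := ψ.left_inv hx.1
      simp [proj, this]
    | normal v n => exact absurd rfl hx.2
  right_inv' p hp := by
    rw [dif_pos hp.2]
    simp [proj, ψ.right_inv hp.1]

/-- What the two kinds of charts have in common (auxiliary, for the coordinate changes). -/
structure IsDeformationChart (e : PartialEquiv (NormalConeDeformation j) (EU × ℝ))
    (ψ : OpenPartialHomeomorph U EU) (π : EU →L[ℝ] EU) (T : Prop) : Prop where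
  mem : ψ ∈ IsManifold.maximalAtlas 𝓘(ℝ, EU) ∞ U
  idem : ∀ y, π (π y) = π y
  source : ∀ x, x ∈ e.source ↔ x.proj.1 ∈ ψ.source ∧ (x.proj.2 ≠ 0 ∨ T)
  target : ∀ p, p ∈ e.target ↔ scale π p.2 p.1 ∈ ψ.target ∧ (p.2 ≠ 0 ∨ T)
  snd : ∀ x, (e x).2 = x.proj.2
  scale_eq : ∀ x ∈ e.source, scale π (e x).2 (e x).1 = ψ x.proj.1
  slice : T → ∃ c : SliceChart j, c.chart = ψ ∧ c.proj = π ∧ e = sliceChart c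

theorem isDeformationChart_slice (c : SliceChart j) :
    IsDeformationChart (sliceChart c) c.chart c.proj True where
  mem := c.mem_maximalAtlas
  idem := c.proj_proj
  source x := by simp [sliceChart]
  target p := by simp [sliceChart]
  snd x := sliceFun_snd c x
  scale_eq x hx := scale_sliceFun c hx
  slice _ := ⟨c, rfl, rfl, rfl⟩

theorem isDeformationChart_off {ψ : OpenPartialHomeomorph U EU}
    (hψ : ψ ∈ IsManifold.maximalAtlas 𝓘(ℝ, EU) ∞ U) :
    IsDeformationChart (offChart j ψ) ψ (ContinuousLinearMap.id ℝ EU) False where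
  mem := hψ
  idem := by simp
  source x := by simp [offChart]
  target p := by simp [offChart, scale]
  snd x := rfl
  scale_eq x _ := by simp [offChart, scale]
  slice h := h.elim

section Transition

variable {e e' : PartialEquiv (NormalConeDeformation j) (EU × ℝ)}
  {ψ ψ' : OpenPartialHomeomorph U EU} {π π' : EU →L[ℝ] EU} {T T' : Prop}

theorem IsDeformationChart.symm_proj (h : IsDeformationChart e ψ π T) {p : EU × ℝ}
    (hp : p ∈ e.target) : (e.symm p).proj = (ψ.symm (scale π p.2 p.1), p.2) := by
  have hx := e.map_target hp
  have h1 := h.scale_eq _ hx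
  have h2 := h.snd (e.symm p)
  rw [e.right_inv hp] at h1 h2
  rw [h1, ψ.left_inv ((h.source _).1 hx).1, h2]

theorem continuous_scale (π : EU →L[ℝ] EU) :
    Continuous (fun p : EU × ℝ => scale π p.2 p.1) := by unfold scale; fun_prop

theorem contDiff_scale (π : EU →L[ℝ] EU) :
    ContDiff ℝ ∞ (fun p : EU × ℝ => scale π p.2 p.1) := by unfold scale; fun_prop

theorem IsDeformationChart.mem_trans_source_iff (h : IsDeformationChart e ψ π T)
    (h' : IsDeformationChart e' ψ' π' T') (p : EU × ℝ) :
    p ∈ (e.symm.trans e').source ↔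
      scale π p.2 p.1 ∈ (ψ.symm.trans ψ').source ∧ (p.2 ≠ 0 ∨ (T ∧ T')) := by
  rw [PartialEquiv.trans_source, PartialEquiv.symm_source, mem_inter_iff, mem_preimage,
    OpenPartialHomeomorph.trans_source, OpenPartialHomeomorph.symm_source, mem_inter_iff,
    mem_preimage]
  constructor
  · rintro ⟨hp, hx⟩
    rw [h'.source, h.symm_proj hp] at hx
    rw [h.target] at hp
    exact ⟨⟨hp.1, hx.1⟩, by tauto⟩
  · rintro ⟨⟨h1, h2⟩, h3⟩
    have hp : p ∈ e.target := (h.target p).2 ⟨h1, by tauto⟩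
    refine ⟨hp, ?_⟩
    rw [h'.source, h.symm_proj hp]
    exact ⟨h2, by tauto⟩

theorem IsDeformationChart.isOpen_trans_source (h : IsDeformationChart e ψ π T)
    (h' : IsDeformationChart e' ψ' π' T') : IsOpen (e.symm.trans e').source := by
  have h1 : IsOpen {p : EU × ℝ | scale π p.2 p.1 ∈ (ψ.symm.trans ψ').source} :=
    (ψ.symm.trans ψ').open_source.preimage (continuous_scale π)
  have h2 : IsOpen {p : EU × ℝ | p.2 ≠ 0} := isOpen_ne.preimage continuous_snd
  have h3 : (e.symm.trans e').source = {p : EU × ℝ | scale π p.2 p.1 ∈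
      (ψ.symm.trans ψ').source} ∩ ({p | p.2 ≠ 0} ∪ {_p | T ∧ T'}) := by
    ext p
    exact h.mem_trans_source_iff h' p
  rw [h3]
  exact h1.inter (h2.union isOpen_const)

theorem contDiffOn_transition (hψ : ψ ∈ IsManifold.maximalAtlas 𝓘(ℝ, EU) ∞ U)
    (hψ' : ψ' ∈ IsManifold.maximalAtlas 𝓘(ℝ, EU) ∞ U) :
    ContDiffOn ℝ ∞ (ψ.symm.trans ψ') (ψ.symm.trans ψ').source := by
  rw [← contMDiffOn_iff_contDiffOn]
  exact (contMDiffOn_of_mem_maximalAtlas hψ').comp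
    ((contMDiffOn_symm_of_mem_maximalAtlas hψ).mono inter_subset_left) inter_subset_right

variable [FiniteDimensional ℝ EU]

theorem IsDeformationChart.contDiffOn (h : IsDeformationChart e ψ π T)
    (h' : IsDeformationChart e' ψ' π' T') :
    ContDiffOn ℝ ∞ (e.symm.trans e') (e.symm.trans e').source := by
  have hopen := h.isOpen_trans_source h'
  set S := (e.symm.trans e').source with hS
  set O := (ψ.symm.trans ψ').source with hO
  have hOopen : IsOpen O := (ψ.symm.trans ψ').open_source
  let t : EU → EU := fun y => ψ' (ψ.symm y)
  have htd : ContDiffOn ℝ ∞ t O := contDiffOn_transition h.mem h'.mem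
  have hmem : ∀ p ∈ S, scale π p.2 p.1 ∈ O ∧ (p.2 ≠ 0 ∨ (T ∧ T')) := fun p hp =>
    (h.mem_trans_source_iff h' p).1 hp
  -- the relation between the two charts
  have hrel : ∀ p ∈ S, (e' (e.symm p)).2 = p.2 ∧
      scale π' p.2 (e' (e.symm p)).1 = t (scale π p.2 p.1) := fun p hp => by
    have h1 : (e' (e.symm p)).2 = p.2 := by rw [h'.snd, h.symm_proj hp.1]
    refine ⟨h1, ?_⟩
    have h2 := h'.scale_eq (e.symm p) hp.2
    rw [h.symm_proj hp.1, h1] at h2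
    exact h2
  have hcomp : ∀ p ∈ S, ContDiffAt ℝ ∞ (fun p : EU × ℝ => t (scale π p.2 p.1)) p :=
    fun p hp => ContDiffAt.comp (g := t) p (htd.contDiffAt (hOopen.mem_nhds (hmem p hp).1))
      (contDiff_scale π).contDiffAt
  intro p hp
  refine ContDiffAt.contDiffWithinAt ?_
  change ContDiffAt ℝ ∞ (fun q => e' (e.symm q)) p
  by_cases hβ : p.2 = 0
  · obtain ⟨hT, hT'⟩ := (hmem p hp).2.resolve_left (not_not.2 hβ)
    obtain ⟨c, rfl, rfl, rfl⟩ := h.slice hT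
    obtain ⟨c', rfl, rfl, rfl⟩ := h'.slice hT'
    let g : EU → EU := fun y => t y - c'.proj (t y)
    have hg : ContDiffOn ℝ ∞ g O := htd.sub (c'.proj.contDiff.comp_contDiffOn htd)
    have hg0 : ∀ y, c.proj y ∈ O → g (c.proj y) = 0 := fun y hy => by
      have h1 : c.chart.symm (c.proj y) ∈ range j.incl :=
        (c.mem_range_iff _ (c.chart.map_target hy.1)).2
          (by rw [c.chart.right_inv hy.1, c.proj_proj])
      have h2 := (c'.mem_range_iff _ hy.2).1 h1
      simp only [g]
      rw [sub_eq_zero]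
      exact h2.symm
    let G : EU × ℝ → EU := fun q => if q.2 = 0 then fderiv ℝ g (c.proj q.1) (q.1 - c.proj q.1)
      else q.2⁻¹ • g (scale c.proj q.2 q.1)
    have hGsm : ContDiffAt ℝ ∞ G p := by
      have hp1 : c.proj p.1 ∈ O := by
        have := (hmem p hp).1
        rwa [hβ, scale_zero] at this
      have := NormalConeDeformation.contDiffAt_deformation c.proj hOopen hg hg0 (G := G)
        (fun y β hβ => by simp [G, hβ, scale]) (fun y _ => by simp [G]) hp1
      rwa [← hβ] at this
    have hkey : ∀ q ∈ S, (sliceChart c' ((sliceChart c).symm q)) =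
        (c'.proj (t (scale c.proj q.2 q.1)) + G q, q.2) := fun q hq => by
      obtain ⟨h1, h2⟩ := hrel q hq
      refine Prod.ext ?_ h1
      set x' := (sliceChart c' ((sliceChart c).symm q)).1 with hx'
      by_cases hq0 : q.2 = 0
      · obtain ⟨y, β⟩ := q
        simp only at hq0 h2
        subst hq0
        have hy : c.proj y ∈ O := by simpa using (hmem _ hq).1
        obtain ⟨v, w, hv1, hv2, hv3, hv4⟩ := exists_normal c hy.1
        have hv5 : (sliceChart c).symm (y, 0) = normal v (Submodule.mkQ _ w) := by
          have := (sliceChart c).left_inv (x := normal v (Submodule.mkQ _ w)) hv1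
          rwa [show sliceChart c (normal v (Submodule.mkQ _ w)) = (y, 0) from hv4] at this
        have hv6 : c.chart.symm (c.proj y) = j.incl v := by
          rw [← hv2, c.chart.left_inv hv1]
        have hv7 : j.incl v ∈ c'.chart.source := by
          have := hy.2
          rw [mem_preimage] at this
          rw [← hv6]; exact this
        have ht1 : t (c.proj y) = c'.chart (j.incl v) := by
          rw [← hv6]
        let d' : EU := mfderiv 𝓘(ℝ, EU) 𝓘(ℝ, EU) c'.chart (j.incl v) w
        have hx'' : x' = c'.chart (j.incl v) + (d' - c'.proj d') := by
          rw [hx', hv5, ← normalCoord_mk c' hv7 w d' rfl]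
          rfl
        have hcd := mdifferentiable_of_mem_maximalAtlas c.mem_maximalAtlas
        have hcd' := mdifferentiable_of_mem_maximalAtlas c'.mem_maximalAtlas
        have hD := (hcd.mdifferentiableAt_symm hy.1).hasMFDerivAt
        have hD' : HasMFDerivAt 𝓘(ℝ, EU) 𝓘(ℝ, EU) c'.chart (c.chart.symm (c.proj y))
            (mfderiv 𝓘(ℝ, EU) 𝓘(ℝ, EU) c'.chart (j.incl v)) := by
          rw [hv6]
          exact (hcd'.mdifferentiableAt hv7).hasMFDerivAt
        have hder : HasFDerivAt t _ (c.proj y) := (hD'.comp _ hD).hasFDerivAt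
        have hw1 : mfderiv 𝓘(ℝ, EU) 𝓘(ℝ, EU) c.chart.symm (c.proj y) (y - c.proj y) = w := by
          have h5 := congrArg (fun f => f w) (hcd.symm_comp_deriv hv1)
          have h6 : mfderiv 𝓘(ℝ, EU) 𝓘(ℝ, EU) c.chart.symm (c.chart (j.incl v))
            (mfderiv 𝓘(ℝ, EU) 𝓘(ℝ, EU) c.chart (j.incl v) w) = w := h5
          rw [hv3, hv2] at h6
          exact h6
        have hgd : HasFDerivAt g _ (c.proj y) :=
          hder.sub (c'.proj.hasFDerivAt.comp (c.proj y) hder)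
        have hG : G (y, 0) = d' - c'.proj d' := by
          simp only [G, if_true]
          rw [hgd.fderiv]
          have h7 : mfderiv 𝓘(ℝ, EU) 𝓘(ℝ, EU) c'.chart (j.incl v)
              (mfderiv 𝓘(ℝ, EU) 𝓘(ℝ, EU) c.chart.symm (c.proj y) (y - c.proj y)) = d' :=
            congrArg (fun x => mfderiv 𝓘(ℝ, EU) 𝓘(ℝ, EU) c'.chart (j.incl v) x) hw1
          exact congrArg (fun x : EU => x - c'.proj x) h7
        have hfix : c'.proj (c'.chart (j.incl v)) = c'.chart (j.incl v) :=
          (c'.mem_range_iff _ hv7).1 ⟨v, rfl⟩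
        rw [hx'', hG, scale_zero, ht1, hfix]
      · have h3 : c'.proj x' = c'.proj (t (scale c.proj q.2 q.1)) := by
          rw [← h2, proj_scale c'.proj_proj]
        simp only [G, hq0, if_false, g]
        rw [← h2, proj_scale c'.proj_proj]
        simp [scale, smul_smul, hq0]
    have hsm : ContDiffAt ℝ ∞ (fun q : EU × ℝ =>
        (c'.proj (t (scale c.proj q.2 q.1)) + G q, q.2)) p :=
      ((c'.proj.contDiff.contDiffAt.comp p (hcomp p hp)).add hGsm).prodMk contDiffAt_snd
    exact hsm.congr_of_eventuallyEq (Filter.mem_of_superset (hopen.mem_nhds hp) hkey)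
  · have hsm : ContDiffAt ℝ ∞ (fun q : EU × ℝ =>
        (scale π' q.2⁻¹ (t (scale π q.2 q.1)), q.2)) p := by
      refine ContDiffAt.prodMk ?_ contDiffAt_snd
      have h1 : ContDiffAt ℝ ∞ (fun q : EU × ℝ => q.2⁻¹) p := contDiffAt_snd.inv hβ
      have h2 : ContDiffAt ℝ ∞ (fun q : EU × ℝ => (t (scale π q.2 q.1), q.2⁻¹)) p :=
        (hcomp p hp).prodMk h1
      exact (contDiff_scale π').contDiffAt.comp p h2
    refine hsm.congr_of_eventuallyEq ?_
    have hne : ∀ᶠ q : EU × ℝ in 𝓝 p, q.2 ≠ 0 :=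
      continuousAt_snd.eventually (isOpen_ne.mem_nhds hβ)
    filter_upwards [hopen.mem_nhds hp, hne] with q hq hq0
    obtain ⟨h1, h2⟩ := hrel q hq
    refine Prod.ext ?_ h1
    rw [← h2, scale_scale h'.idem (inv_mul_cancel₀ hq0)]

end Transition

variable (j) in
/-- The atlas of `D(U, V)`. -/
def deformationAtlas : Set (PartialEquiv (NormalConeDeformation j) (EU × ℝ)) :=
  {e | (∃ c : SliceChart j, e = sliceChart c) ∨
    ∃ ψ ∈ IsManifold.maximalAtlas 𝓘(ℝ, EU) ∞ U, e = offChart j ψ}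

theorem isDeformationChart_of_mem {e : PartialEquiv (NormalConeDeformation j) (EU × ℝ)}
    (he : e ∈ deformationAtlas j) : ∃ ψ π T, IsDeformationChart e ψ π T := by
  rcases he with ⟨c, rfl⟩ | ⟨ψ, hψ, rfl⟩
  · exact ⟨_, _, _, isDeformationChart_slice c⟩
  · exact ⟨_, _, _, isDeformationChart_off hψ⟩

variable [FiniteDimensional ℝ EU]

theorem contDiffOn_of_mem_deformationAtlas
    {e e' : PartialEquiv (NormalConeDeformation j) (EU × ℝ)}
    (he : e ∈ deformationAtlas j) (he' : e' ∈ deformationAtlas j) :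
    ContDiffOn ℝ ∞ (e.symm.trans e') (e.symm.trans e').source := by
  obtain ⟨ψ, π, T, h⟩ := isDeformationChart_of_mem he
  obtain ⟨ψ', π', T', h'⟩ := isDeformationChart_of_mem he'
  exact h.contDiffOn h'

variable [IsManifold 𝓘(ℝ, EU) ∞ U]

variable (j) in
noncomputable def chartedSpaceCore : ChartedSpaceCore (EU × ℝ) (NormalConeDeformation j) where
  atlas := deformationAtlas j
  chartAt
    | off p _ _ => offChart j (chartAt EU p)
    | normal v _ => sliceChart (j.exists_sliceChart v).choose
  mem_chart_source
    | off p _ hβ => ⟨mem_chart_source EU p, hβ⟩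
    | normal v _ => (j.exists_sliceChart v).choose_spec
  chart_mem_atlas
    | off p _ _ => Or.inr ⟨_, IsManifold.chart_mem_maximalAtlas p, rfl⟩
    | normal v _ => Or.inl ⟨_, rfl⟩
  open_source e e' he he' := by
    obtain ⟨ψ, π, T, h⟩ := isDeformationChart_of_mem he
    obtain ⟨ψ', π', T', h'⟩ := isDeformationChart_of_mem he'
    exact h.isOpen_trans_source h'
  continuousOn_toFun e e' he he' := (contDiffOn_of_mem_deformationAtlas he he').continuousOn

/-- The topology of `D(U, V)`, for which the charts are homeomorphisms onto open sets. -/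
noncomputable instance : TopologicalSpace (NormalConeDeformation j) :=
  (chartedSpaceCore j).toTopologicalSpace

/-- The smooth structure of `D(U, V)`, defined by the charts. -/
noncomputable instance : ChartedSpace (EU × ℝ) (NormalConeDeformation j) :=
  (chartedSpaceCore j).toChartedSpace

instance : IsManifold 𝓘(ℝ, EU × ℝ) ∞ (NormalConeDeformation j) := by
  refine isManifold_of_contDiffOn _ _ _ fun e e' he he' => ?_
  change e ∈ ⋃ (e : PartialEquiv (NormalConeDeformation j) (EU × ℝ))
    (he : e ∈ (chartedSpaceCore j).atlas), {(chartedSpaceCore j).openPartialHomeomorph e he} at he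
  change e' ∈ ⋃ (e : PartialEquiv (NormalConeDeformation j) (EU × ℝ))
    (he : e ∈ (chartedSpaceCore j).atlas), {(chartedSpaceCore j).openPartialHomeomorph e he} at he'
  simp only [mem_iUnion, mem_singleton_iff] at he he'
  obtain ⟨f, hf, rfl⟩ := he
  obtain ⟨f', hf', rfl⟩ := he'
  have := contDiffOn_of_mem_deformationAtlas hf hf'
  refine ContDiffOn.mono this ?_
  intro p hp
  exact hp.1

end NormalConeDeformation

end Deformation

/-! ### Foliations and bi-submersions -/

section Foliation

variable {E : Type*} [NormedAddCommGroup E] [NormedSpace ℝ E]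
  {H : Type*} [TopologicalSpace H] (I : ModelWithCorners ℝ E H)
  {M : Type*} [TopologicalSpace M] [ChartedSpace H M] [IsManifold I ∞ M]

/-- Elements of `C_c^∞(M; TM)`. -/
def IsSmoothCompactField (X : ∀ x : M, TangentSpace I x) : Prop :=
  ContMDiff I I.tangent ∞ (fun x => (⟨x, X x⟩ : TangentBundle I M)) ∧
    IsCompact (closure {x | X x ≠ 0})

/-- A (singular) foliation: a locally finitely generated `C^∞(M)`-submodule of `C_c^∞(M; TM)` stable
under Lie brackets. -/
structure IsFoliation (F : Set (∀ x : M, TangentSpace I x)) : Prop where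
  smooth : ∀ X ∈ F, IsSmoothCompactField I X
  zero_mem : 0 ∈ F
  add_mem : ∀ X ∈ F, ∀ Y ∈ F, X + Y ∈ F
  smul_mem : ∀ f : M → ℝ, ContMDiff I 𝓘(ℝ) ∞ f → ∀ X ∈ F, (fun x => f x • X x) ∈ F
  lie_mem : ∀ X ∈ F, ∀ Y ∈ F, VectorField.mlieBracket I X Y ∈ F
  locally_fg : ∀ x₀ : M, ∃ W : Set M, IsOpen W ∧ x₀ ∈ W ∧
    ∃ (k : ℕ) (X : Fin k → ∀ x : M, TangentSpace I x), (∀ i, X i ∈ F) ∧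
      ∀ Y ∈ F, closure {x | Y x ≠ 0} ⊆ W →
        ∃ f : Fin k → M → ℝ, (∀ i, ContMDiff I 𝓘(ℝ) ∞ (f i) ∧ HasCompactSupport (f i) ∧
          tsupport (f i) ⊆ W) ∧ ∀ x, Y x = ∑ i, f i x • X i x

variable {E' : Type*} [NormedAddCommGroup E'] [NormedSpace ℝ E']
  {H' : Type*} [TopologicalSpace H'] (J : ModelWithCorners ℝ E' H')
  {U : Type*} [TopologicalSpace U] [ChartedSpace H' U] [IsManifold J ∞ U]

/-- `C_c^∞(U; ker dp)`. -/
def verticalFields (p : U → M) : Set (∀ u : U, TangentSpace J u) :=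
  {Y | IsSmoothCompactField J Y ∧ ∀ u, mfderiv J I p u (Y u) = 0}

/-- The pull-back `p⁻¹(F)` by a submersion `p : U → M`: the fields `Y ∈ C_c^∞(U; TU)` such that
`dp(Y)` is a finite sum `∑ fᵢ (Xᵢ ∘ p)` with `fᵢ ∈ C_c^∞(U)` and `Xᵢ ∈ F`. -/
def pullbackFoliation (F : Set (∀ x : M, TangentSpace I x)) (p : U → M) :
    Set (∀ u : U, TangentSpace J u) :=
  {Y | IsSmoothCompactField J Y ∧
    ∃ (k : ℕ) (f : Fin k → U → ℝ) (X : Fin k → ∀ x : M, TangentSpace I x),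
      (∀ i, ContMDiff J 𝓘(ℝ) ∞ (f i) ∧ HasCompactSupport (f i) ∧ X i ∈ F) ∧
      ∀ u, mfderiv J I p u (Y u) = ∑ i, f i u • X i (p u)}

/-- `(U, t, s)` is a bi-submersion of the foliated manifold `(M, F)`. -/
structure IsBisubmersion (F : Set (∀ x : M, TangentSpace I x)) (t s : U → M) : Prop where
  t2Space : T2Space U
  secondCountable : SecondCountableTopology U
  isFoliation : IsFoliation I F
  submersion_t : IsSubmersion J I ∞ t
  submersion_s : IsSubmersion J I ∞ s
  pullback_eq : pullbackFoliation I J F s = pullbackFoliation I J F t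
  pullback_eq_add : pullbackFoliation I J F s =
    {Y | ∃ Y₁ ∈ verticalFields I J s, ∃ Y₂ ∈ verticalFields I J t, Y = Y₁ + Y₂}

variable {I} in
/-- The extension `X ⊗ 1` of a vector field `X` of `M` to `M × ℝ`, tangent along `M`. -/
def extendField (X : ∀ x : M, TangentSpace I x) (p : M × ℝ) : TangentSpace (I.prod 𝓘(ℝ)) p :=
  (X p.1, (0 : ℝ))

/-- The adiabatic foliation on `M × ℝ`: the finite sums `∑ λ fᵢ (Xᵢ ⊗ 1)` with
`fᵢ ∈ C_c^∞(M × ℝ)` and `Xᵢ ∈ F`, where `λ` is the second projection of `M × ℝ`. -/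
def adiabaticFoliation (F : Set (∀ x : M, TangentSpace I x)) :
    Set (∀ p : M × ℝ, TangentSpace (I.prod 𝓘(ℝ)) p) :=
  {Y | ∃ (k : ℕ) (f : Fin k → M × ℝ → ℝ) (X : Fin k → ∀ x : M, TangentSpace I x),
      (∀ i, ContMDiff (I.prod 𝓘(ℝ)) 𝓘(ℝ) ∞ (f i) ∧ HasCompactSupport (f i) ∧ X i ∈ F) ∧
      ∀ p, Y p = ∑ i, (p.2 * f i p) • extendField (X i) p}

variable {E'' : Type*} [NormedAddCommGroup E''] [NormedSpace ℝ E'']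
  {H'' : Type*} [TopologicalSpace H''] (J' : ModelWithCorners ℝ E'' H'')
  {U' : Type*} [TopologicalSpace U'] [ChartedSpace H'' U']

/-- `(U', t', s')` is adapted to (the family that consists of) `(U, t, s)`: near every point of `U'`
there is a morphism of bi-submersions to `U`. -/
def IsAdaptedTo (t' s' : U' → M) (t s : U → M) : Prop :=
  ∀ u' : U', ∃ W : Set U', IsOpen W ∧ u' ∈ W ∧
    ∃ f : U' → U, ContMDiffOn J' J ∞ f W ∧ ∀ x ∈ W, s (f x) = s' x ∧ t (f x) = t' x

end Foliation

section IdentityBisection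

variable {E : Type*} [NormedAddCommGroup E] [NormedSpace ℝ E]
  {M : Type*} [TopologicalSpace M] [ChartedSpace E M]
  {EU : Type*} [NormedAddCommGroup EU] [NormedSpace ℝ EU]
  {U : Type*} [TopologicalSpace U] [ChartedSpace EU U]
  {V : Type*} [TopologicalSpace V] [ChartedSpace E V]

/-- The submanifold `V` of `U` is an identity bisection of `(U, t, s)`: the restrictions of `s` and
`t` to `V` coincide and are étale. As `V` is étale over `M`, it is modelled on the same space. -/
structure IsIdentityBisection (t s : U → M) (j : EmbeddedSubmanifold E EU V U) : Prop where
  coincide : ∀ v, s (j.incl v) = t (j.incl v)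
  etale : IsLocalDiffeomorph 𝓘(ℝ, E) 𝓘(ℝ, E) ∞ (fun v => s (j.incl v))

/-- The map `(p × id) ∘ q : D(U, V) → M × ℝ` defined by `p : U → M`. -/
def deformationMap (j : EmbeddedSubmanifold E EU V U) (p : U → M) :
    NormalConeDeformation j → M × ℝ :=
  fun x => (p x.proj.1, x.proj.2)

end IdentityBisection

/-! The two equations that define a bi-submersion are first replaced by a local condition.
`SweepsOut` for (s, t) says that dt maps every s-vertical field to a field along t that is locally a
combination of the X ∘ t with X in F, and that every X in F lifts locally along t to an s-vertical
field. A bi-submersion has this property for (s, t) and for (t, s) (`sweepsOut_of_isBisubmersion`).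
Conversely, a partition of unity turns it into t⁻¹(F) = C_c^∞(ker ds) + C_c^∞(ker dt), whose
right-hand side is symmetric in s and t (`isBisubmersion_of_sweepsOut`).

For (a), since s is étale on V, there are charts U ≈ E × N in which s is the projection to E and V
is the zero section (`exists_sliceChart_isSubmersionChart`). Then D(U, V) has coordinates (x, k, β),
in which q is (x, k, β) ↦ (x, βk, β) and s ∘ q is (x, k, β) ↦ (x, β). The fields vertical for s ∘ q
point in the direction of N, and d(t ∘ q) maps a vertical vector ξ to β dt(ξ). This factor β is the
λ of the adiabatic foliation, so both halves of `SweepsOut` pass from F on U to the adiabatic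
foliation on D(U, V) (`sweepsOut_deformation`). Where β ≠ 0 the chart ψ × id is enough, because β is
invertible there. The adiabatic foliation is stable under brackets by the Leibniz rule: every term
of [λf (X ⊗ 1), λg (Y ⊗ 1)] keeps a factor λ and a compactly supported coefficient.

For (b), over β ≠ 0 the given local morphisms U' → U, times the identity, suffice. Over β = 0 a
local morphism is needed that maps V' into V: by Hadamard's lemma it then extends smoothly to the
normal bundles. The given morphism need not do this, and another one is built
(`exists_local_morphism`, from `exists_transport`). In adapted charts a point (a, ξ) of U' is joined
to V' by the segment τ ↦ (a, τξ), whose image by t' has a velocity of the form ∑ cᵢ Xᵢ with Xᵢ in F.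
Let r start at the point of V over the same point of M and move in the fibre of s with velocity ∑ cᵢ
κᵢ(r), where κᵢ is an s-vertical lift of Xᵢ along t. Then t(r(τ)) and t'(a, τξ) solve the same
differential equation, with the same initial value because s = t on V and s' = t' on V'. So they
agree, and (a, ξ) ↦ r(1) is a morphism. When ξ = 0 the curve r is constant, so V' goes to V.

That r(1) is smooth in (a, ξ) is the smooth dependence of a flow on the initial condition
(`exists_smooth_flow`). It follows from the invertibility, for small ε, of γ ↦ γ - ε ∫ g ∘ γ on the
Banach space of curves on [0, 1]. -/

namespace SingularFoliation

/-! ### Bump functions and gluing -/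

section Glue

variable {E : Type*} [NormedAddCommGroup E] [NormedSpace ℝ E] [FiniteDimensional ℝ E]
  {H : Type*} [TopologicalSpace H] (J : ModelWithCorners ℝ E H)
  {U : Type*} [TopologicalSpace U] [ChartedSpace H U] [IsManifold J ∞ U]
  [T2Space U] [SigmaCompactSpace U]

include J in
omit [SigmaCompactSpace U] [T2Space U] [IsManifold J ∞ U] in
theorem locallyCompactSpace : LocallyCompactSpace U := by
  have : LocallyCompactSpace H := J.locallyCompactSpace
  exact ChartedSpace.locallyCompactSpace H U

theorem exists_bump {K O : Set U} (hK : IsCompact K) (hO : IsOpen O) (hKO : K ⊆ O) :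
    ∃ χ : U → ℝ, ContMDiff J 𝓘(ℝ) ∞ χ ∧ HasCompactSupport χ ∧ tsupport χ ⊆ O ∧
      ∀ᶠ x in 𝓝ˢ K, χ x = 1 := by
  have := locallyCompactSpace J (U := U)
  obtain ⟨L, hL, hKL, hLO⟩ := exists_compact_between hK hO hKO
  obtain ⟨f, h1, h0, -⟩ := exists_contMDiffMap_one_nhds_of_subset_interior (n := ⊤) J
    hK.isClosed hKL
  have hs : tsupport f ⊆ L := closure_minimal (fun x hx => by
    by_contra h; exact hx (h0 x h)) hL.isClosed
  exact ⟨f, f.contMDiff, hL.of_isClosed_subset (isClosed_tsupport _) hs, hs.trans hLO, h1⟩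

theorem exists_bump_nhds {u : U} {W : Set U} (hW : W ∈ 𝓝 u) :
    ∃ χ : U → ℝ, ContMDiff J 𝓘(ℝ) ∞ χ ∧ HasCompactSupport χ ∧ tsupport χ ⊆ W ∧
      ∀ᶠ x in 𝓝 u, χ x = 1 := by
  obtain ⟨χ, h1, h2, h3, h4⟩ := exists_bump J (K := {u}) isCompact_singleton isOpen_interior
    (by simpa using mem_interior_iff_mem_nhds.2 hW)
  exact ⟨χ, h1, h2, h3.trans interior_subset, by simpa using h4⟩

/-- A partition of unity writes a section that vanishes off a compact set as a finite sum of its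
products with bump functions. A property stable under sums can therefore be checked after
multiplication by a bump function with small support. -/
theorem section_glue {B : U → Type*} [∀ u, AddCommGroup (B u)] [∀ u, Module ℝ (B u)]
    {P : (∀ u, B u) → Prop} (h0 : P 0) (hadd : ∀ Y Z, P Y → P Z → P (Y + Z))
    {Y : ∀ u, B u} {K : Set U} (hK : IsCompact K) (hYK : ∀ u ∉ K, Y u = 0)
    (hloc : ∀ u ∈ K, ∃ W ∈ 𝓝 u, ∀ χ : U → ℝ, ContMDiff J 𝓘(ℝ) ∞ χ → HasCompactSupport χ →
      tsupport χ ⊆ W → P (fun u => χ u • Y u)) : P Y := by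
  classical
  have := locallyCompactSpace J (U := U)
  choose W hW hP using fun u : K => hloc u u.2
  -- The compact neighbourhoods force each function of the partition to have compact support, as
  -- `hloc` requires.
  have hC : ∀ u : K, ∃ C : Set U, IsCompact C ∧ C ∈ 𝓝 (u : U) := fun u =>
    exists_compact_mem_nhds _
  choose C hC hCn using hC
  obtain ⟨ρ, hρ⟩ := SmoothPartitionOfUnity.exists_isSubordinate J hK.isClosed
    (fun u : K => interior (W u) ∩ interior (C u))
    (fun u => isOpen_interior.inter isOpen_interior) (fun u hu => mem_iUnion.2 ⟨⟨u, hu⟩,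
      mem_interior_iff_mem_nhds.2 (hW ⟨u, hu⟩), mem_interior_iff_mem_nhds.2 (hCn ⟨u, hu⟩)⟩)
  have hfin := ρ.locallyFinite.finite_nonempty_inter_compact hK
  have hY : Y = ∑ i ∈ hfin.toFinset, fun u => ρ i u • Y u := by
    ext u
    rw [Finset.sum_apply, ← Finset.sum_smul]
    by_cases hu : u ∈ K
    · rw [ρ.sum_finsupport' (x₀ := u) hu, one_smul]
      intro i hi
      rw [SmoothPartitionOfUnity.mem_finsupport] at hi
      exact hfin.mem_toFinset.2 ⟨u, hi, hu⟩
    · rw [hYK u hu, smul_zero]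
  rw [hY]
  refine Finset.sum_induction _ P (fun a b => hadd a b) h0 fun i _ => ?_
  refine hP i _ (ρ i).contMDiff ?_ ((hρ i).trans (inter_subset_left.trans interior_subset))
  exact (hC i).of_isClosed_subset (isClosed_tsupport _)
    ((hρ i).trans (inter_subset_right.trans interior_subset))

end Glue

/-! ### Sections spanned by a family of vector fields -/

section SpansOn

variable {E : Type*} [NormedAddCommGroup E] [NormedSpace ℝ E]
  {H : Type*} [TopologicalSpace H] (I : ModelWithCorners ℝ E H)
  {M : Type*} [TopologicalSpace M] [ChartedSpace H M]
  {E' : Type*} [NormedAddCommGroup E'] [NormedSpace ℝ E']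
  {H' : Type*} [TopologicalSpace H'] (J : ModelWithCorners ℝ E' H')
  {U : Type*} [TopologicalSpace U] [ChartedSpace H' U]

/-- The section `ζ` of the pull-back of `TM` by `p` is on `S` a finite sum `∑ fᵢ (Xᵢ ∘ p)` with
`fᵢ ∈ C_c^∞(U)` and `Xᵢ ∈ F`. -/
def SpansOn (F : Set (∀ x : M, TangentSpace I x)) (p : U → M) (ζ : ∀ u, TangentSpace I (p u))
    (S : Set U) : Prop :=
  ∃ (k : ℕ) (f : Fin k → U → ℝ) (X : Fin k → ∀ x : M, TangentSpace I x),
    (∀ i, ContMDiff J 𝓘(ℝ) ∞ (f i) ∧ HasCompactSupport (f i) ∧ X i ∈ F) ∧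
      ∀ u ∈ S, ζ u = ∑ i, f i u • X i (p u)

variable {I J} {F : Set (∀ x : M, TangentSpace I x)} {p : U → M}
  {ζ ζ' : ∀ u, TangentSpace I (p u)} {S S' : Set U}

theorem SpansOn.mono (h : SpansOn I J F p ζ S) (hS : S' ⊆ S) : SpansOn I J F p ζ S' := by
  obtain ⟨k, f, X, h1, h2⟩ := h
  exact ⟨k, f, X, h1, fun u hu => h2 u (hS hu)⟩

theorem SpansOn.congr (h : SpansOn I J F p ζ S) (hS : ∀ u ∈ S, ζ' u = ζ u) :
    SpansOn I J F p ζ' S := by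
  obtain ⟨k, f, X, h1, h2⟩ := h
  exact ⟨k, f, X, h1, fun u hu => (hS u hu).trans (h2 u hu)⟩

variable (I J F p S) in
theorem SpansOn.zero : SpansOn I J F p (0 : ∀ u, TangentSpace I (p u)) S :=
  ⟨0, Fin.elim0, Fin.elim0, fun i => i.elim0, fun u _ => by simp⟩

theorem SpansOn.add (h : SpansOn I J F p ζ S) (h' : SpansOn I J F p ζ' S) :
    SpansOn I J F p (ζ + ζ') S := by
  obtain ⟨k, f, X, h1, h2⟩ := h
  obtain ⟨k', f', X', h1', h2'⟩ := h'
  refine ⟨k + k', Fin.append f f', Fin.append X X', fun i => ?_, fun u hu => ?_⟩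
  · induction i using Fin.addCases with
    | left i => simpa using h1 i
    | right i => simpa using h1' i
  · rw [Fin.sum_univ_add]
    simp [h2 u hu, h2' u hu]

theorem SpansOn.sum {ι : Type*} (s : Finset ι) {ζ : ι → ∀ u, TangentSpace I (p u)}
    (h : ∀ i ∈ s, SpansOn I J F p (ζ i) S) : SpansOn I J F p (∑ i ∈ s, ζ i) S :=
  Finset.sum_induction _ (fun ζ => SpansOn I J F p ζ S) (fun _ _ => SpansOn.add)
    (SpansOn.zero I J F p S) h

theorem SpansOn.smul (h : SpansOn I J F p ζ S) {g : U → ℝ} (hg : ContMDiff J 𝓘(ℝ) ∞ g) :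
    SpansOn I J F p (fun u => g u • ζ u) S := by
  obtain ⟨k, f, X, h1, h2⟩ := h
  refine ⟨k, fun i u => g u * f i u, X, fun i => ⟨hg.mul (h1 i).1, (h1 i).2.1.mul_left, (h1 i).2.2⟩,
    fun u hu => ?_⟩
  simp only [h2 u hu, Finset.smul_sum, smul_smul]

theorem SpansOn.of_mem {X : ∀ x : M, TangentSpace I x} (hX : X ∈ F) {f : U → ℝ}
    (hf : ContMDiff J 𝓘(ℝ) ∞ f) (hfc : HasCompactSupport f) :
    SpansOn I J F p (fun u => f u • X (p u)) S :=
  ⟨1, fun _ => f, fun _ => X, fun _ => ⟨hf, hfc, hX⟩, fun u _ => by simp⟩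

theorem SpansOn.smul_univ (h : SpansOn I J F p ζ S) {g : U → ℝ} (hg : ContMDiff J 𝓘(ℝ) ∞ g)
    (hgS : tsupport g ⊆ S) : SpansOn I J F p (fun u => g u • ζ u) univ := by
  obtain ⟨k, f, X, h1, h2⟩ := h
  refine ⟨k, fun i u => g u * f i u, X, fun i => ⟨hg.mul (h1 i).1, (h1 i).2.1.mul_left, (h1 i).2.2⟩,
    fun u _ => ?_⟩
  by_cases hu : u ∈ S
  · simp only [h2 u hu, Finset.smul_sum, smul_smul]
  · have : g u = 0 := image_eq_zero_of_notMem_tsupport fun h => hu (hgS h)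
    simp [this]

theorem SpansOn.of_locally [FiniteDimensional ℝ E'] [IsManifold J ∞ U] [T2Space U]
    [SigmaCompactSpace U] {K : Set U} (hK : IsCompact K) (h0 : ∀ u ∉ K, ζ u = 0)
    (h : ∀ u ∈ K, ∃ W ∈ 𝓝 u, SpansOn I J F p ζ W) : SpansOn I J F p ζ univ := by
  refine section_glue J (P := fun ζ => SpansOn I J F p ζ univ) (SpansOn.zero I J F p univ)
    (fun _ _ => SpansOn.add) hK h0 fun u hu => ?_
  obtain ⟨W, hW, h1⟩ := h u hu
  exact ⟨W, hW, fun χ hχ _ hχW => h1.smul_univ hχ hχW⟩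

end SpansOn

/-! ### Vector fields in charts -/

section Charts

variable {E : Type*} [NormedAddCommGroup E] [NormedSpace ℝ E]
  {U : Type*} [TopologicalSpace U] [ChartedSpace E U] [IsManifold 𝓘(ℝ, E) ∞ U]
  {G : Type*} [NormedAddCommGroup G] [NormedSpace ℝ G]

theorem contMDiffOn_mfderiv_apply {g : U → G} {Y : ∀ u : U, TangentSpace 𝓘(ℝ, E) u} {W : Set U}
    (hW : IsOpen W) (hg : ContMDiffOn 𝓘(ℝ, E) 𝓘(ℝ, G) ∞ g W)
    (hY : ContMDiffOn 𝓘(ℝ, E) 𝓘(ℝ, E).tangent ∞ (fun u => (⟨u, Y u⟩ : TangentBundle 𝓘(ℝ, E) U)) W) :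
    ContMDiffOn 𝓘(ℝ, E) 𝓘(ℝ, G) ∞ (fun u => (mfderiv 𝓘(ℝ, E) 𝓘(ℝ, G) g u (Y u) : G)) W := by
  have h1 := hg.contMDiffOn_tangentMapWithin (m := ∞) (by simp) hW.uniqueMDiffOn
  have h2 := h1.comp hY (fun u hu => hu)
  have h3 := (contMDiff_snd_tangentBundle_modelSpace (n := ∞) G 𝓘(ℝ, G)).comp_contMDiffOn h2
  refine h3.congr fun u hu => ?_
  change _ = mfderivWithin 𝓘(ℝ, E) 𝓘(ℝ, G) g W u (Y u)
  rw [mfderivWithin_of_isOpen hW hu]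

theorem contMDiffOn_mfderiv_symm {ψ : OpenPartialHomeomorph U E}
    (hψ : ψ ∈ IsManifold.maximalAtlas 𝓘(ℝ, E) ∞ U) {w : U → E} {W : Set U} (hWψ : W ⊆ ψ.source)
    (hw : ContMDiffOn 𝓘(ℝ, E) 𝓘(ℝ, E) ∞ w W) :
    ContMDiffOn 𝓘(ℝ, E) 𝓘(ℝ, E).tangent ∞
      (fun u => (⟨ψ.symm (ψ u), mfderiv 𝓘(ℝ, E) 𝓘(ℝ, E) ψ.symm (ψ u) (w u)⟩ :
        TangentBundle 𝓘(ℝ, E) U)) W := by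
  have h1 := (contMDiffOn_symm_of_mem_maximalAtlas hψ).contMDiffOn_tangentMapWithin (m := ∞)
    (by simp) ψ.open_target.uniqueMDiffOn
  have h2 : ContMDiffOn 𝓘(ℝ, E) 𝓘(ℝ, E).tangent ∞
      (fun u => (⟨ψ u, w u⟩ : TangentBundle 𝓘(ℝ, E) E)) W := by
    intro u hu
    refine Bundle.contMDiffWithinAt_totalSpace.2 ⟨?_, ?_⟩
    · exact ((contMDiffOn_of_mem_maximalAtlas hψ) u (hWψ hu)).mono hWψ
    · simpa using hw u hu
  refine (h1.comp h2 fun u hu => ψ.map_source (hWψ hu)).congr fun u hu => ?_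
  simp only [Function.comp_apply, tangentMapWithin]
  rw [mfderivWithin_of_isOpen ψ.open_target (ψ.map_source (hWψ hu))]

omit [IsManifold 𝓘(ℝ, E) ∞ U] in
-- All tangent spaces are the model space E by definition, so one vector can be placed over two
-- names of the same point. This replaces the base point ψ.symm (ψ u), which the tangent map of
-- ψ.symm produces, by u.
theorem tangentBundle_mk_congr {u u' : U} (h : u = u') (x : E) :
    (⟨u, x⟩ : TangentBundle 𝓘(ℝ, E) U) = ⟨u', x⟩ := by
  subst h; rfl

/-- The vector field with coordinates `w` in the chart `ψ`. -/
noncomputable def ofCoord (ψ : OpenPartialHomeomorph U E) (w : U → E) (u : U) :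
    TangentSpace 𝓘(ℝ, E) u :=
  mfderiv 𝓘(ℝ, E) 𝓘(ℝ, E) ψ.symm (ψ u) (w u)

theorem contMDiffOn_ofCoord {ψ : OpenPartialHomeomorph U E}
    (hψ : ψ ∈ IsManifold.maximalAtlas 𝓘(ℝ, E) ∞ U) {w : U → E} {W : Set U} (hWψ : W ⊆ ψ.source)
    (hw : ContMDiffOn 𝓘(ℝ, E) 𝓘(ℝ, E) ∞ w W) :
    ContMDiffOn 𝓘(ℝ, E) 𝓘(ℝ, E).tangent ∞
      (fun u => (⟨u, ofCoord ψ w u⟩ : TangentBundle 𝓘(ℝ, E) U)) W := by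
  refine (contMDiffOn_mfderiv_symm hψ hWψ hw).congr fun u hu => ?_
  exact tangentBundle_mk_congr (ψ.left_inv (hWψ hu)).symm _

omit [IsManifold 𝓘(ℝ, E) ∞ U] in
theorem ofCoord_mfderiv {ψ : OpenPartialHomeomorph U E}
    (hψ : ψ ∈ IsManifold.maximalAtlas 𝓘(ℝ, E) ∞ U) {u : U} (hu : u ∈ ψ.source)
    (Y : ∀ u : U, TangentSpace 𝓘(ℝ, E) u) :
    ofCoord ψ (fun u => mfderiv 𝓘(ℝ, E) 𝓘(ℝ, E) ψ u (Y u)) u = Y u :=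
  congrArg (fun f => f (Y u))
    ((mdifferentiable_of_mem_maximalAtlas hψ).symm_comp_deriv hu)

omit [IsManifold 𝓘(ℝ, E) ∞ U] in
/-- The derivative of `g` along a field given by its coordinates. -/
theorem mfderiv_ofCoord {E₁ : Type*} [NormedAddCommGroup E₁] [NormedSpace ℝ E₁]
    {H₁ : Type*} [TopologicalSpace H₁] {I : ModelWithCorners ℝ E₁ H₁}
    {M : Type*} [TopologicalSpace M] [ChartedSpace H₁ M] {ψ : OpenPartialHomeomorph U E}
    (hψ : ψ ∈ IsManifold.maximalAtlas 𝓘(ℝ, E) ∞ U) {u : U} (hu : u ∈ ψ.source)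
    {g : U → M} (hg : MDifferentiableAt 𝓘(ℝ, E) I g u) (w : U → E) :
    (mfderiv 𝓘(ℝ, E) I g u (ofCoord ψ w u) : E₁) =
      mfderiv 𝓘(ℝ, E) I (fun y => g (ψ.symm y)) (ψ u) (w u) := by
  have h1 := ((mdifferentiable_of_mem_maximalAtlas hψ).mdifferentiableAt_symm
    (ψ.map_source hu)).hasMFDerivAt
  have h2 : HasMFDerivAt 𝓘(ℝ, E) I g (ψ.symm (ψ u)) (mfderiv 𝓘(ℝ, E) I g (ψ.symm (ψ u))) := by
    rw [ψ.left_inv hu]; exact hg.hasMFDerivAt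
  have h3 := (h2.comp (ψ u) h1).mfderiv
  have h4 : (mfderiv 𝓘(ℝ, E) I (fun y => g (ψ.symm y)) (ψ u) (w u) : E₁) =
      mfderiv 𝓘(ℝ, E) I g (ψ.symm (ψ u)) (ofCoord ψ w u) := congrArg (fun f : E →L[ℝ] E₁ => f (w u)) h3
  rw [h4]
  exact congrArg (fun x => (mfderiv 𝓘(ℝ, E) I g x : E →L[ℝ] E₁) (ofCoord ψ w u))
    (ψ.left_inv hu).symm

/-- Off the support of χ the product is locally zero, so the smoothness of Y matters only on W. -/
theorem isSmoothCompactField_smul {H : Type*} [TopologicalSpace H] {J : ModelWithCorners ℝ E H}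
  {U : Type*} [TopologicalSpace U] [ChartedSpace H U] [IsManifold J ∞ U] [T2Space U]
  {W : Set U} (hW : IsOpen W) {χ : U → ℝ}
    (hχ : ContMDiff J 𝓘(ℝ) ∞ χ) (hχc : HasCompactSupport χ) (hχW : tsupport χ ⊆ W)
    {Y : ∀ u : U, TangentSpace J u}
    (hY : ContMDiffOn J J.tangent ∞ (fun u => (⟨u, Y u⟩ : TangentBundle J U)) W) :
    IsSmoothCompactField J (fun u => χ u • Y u) := by
  refine ⟨?_, hχc.of_isClosed_subset isClosed_closure (closure_mono fun u hu h => hu (by simp [h]))⟩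
  intro u
  by_cases hu : u ∈ tsupport χ
  · exact hχ.contMDiffAt.smul_section (hY.contMDiffAt (hW.mem_nhds (hχW hu)))
  · have h0 := notMem_tsupport_iff_eventuallyEq.1 hu
    refine (Bundle.contMDiff_zeroSection ℝ (TangentSpace J : U → Type _)).contMDiffAt.congr_of_eventuallyEq ?_
    filter_upwards [h0] with x hx
    rw [hx, Pi.zero_apply, zero_smul]
    rfl

end Charts

/-! ### Fields with compact support -/

section Fields

variable {E : Type*} [NormedAddCommGroup E] [NormedSpace ℝ E]
  {H : Type*} [TopologicalSpace H] {I : ModelWithCorners ℝ E H}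
  {M : Type*} [TopologicalSpace M] [ChartedSpace H M]
  {E' : Type*} [NormedAddCommGroup E'] [NormedSpace ℝ E']
  {H' : Type*} [TopologicalSpace H'] {J : ModelWithCorners ℝ E' H'}
  {U : Type*} [TopologicalSpace U] [ChartedSpace H' U] [IsManifold J ∞ U]

variable (J U) in
theorem isSmoothCompactField_zero : IsSmoothCompactField J (0 : ∀ u : U, TangentSpace J u) :=
  ⟨Bundle.contMDiff_zeroSection ℝ (TangentSpace J : U → Type _), by simp⟩

theorem isSmoothCompactField_add {Y Z : ∀ u : U, TangentSpace J u} (hY : IsSmoothCompactField J Y)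
    (hZ : IsSmoothCompactField J Z) : IsSmoothCompactField J (Y + Z) := by
  refine ⟨hY.1.add_section hZ.1, (hY.2.union hZ.2).of_isClosed_subset isClosed_closure ?_⟩
  rw [← closure_union]
  refine closure_mono fun u hu => ?_
  by_contra h
  simp only [mem_union, not_or] at h
  have h1 : Y u = 0 := not_not.1 h.1
  have h2 : Z u = 0 := not_not.1 h.2
  exact hu (by simp [h1, h2])

theorem isSmoothCompactField_smul_left {Y : ∀ u : U, TangentSpace J u}
    (hY : IsSmoothCompactField J Y) {f : U → ℝ} (hf : ContMDiff J 𝓘(ℝ) ∞ f) :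
    IsSmoothCompactField J (fun u => f u • Y u) :=
  ⟨hf.smul_section hY.1, hY.2.of_isClosed_subset isClosed_closure
    (closure_mono fun u hu (h : Y u = 0) => hu (show f u • Y u = 0 by rw [h, smul_zero]))⟩

variable {F : Set (∀ x : M, TangentSpace I x)} {p s t : U → M}

variable (I J p) in
theorem zero_mem_verticalFields : 0 ∈ verticalFields I J p :=
  ⟨isSmoothCompactField_zero J U, fun u => by simp⟩

theorem add_mem_verticalFields {Y Z : ∀ u : U, TangentSpace J u} (hY : Y ∈ verticalFields I J p)
    (hZ : Z ∈ verticalFields I J p) : Y + Z ∈ verticalFields I J p :=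
  ⟨isSmoothCompactField_add hY.1 hZ.1, fun u => by
    rw [Pi.add_apply, map_add, hY.2, hZ.2, add_zero]⟩

theorem smul_mem_verticalFields {Y : ∀ u : U, TangentSpace J u} (hY : Y ∈ verticalFields I J p)
    {f : U → ℝ} (hf : ContMDiff J 𝓘(ℝ) ∞ f) : (fun u => f u • Y u) ∈ verticalFields I J p :=
  ⟨isSmoothCompactField_smul_left hY.1 hf, fun u => by rw [map_smul, hY.2, smul_zero]⟩

theorem sum_mem_verticalFields {ι : Type*} (s : Finset ι) {Y : ι → ∀ u : U, TangentSpace J u}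
    (hY : ∀ i ∈ s, Y i ∈ verticalFields I J p) : ∑ i ∈ s, Y i ∈ verticalFields I J p :=
  Finset.sum_induction _ (· ∈ verticalFields I J p) (fun _ _ => add_mem_verticalFields)
    (zero_mem_verticalFields I J p) hY

theorem mem_pullbackFoliation_iff {Y : ∀ u : U, TangentSpace J u} :
    Y ∈ pullbackFoliation I J F p ↔ IsSmoothCompactField J Y ∧
      SpansOn I J F p (fun u => mfderiv J I p u (Y u)) univ := by
  simp only [pullbackFoliation, SpansOn, mem_univ, true_implies]
  rfl

theorem verticalFields_subset_pullbackFoliation :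
    verticalFields I J p ⊆ pullbackFoliation I J F p := fun _ hY =>
  mem_pullbackFoliation_iff.2 ⟨hY.1, (SpansOn.zero I J F p univ).congr fun u _ => hY.2 u⟩

theorem add_mem_pullbackFoliation {Y Z : ∀ u : U, TangentSpace J u}
    (hY : Y ∈ pullbackFoliation I J F p) (hZ : Z ∈ pullbackFoliation I J F p) :
    Y + Z ∈ pullbackFoliation I J F p := by
  rw [mem_pullbackFoliation_iff] at *
  exact ⟨isSmoothCompactField_add hY.1 hZ.1, (hY.2.add hZ.2).congr fun u _ => by simp⟩

variable (I J F s t) in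
/-- The images by `dt` of the fields of `C_c^∞(U; ker ds)` generate, locally, the same module as the
fields of `F`. -/
structure SweepsOut : Prop where
  spans : ∀ Y ∈ verticalFields I J s, ∀ u, ∃ W ∈ 𝓝 u,
    SpansOn I J F t (fun u => mfderiv J I t u (Y u)) W
  lifts : ∀ X ∈ F, ∀ u, ∃ K ∈ verticalFields I J s,
    ∀ᶠ u' in 𝓝 u, mfderiv J I t u' (K u') = X (t u')

section

variable [FiniteDimensional ℝ E'] [T2Space U] [SigmaCompactSpace U]

theorem SweepsOut.verticalFields_subset (h : SweepsOut I J F s t) :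
    verticalFields I J s ⊆ pullbackFoliation I J F t := fun Y hY =>
  mem_pullbackFoliation_iff.2 ⟨hY.1, SpansOn.of_locally hY.1.2 (fun u hu => by
    have : Y u = 0 := not_not.1 fun h => hu (subset_closure h)
    rw [this, map_zero]) fun u _ => h.spans Y hY u⟩

/-- If dt(Y) = ∑ fᵢ (Xᵢ ∘ t) and Kᵢ is an s-vertical field that lifts Xᵢ near a point, then Y - ∑ fᵢ
Kᵢ is t-vertical near that point. The local decompositions are glued by `section_glue`. -/
theorem SweepsOut.pullbackFoliation_eq (h : SweepsOut I J F s t) :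
    pullbackFoliation I J F t = {Y | ∃ Y₁ ∈ verticalFields I J s, ∃ Y₂ ∈ verticalFields I J t,
      Y = Y₁ + Y₂} := by
  ext Y
  constructor
  · intro hY
    obtain ⟨hYc, k, f, X, hf, hfY⟩ := mem_pullbackFoliation_iff.1 hY
    refine section_glue J (P := fun Y => ∃ Y₁ ∈ verticalFields I J s,
      ∃ Y₂ ∈ verticalFields I J t, Y = Y₁ + Y₂)
      ⟨0, zero_mem_verticalFields I J s, 0, zero_mem_verticalFields I J t, by simp⟩ ?_ hYc.2
      (fun u hu => not_not.1 fun h => hu (subset_closure h)) fun u _ => ?_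
    · rintro _ _ ⟨Y₁, h₁, Y₂, h₂, rfl⟩ ⟨Z₁, k₁, Z₂, k₂, rfl⟩
      exact ⟨_, add_mem_verticalFields h₁ k₁, _, add_mem_verticalFields h₂ k₂, by abel⟩
    · choose K hK hKX using fun i => h.lifts (X i) (hf i).2.2 u
      refine ⟨{u' | ∀ i, mfderiv J I t u' (K i u') = X i (t u')},
        Filter.eventually_all.2 hKX, fun χ hχ hχc hχW => ?_⟩
      have hK' : ∑ i, (fun u => f i u • K i u) ∈ verticalFields I J s :=
        sum_mem_verticalFields _ fun i _ => smul_mem_verticalFields (hK i) (hf i).1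
      -- The t-vertical summand is χ (Y - ∑ fᵢ Kᵢ): on the support of χ each Kᵢ lifts Xᵢ, and
      -- elsewhere χ = 0.
      refine ⟨_, smul_mem_verticalFields hK' hχ,
        fun u => χ u • (Y u + (-1 : ℝ) • (∑ i, (fun u => f i u • K i u)) u), ⟨?_, fun u' => ?_⟩, ?_⟩
      · exact isSmoothCompactField_smul_left (isSmoothCompactField_add hYc
          (isSmoothCompactField_smul_left hK'.1 contMDiff_const)) hχ
      · by_cases hu' : u' ∈ tsupport χ
        · have h1 := hχW hu'
          have h2 : mfderiv J I t u' (Y u') = _ := hfY u' (mem_univ _)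
          rw [map_smul, map_add, map_smul, Finset.sum_apply, map_sum, h2]
          have h3 : ∀ i, mfderiv J I t u' (f i u' • K i u') = f i u' • X i (t u') := fun i => by
            rw [map_smul, h1 i]
          simp only [h3]
          simp
        · rw [map_smul, image_eq_zero_of_notMem_tsupport hu', zero_smul]
      · ext u'
        simp only [Pi.add_apply]
        rw [← smul_add, add_comm (Y u'), ← add_assoc]
        simp
  · rintro ⟨Y₁, h₁, Y₂, h₂, rfl⟩
    exact add_mem_pullbackFoliation (h.verticalFields_subset h₁)
      (verticalFields_subset_pullbackFoliation h₂)

/-- Both pull-backs equal C_c^∞(ker ds) + C_c^∞(ker dt), by `SweepsOut.pullbackFoliation_eq` applied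
to (s, t) and to (t, s). -/
theorem isBisubmersion_of_sweepsOut [IsManifold I ∞ M] [SecondCountableTopology U] (hF : IsFoliation I F)
    (ht : IsSubmersion J I ∞ t) (hs : IsSubmersion J I ∞ s)
    (hst : SweepsOut I J F s t) (hts : SweepsOut I J F t s) : IsBisubmersion I J F t s where
  t2Space := inferInstance
  secondCountable := inferInstance
  isFoliation := hF
  submersion_t := ht
  submersion_s := hs
  pullback_eq := by
    rw [hst.pullbackFoliation_eq, hts.pullbackFoliation_eq]
    ext Y
    constructor <;> rintro ⟨Y₁, h₁, Y₂, h₂, rfl⟩ <;> exact ⟨Y₂, h₂, Y₁, h₁, add_comm _ _⟩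
  pullback_eq_add := by
    rw [hts.pullbackFoliation_eq]
    ext Y
    constructor <;> rintro ⟨Y₁, h₁, Y₂, h₂, rfl⟩ <;> exact ⟨Y₂, h₂, Y₁, h₁, add_comm _ _⟩

end

theorem isBisubmersion_symm [IsManifold I ∞ M] (h : IsBisubmersion I J F t s) : IsBisubmersion I J F s t where
  t2Space := h.t2Space
  secondCountable := h.secondCountable
  isFoliation := h.isFoliation
  submersion_t := h.submersion_s
  submersion_s := h.submersion_t
  pullback_eq := h.pullback_eq.symm
  pullback_eq_add := by
    rw [← h.pullback_eq, h.pullback_eq_add]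
    ext Y
    constructor <;> rintro ⟨Y₁, h₁, Y₂, h₂, rfl⟩ <;> exact ⟨Y₂, h₂, Y₁, h₁, add_comm _ _⟩

end Fields

/-! ### Submersions in charts -/

section Submersion

variable {E : Type*} [NormedAddCommGroup E] [NormedSpace ℝ E]
  {M : Type*} [TopologicalSpace M] [ChartedSpace E M]
  {EU : Type*} [NormedAddCommGroup EU] [NormedSpace ℝ EU]
  {U : Type*} [TopologicalSpace U] [ChartedSpace EU U]
  {N : Type*} [NormedAddCommGroup N] [NormedSpace ℝ N]

/-- In the charts `ψ` and `φ`, the map `p` is the projection of `EU ≃ E × N` on `E`. -/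
structure IsSubmersionChart (p : U → M) (ψ : OpenPartialHomeomorph U EU)
    (φ : OpenPartialHomeomorph M E) (L : EU ≃L[ℝ] E × N) : Prop where
  mem : ψ ∈ IsManifold.maximalAtlas 𝓘(ℝ, EU) ∞ U
  mem' : φ ∈ IsManifold.maximalAtlas 𝓘(ℝ, E) ∞ M
  mapsTo : ∀ u ∈ ψ.source, p u ∈ φ.source
  eq : ∀ u ∈ ψ.source, φ (p u) = (L (ψ u)).1

theorem exists_isSubmersionChart {p : U → M}
    (hp : IsSubmersionOfComplement N 𝓘(ℝ, EU) 𝓘(ℝ, E) ∞ p) (u : U) :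
    ∃ (ψ : OpenPartialHomeomorph U EU) (φ : OpenPartialHomeomorph M E) (L : EU ≃L[ℝ] E × N),
      IsSubmersionChart p ψ φ L ∧ u ∈ ψ.source := by
  have h := hp u
  refine ⟨h.domChart, h.codChart, h.equiv, ⟨h.domChart_mem_maximalAtlas,
    h.codChart_mem_maximalAtlas, fun x hx => h.source_subset_preimage_source hx, fun x hx => ?_⟩,
    h.mem_domChart_source⟩
  have hx' : h.domChart x ∈ (h.domChart.extend 𝓘(ℝ, EU)).target := by
    simpa only [mfld_simps] using h.domChart.map_source hx
  simpa [h.domChart.left_inv hx] using h.writtenInCharts hx'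

variable {p : U → M} {ψ : OpenPartialHomeomorph U EU} {φ : OpenPartialHomeomorph M E}
  {L : EU ≃L[ℝ] E × N} (h : IsSubmersionChart p ψ φ L)

include h

theorem IsSubmersionChart.mfderiv_mfderiv (hp : ContMDiff 𝓘(ℝ, EU) 𝓘(ℝ, E) ∞ p) {u : U}
    (hu : u ∈ ψ.source) (w : TangentSpace 𝓘(ℝ, EU) u) :
    (mfderiv 𝓘(ℝ, E) 𝓘(ℝ, E) φ (p u) (mfderiv 𝓘(ℝ, EU) 𝓘(ℝ, E) p u w) : E) =
      (L (mfderiv 𝓘(ℝ, EU) 𝓘(ℝ, EU) ψ u w)).1 := by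
  have h1 := ((mdifferentiable_of_mem_maximalAtlas h.mem').mdifferentiableAt
    (h.mapsTo u hu)).hasMFDerivAt
  have h2 := ((hp u).mdifferentiableAt (by simp)).hasMFDerivAt
  have h3 := ((mdifferentiable_of_mem_maximalAtlas h.mem).mdifferentiableAt hu).hasMFDerivAt
  have h4 : HasMFDerivAt 𝓘(ℝ, EU) 𝓘(ℝ, E) (fun u => (L (ψ u)).1) u _ :=
    (((ContinuousLinearMap.fst ℝ E N).comp
      (L : EU →L[ℝ] E × N)).hasMFDerivAt (x := ψ u)).comp u h3
  have h5 : (fun u => φ (p u)) =ᶠ[𝓝 u] fun u => (L (ψ u)).1 := by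
    filter_upwards [ψ.open_source.mem_nhds hu] with x hx using h.eq x hx
  have h6 := hasMFDerivAt_unique (h1.comp u h2) (h4.congr_of_eventuallyEq h5)
  exact congrArg (fun f => f w) h6

/-- The derivative of the chart φ is injective, so an equation for dp can be read on the E-component
of the coordinates. -/
theorem IsSubmersionChart.mfderiv_eq_iff (hp : ContMDiff 𝓘(ℝ, EU) 𝓘(ℝ, E) ∞ p) {u : U}
    (hu : u ∈ ψ.source) (w : TangentSpace 𝓘(ℝ, EU) u) (x : TangentSpace 𝓘(ℝ, E) (p u)) :
    mfderiv 𝓘(ℝ, EU) 𝓘(ℝ, E) p u w = x ↔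
      (L (mfderiv 𝓘(ℝ, EU) 𝓘(ℝ, EU) ψ u w)).1 = mfderiv 𝓘(ℝ, E) 𝓘(ℝ, E) φ (p u) x := by
  rw [← h.mfderiv_mfderiv hp hu]
  constructor
  · intro hx
    exact congrArg (fun x => mfderiv 𝓘(ℝ, E) 𝓘(ℝ, E) φ (p u) x) hx
  · intro hx
    exact (mdifferentiable_of_mem_maximalAtlas h.mem').mfderiv_injective (h.mapsTo u hu) hx

end Submersion

/-! ### The sweeping condition for a bi-submersion, and its form in charts -/

section BisubmersionCharts

variable {E : Type*} [NormedAddCommGroup E] [NormedSpace ℝ E]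
  {M : Type*} [TopologicalSpace M] [ChartedSpace E M] [IsManifold 𝓘(ℝ, E) ∞ M]
  {EU : Type*} [NormedAddCommGroup EU] [NormedSpace ℝ EU]
  {U : Type*} [TopologicalSpace U] [ChartedSpace EU U] [IsManifold 𝓘(ℝ, EU) ∞ U]
  {N : Type*} [NormedAddCommGroup N] [NormedSpace ℝ N]
  {F : Set (∀ x : M, TangentSpace 𝓘(ℝ, E) x)} {p s t : U → M}
  {ψ : OpenPartialHomeomorph U EU} {φ : OpenPartialHomeomorph M E}
  {L : EU ≃L[ℝ] E × N}

omit [IsManifold 𝓘(ℝ, EU) ∞ U] in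
theorem mfderiv_ofCoord_self (hψ : ψ ∈ IsManifold.maximalAtlas 𝓘(ℝ, EU) ∞ U) {u : U}
    (hu : u ∈ ψ.source) (w : U → EU) :
    (mfderiv 𝓘(ℝ, EU) 𝓘(ℝ, EU) ψ u (ofCoord ψ w u) : EU) = w u := by
  have hd := mdifferentiable_of_mem_maximalAtlas hψ
  have h1 := mfderiv_ofCoord hψ hu (hd.mdifferentiableAt hu) w
  rw [h1]
  have h2 : (fun y => ψ (ψ.symm y)) =ᶠ[𝓝 (ψ u)] id := by
    filter_upwards [ψ.open_target.mem_nhds (ψ.map_source hu)] with y hy using ψ.right_inv hy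
  rw [h2.mfderiv_eq, mfderiv_id]
  rfl

omit [IsManifold 𝓘(ℝ, EU) ∞ U] in
-- In these charts p is the projection E × N → E, and a field on the base is lifted with N-component
-- zero.
theorem IsSubmersionChart.lift_mem (h : IsSubmersionChart p ψ φ L)
    (hp : ContMDiff 𝓘(ℝ, EU) 𝓘(ℝ, E) ∞ p) {X : ∀ x : M, TangentSpace 𝓘(ℝ, E) x}
    (hX : IsSmoothCompactField 𝓘(ℝ, E) X) :
    ∃ w : U → EU, ContMDiffOn 𝓘(ℝ, EU) 𝓘(ℝ, EU) ∞ w ψ.source ∧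
      ∀ u ∈ ψ.source, mfderiv 𝓘(ℝ, EU) 𝓘(ℝ, E) p u (ofCoord ψ w u) = X (p u) := by
  have h1 := contMDiffOn_mfderiv_apply φ.open_source (contMDiffOn_of_mem_maximalAtlas h.mem')
    hX.1.contMDiffOn
  refine ⟨fun u => L.symm (mfderiv 𝓘(ℝ, E) 𝓘(ℝ, E) φ (p u) (X (p u)), 0), ?_, fun u hu => ?_⟩
  · have h2 := h1.comp hp.contMDiffOn h.mapsTo
    have h3 : ContDiff ℝ ∞ fun x : E => L.symm (x, (0 : N)) := by fun_prop
    exact h3.contMDiff.comp_contMDiffOn h2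
  · rw [h.mfderiv_eq_iff hp hu, mfderiv_ofCoord_self h.mem hu]
    exact congrArg Prod.fst (L.apply_symm_apply _)

/-- An s-vertical field lies in s⁻¹(F), which is t⁻¹(F). In the other direction, a field Y with
dt(Y) = χ (X ∘ t) lies in t⁻¹(F), hence is the sum of an s-vertical and a t-vertical field; the
first has the same image by dt as Y. -/
theorem sweepsOut_of_isBisubmersion [FiniteDimensional ℝ EU]
    (h : IsBisubmersion 𝓘(ℝ, E) 𝓘(ℝ, EU) F t s) : SweepsOut 𝓘(ℝ, E) 𝓘(ℝ, EU) F s t := by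
  have := h.t2Space
  have := h.secondCountable
  have := locallyCompactSpace 𝓘(ℝ, EU) (U := U)
  constructor
  · intro Y hY u
    have h1 := verticalFields_subset_pullbackFoliation (F := F) hY
    rw [h.pullback_eq] at h1
    exact ⟨univ, Filter.univ_mem, (mem_pullbackFoliation_iff.1 h1).2⟩
  · intro X hX u
    obtain ⟨N, _, _, hN⟩ := h.submersion_t
    obtain ⟨ψ, φ, L, hL, hu⟩ := exists_isSubmersionChart hN u
    have ht := hN.contMDiff
    obtain ⟨w, hw, hwX⟩ := hL.lift_mem ht (h.isFoliation.smooth X hX)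
    obtain ⟨χ, h1, h2, h3, h4⟩ := exists_bump_nhds 𝓘(ℝ, EU) (ψ.open_source.mem_nhds hu)
    have hY : (fun u => χ u • ofCoord ψ w u) ∈ pullbackFoliation 𝓘(ℝ, E) 𝓘(ℝ, EU) F t := by
      refine mem_pullbackFoliation_iff.2 ⟨isSmoothCompactField_smul ψ.open_source h1 h2 h3
        (contMDiffOn_ofCoord hL.mem subset_rfl hw), (SpansOn.of_mem hX h1 h2).congr fun u' _ => ?_⟩
      rw [map_smul]
      by_cases hu' : u' ∈ ψ.source
      · rw [hwX u' hu']
      · rw [image_eq_zero_of_notMem_tsupport fun h => hu' (h3 h), zero_smul, zero_smul]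
    rw [← h.pullback_eq, h.pullback_eq_add] at hY
    obtain ⟨Y₁, k₁, Y₂, k₂, hY⟩ := hY
    refine ⟨Y₁, k₁, ?_⟩
    filter_upwards [h4, ψ.open_source.mem_nhds hu] with u' h5 hu'
    have h6 : Y₁ u' + Y₂ u' = χ u' • ofCoord ψ w u' := (congrFun hY u').symm
    have h7 := congrArg (mfderiv 𝓘(ℝ, EU) 𝓘(ℝ, E) t u') h6
    rwa [map_add, k₂.2, add_zero, h5, one_smul, hwX u' hu'] at h7

variable (hL : IsSubmersionChart s ψ φ L) (hs : ContMDiff 𝓘(ℝ, EU) 𝓘(ℝ, E) ∞ s)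
  (h : SweepsOut 𝓘(ℝ, E) 𝓘(ℝ, EU) F s t)

include hL hs h

omit [IsManifold 𝓘(ℝ, E) ∞ M] in
-- A constant vector of N defines an s-vertical field on the chart only. A bump function extends it
-- to U without changing it near u, and `SweepsOut.spans` applies.
theorem SweepsOut.exists_spansOn [FiniteDimensional ℝ EU] [T2Space U] [SigmaCompactSpace U] {u : U}
    (hu : u ∈ ψ.source) (ξ : N) : ∃ W ∈ 𝓝 u, SpansOn 𝓘(ℝ, E) 𝓘(ℝ, EU) F t
      (fun u => mfderiv 𝓘(ℝ, EU) 𝓘(ℝ, E) t u (ofCoord ψ (fun _ => L.symm (0, ξ)) u)) W := by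
  obtain ⟨χ, h1, h2, h3, h4⟩ := exists_bump_nhds 𝓘(ℝ, EU) (ψ.open_source.mem_nhds hu)
  have hK : (fun u => χ u • ofCoord ψ (fun _ => L.symm (0, ξ)) u) ∈
      verticalFields 𝓘(ℝ, E) 𝓘(ℝ, EU) s := by
    refine ⟨isSmoothCompactField_smul ψ.open_source h1 h2 h3
        (contMDiffOn_ofCoord hL.mem subset_rfl contMDiffOn_const), fun u' => ?_⟩
    rw [map_smul]
    by_cases hu' : u' ∈ ψ.source
    · rw [(hL.mfderiv_eq_iff hs hu' _ 0).2, smul_zero]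
      rw [mfderiv_ofCoord_self hL.mem hu', map_zero]
      exact congrArg Prod.fst (L.apply_symm_apply _)
    · rw [image_eq_zero_of_notMem_tsupport fun h => hu' (h3 h), zero_smul]
  obtain ⟨W, hW, h5⟩ := h.spans _ hK u
  refine ⟨W ∩ {u | χ u = 1}, Filter.inter_mem hW h4, (h5.mono inter_subset_left).congr
    fun u' hu' => ?_⟩
  have : χ u' = 1 := hu'.2
  rw [this, one_smul]

omit [IsManifold 𝓘(ℝ, E) ∞ M] in
-- An s-vertical lift K of X has zero E-component in the chart, so it is determined by its
-- N-component, which is the κ sought.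
theorem SweepsOut.exists_lift {u : U} (hu : u ∈ ψ.source) {X : ∀ x : M, TangentSpace 𝓘(ℝ, E) x}
    (hX : X ∈ F) : ∃ W : Set U, IsOpen W ∧ u ∈ W ∧ W ⊆ ψ.source ∧ ∃ κ : U → N,
      ContMDiffOn 𝓘(ℝ, EU) 𝓘(ℝ, N) ∞ κ W ∧ ∀ u ∈ W,
        mfderiv 𝓘(ℝ, EU) 𝓘(ℝ, E) t u (ofCoord ψ (fun u => L.symm (0, κ u)) u) = X (t u) := by
  obtain ⟨K, hK, hKX⟩ := h.lifts X hX u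
  obtain ⟨W, hW, hWo, huW⟩ := eventually_nhds_iff.1 hKX
  have h1 := contMDiffOn_mfderiv_apply ψ.open_source (contMDiffOn_of_mem_maximalAtlas hL.mem)
    hK.1.1.contMDiffOn
  refine ⟨W ∩ ψ.source, hWo.inter ψ.open_source, ⟨huW, hu⟩, inter_subset_right,
    fun u => (L (mfderiv 𝓘(ℝ, EU) 𝓘(ℝ, EU) ψ u (K u))).2, ?_, fun u' hu' => ?_⟩
  · have h3 : ContDiff ℝ ∞ fun x : EU => (L x).2 := by fun_prop
    exact h3.contMDiff.comp_contMDiffOn (h1.mono inter_subset_right)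
  · rw [← hW u' hu'.1]
    congr 1
    rw [← ofCoord_mfderiv hL.mem hu'.2 K]
    have h2 := (hL.mfderiv_eq_iff hs hu'.2 _ 0).1 (hK.2 u')
    rw [map_zero] at h2
    unfold ofCoord
    congr 1
    exact (L.symm_apply_eq).2 (Prod.ext h2.symm rfl)

end BisubmersionCharts

/-! ### Lie brackets in coordinates, and brackets of fields extended to M × ℝ -/

section Bracket

open VectorField

variable {E : Type*} [NormedAddCommGroup E] [NormedSpace ℝ E] [CompleteSpace E]
  {H : Type*} [TopologicalSpace H] (I : ModelWithCorners ℝ E H) [I.Boundaryless]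
  {M : Type*} [TopologicalSpace M] [ChartedSpace H M] [IsManifold I ∞ M]

/-- The coordinate expression of a vector field in the preferred chart at `x₀`. -/
noncomputable def coordRep (x₀ : M) (X : ∀ x : M, TangentSpace I x) (y : E) : E :=
  mfderiv I 𝓘(ℝ, E) (extChartAt I x₀) ((extChartAt I x₀).symm y) (X ((extChartAt I x₀).symm y))

omit [CompleteSpace E] [I.Boundaryless] in
-- The pull-back by the inverse chart involves the inverse of its derivative, and this inverse is
-- the derivative of the chart. In this way the manifold bracket, defined through pull-backs,
-- becomes a bracket of explicit maps of the model space.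
theorem mpullbackWithin_eq_coordRep (x₀ : M) (X : ∀ x : M, TangentSpace I x) {y : E}
    (hy : y ∈ (extChartAt I x₀).target) :
    mpullbackWithin 𝓘(ℝ, E) I (extChartAt I x₀).symm X (range I) y = coordRep I x₀ X y := by
  have : IsManifold I 1 M := .of_le (n := ∞) (by simp)
  rw [mpullbackWithin_apply, ContinuousLinearMap.inverse_eq
    (mfderivWithin_extChartAt_symm_comp_mfderiv_extChartAt hy)
    (mfderiv_extChartAt_comp_mfderivWithin_extChartAt_symm hy)]
  rfl

omit [CompleteSpace E] in
theorem mpullbackWithin_eventuallyEq_coordRep (x₀ : M) (X : ∀ x : M, TangentSpace I x) :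
    (mpullbackWithin 𝓘(ℝ, E) I (extChartAt I x₀).symm X (range I) : E → E) =ᶠ[𝓝 (extChartAt I x₀ x₀)]
      coordRep I x₀ X := by
  filter_upwards [extChartAt_target_mem_nhds x₀] with y hy using
    mpullbackWithin_eq_coordRep I x₀ X hy

omit [CompleteSpace E] in
theorem mlieBracket_eq_lieBracket_coordRep (X Y : ∀ x : M, TangentSpace I x) (x₀ : M) :
    (mlieBracket I X Y x₀ : E) =
      lieBracket ℝ (coordRep I x₀ X) (coordRep I x₀ Y) (extChartAt I x₀ x₀) := by
  have : IsManifold I 1 M := .of_le (n := ∞) (by simp)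
  have h1 := Filter.EventuallyEq.lieBracket_vectorField_eq (𝕜 := ℝ)
    (mpullbackWithin_eventuallyEq_coordRep I x₀ X) (mpullbackWithin_eventuallyEq_coordRep I x₀ Y)
  -- The derivative at x₀ of the preferred chart at x₀ is the identity of the model space, so the
  -- outer inverse in the definition of the bracket disappears.
  have h2 : ∀ w : E, ((mfderiv I 𝓘(ℝ, E) (extChartAt I x₀) x₀).inverse w : E) = w := fun w =>
    (congrArg (fun f : E →L[ℝ] E => f.inverse w) (mfderiv_extChartAt_self (I := I) (x := x₀))).trans
      (congrArg (fun f : E →L[ℝ] E => f w) (ContinuousLinearMap.inverse_id (R := ℝ) (M := E)))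
  have h3 : ∀ (f g : E → E) (S : Set E), S = univ → lieBracketWithin ℝ f g S = lieBracket ℝ f g := by
    rintro f g S rfl
    exact lieBracketWithin_univ
  rw [← h1, ← mlieBracketWithin_univ, mlieBracketWithin_apply]
  refine (h2 _).trans (congrFun (h3 _ _ _ ?_) _)
  rw [preimage_univ, univ_inter, I.range_eq_univ]

theorem differentiableAt_coordRep {X : ∀ x : M, TangentSpace I x} {x₀ : M}
    (hX : MDifferentiableAt I I.tangent (fun x => (⟨x, X x⟩ : TangentBundle I M)) x₀) :
    DifferentiableAt ℝ (coordRep I x₀ X) (extChartAt I x₀ x₀) := by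
  have : IsManifold I 2 M := .of_le (n := ∞) (by norm_cast)
  have h1 := (mdifferentiableWithinAt_univ.2 hX).differentiableWithinAt_mpullbackWithin_vectorField
  have h2 := mpullbackWithin_eventuallyEq_coordRep I x₀ X
  refine (h1.differentiableAt ?_).congr_of_eventuallyEq h2.symm
  rw [preimage_univ, univ_inter, I.range_eq_univ]
  exact Filter.univ_mem

omit [CompleteSpace E] [I.Boundaryless] in
-- The preferred chart of M × ℝ is the product of a chart of M and the identity, so its derivative
-- is block diagonal and the ℝ-component remains zero.
theorem coordRep_extendField (X : ∀ x : M, TangentSpace I x) (x₀ : M × ℝ) {y : E × ℝ}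
    (hy : y.1 ∈ (extChartAt I x₀.1).target) :
    coordRep (I.prod 𝓘(ℝ)) x₀ (extendField X) y = (coordRep I x₀.1 X y.1, 0) := by
  have : IsManifold I 1 M := .of_le (n := ∞) (by simp)
  have h1 : (extChartAt (I.prod 𝓘(ℝ)) x₀ : M × ℝ → E × ℝ) =
      Prod.map (extChartAt I x₀.1) id := by
    rw [extChartAt_prod]
    simp
    rfl
  have h2 : (extChartAt (I.prod 𝓘(ℝ)) x₀).symm y = ((extChartAt I x₀.1).symm y.1, y.2) := by
    rw [extChartAt_prod]
    simp
    rfl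
  have h3 : (extChartAt I x₀.1).symm y.1 ∈ (chartAt H x₀.1).source := by
    rw [← extChartAt_source I]
    exact (extChartAt I x₀.1).map_target hy
  unfold coordRep
  rw [h1, h2]
  have h4 : mfderiv (I.prod 𝓘(ℝ)) 𝓘(ℝ, E × ℝ) (Prod.map (extChartAt I x₀.1) (id : ℝ → ℝ))
      ((extChartAt I x₀.1).symm y.1, y.2) =
      (mfderiv I 𝓘(ℝ, E) (extChartAt I x₀.1) ((extChartAt I x₀.1).symm y.1)).prodMap
        (mfderiv 𝓘(ℝ) 𝓘(ℝ) (id : ℝ → ℝ) y.2) := by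
    -- The target E × ℝ carries its own model; it is rewritten as a product of models, the form in
    -- `mfderiv_prodMap`.
    rw [modelWithCornersSelf_prod, ← chartedSpaceSelf_prod]
    exact mfderiv_prodMap (p := ((extChartAt I x₀.1).symm y.1, y.2))
      (mdifferentiableAt_extChartAt (I := I) h3) (mdifferentiableAt_id (I := 𝓘(ℝ)) (M := ℝ))
  refine (congrArg (fun f : E × ℝ →L[ℝ] E × ℝ => f (X ((extChartAt I x₀.1).symm y.1), (0 : ℝ)))
    h4).trans ?_
  refine Prod.ext rfl ?_
  exact map_zero (mfderiv 𝓘(ℝ) 𝓘(ℝ) (id : ℝ → ℝ) y.2)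

/-- In coordinates an extended field is (y, β) ↦ (X y, 0), whose derivative does not see β. The
bracket formula then gives the bracket on M in the first component and zero in the second. -/
theorem mlieBracket_extendField {X Y : ∀ x : M, TangentSpace I x}
    (hX : ContMDiff I I.tangent ∞ (fun x => (⟨x, X x⟩ : TangentBundle I M)))
    (hY : ContMDiff I I.tangent ∞ (fun x => (⟨x, Y x⟩ : TangentBundle I M))) (x₀ : M × ℝ) :
    mlieBracket (I.prod 𝓘(ℝ)) (extendField X) (extendField Y) x₀ =
      extendField (mlieBracket I X Y) x₀ := by
  have key : ∀ X : ∀ x : M, TangentSpace I x, coordRep (I.prod 𝓘(ℝ)) x₀ (extendField X)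
      =ᶠ[𝓝 (extChartAt I x₀.1 x₀.1, x₀.2)] fun y => (coordRep I x₀.1 X y.1, 0) := fun X => by
    have : ∀ᶠ y : E × ℝ in 𝓝 (extChartAt I x₀.1 x₀.1, x₀.2), y.1 ∈ (extChartAt I x₀.1).target :=
      continuousAt_fst.eventually (extChartAt_target_mem_nhds x₀.1)
    filter_upwards [this] with y hy using coordRep_extendField I X x₀ hy
  have h1 : extChartAt (I.prod 𝓘(ℝ)) x₀ x₀ = (extChartAt I x₀.1 x₀.1, x₀.2) := by
    rw [extChartAt_prod]
    simp
    rfl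
  have hd : ∀ {X : ∀ x : M, TangentSpace I x},
      ContMDiff I I.tangent ∞ (fun x => (⟨x, X x⟩ : TangentBundle I M)) →
      HasFDerivAt (fun y : E × ℝ => (coordRep I x₀.1 X y.1, (0 : ℝ)))
      (((fderiv ℝ (coordRep I x₀.1 X) (extChartAt I x₀.1 x₀.1)).comp
        (ContinuousLinearMap.fst ℝ E ℝ)).prod 0) (extChartAt I x₀.1 x₀.1, x₀.2) := fun hX => by
    have := differentiableAt_coordRep I ((hX x₀.1).mdifferentiableAt (by simp))
    exact (HasFDerivAt.comp (f := Prod.fst) (extChartAt I x₀.1 x₀.1, x₀.2) this.hasFDerivAt hasFDerivAt_fst).prodMk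
      (hasFDerivAt_const _ _)
  have h2 := mlieBracket_eq_lieBracket_coordRep (I.prod 𝓘(ℝ)) (extendField X) (extendField Y) x₀
  refine Eq.trans (b := (_ : E × ℝ)) h2 ?_
  rw [h1, Filter.EventuallyEq.lieBracket_vectorField_eq (key X) (key Y)]
  refine Eq.trans ?_ (congrArg (fun z : E => (z, (0 : ℝ)))
    (mlieBracket_eq_lieBracket_coordRep I X Y x₀.1).symm)
  simp only [lieBracket, (hd hX).fderiv, (hd hY).fderiv]
  simp

end Bracket

/-! ### The adiabatic foliation is a foliation -/

section Adiabatic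

open VectorField

variable {E : Type*} [NormedAddCommGroup E] [NormedSpace ℝ E]
  {H : Type*} [TopologicalSpace H] {I : ModelWithCorners ℝ E H}
  {M : Type*} [TopologicalSpace M] [ChartedSpace H M] [IsManifold I ∞ M]
  {F : Set (∀ x : M, TangentSpace I x)}

/-- The derivative of a smooth function along a smooth vector field is smooth. -/
theorem contMDiff_mfderiv_apply {g : M → ℝ} {Y : ∀ x : M, TangentSpace I x}
    (hg : ContMDiff I 𝓘(ℝ) ∞ g)
    (hY : ContMDiff I I.tangent ∞ (fun x => (⟨x, Y x⟩ : TangentBundle I M))) :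
    ContMDiff I 𝓘(ℝ) ∞ (fun x => (mfderiv I 𝓘(ℝ) g x (Y x) : ℝ)) :=
  (contMDiff_snd_tangentBundle_modelSpace (n := ∞) ℝ 𝓘(ℝ)).comp
    ((hg.contMDiff_tangentMap (m := ∞) (by simp)).comp hY)

theorem contMDiff_extendField {X : ∀ x : M, TangentSpace I x}
    (hX : ContMDiff I I.tangent ∞ (fun x => (⟨x, X x⟩ : TangentBundle I M))) :
    ContMDiff (I.prod 𝓘(ℝ)) (I.prod 𝓘(ℝ)).tangent ∞
      (fun p => (⟨p, extendField X p⟩ : TangentBundle (I.prod 𝓘(ℝ)) (M × ℝ))) := by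
  have h0 : ContMDiff 𝓘(ℝ) 𝓘(ℝ).tangent ∞
      (fun x : ℝ => (⟨x, (0 : ℝ)⟩ : TangentBundle 𝓘(ℝ) ℝ)) :=
    Bundle.contMDiff_zeroSection ℝ (TangentSpace 𝓘(ℝ) : ℝ → Type _)
  exact (contMDiff_equivTangentBundleProd_symm (n := ∞) (I := I) (I' := 𝓘(ℝ))).comp
    ((hX.comp contMDiff_fst).prodMk (h0.comp contMDiff_snd))

omit [IsManifold I ∞ M] in
theorem extendField_eq_sum {ι : Type*} [Fintype ι] {X : ∀ x : M, TangentSpace I x}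
    {Y : ι → ∀ x : M, TangentSpace I x} {g : ι → ℝ} {p : M × ℝ}
    (h : X p.1 = ∑ i, g i • Y i p.1) :
    extendField X p = ∑ i, g i • extendField (Y i) p := by
  have h1 : (ContinuousLinearMap.inl ℝ E ℝ) (X p.1) =
      ∑ i, g i • (ContinuousLinearMap.inl ℝ E ℝ) (Y i p.1) :=
    (congrArg (ContinuousLinearMap.inl ℝ E ℝ) h).trans ((map_sum _ _ _).trans
      (Finset.sum_congr rfl fun i _ => map_smul _ _ _))
  exact h1

omit [IsManifold I ∞ M] in
theorem zero_mem_adiabaticFoliation : 0 ∈ adiabaticFoliation I F :=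
  ⟨0, Fin.elim0, Fin.elim0, fun i => i.elim0, fun p => by simp⟩

omit [IsManifold I ∞ M] in
theorem add_mem_adiabaticFoliation {Y Z : ∀ p : M × ℝ, TangentSpace (I.prod 𝓘(ℝ)) p}
    (hY : Y ∈ adiabaticFoliation I F) (hZ : Z ∈ adiabaticFoliation I F) :
    Y + Z ∈ adiabaticFoliation I F := by
  obtain ⟨k, f, X, h1, h2⟩ := hY
  obtain ⟨k', f', X', h1', h2'⟩ := hZ
  refine ⟨k + k', Fin.append f f', Fin.append X X', fun i => ?_, fun u => ?_⟩
  · induction i using Fin.addCases with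
    | left i => simpa using h1 i
    | right i => simpa using h1' i
  · rw [Fin.sum_univ_add]
    simp [h2 u, h2' u]

omit [IsManifold I ∞ M] in
theorem smul_extendField_mem {X : ∀ x : M, TangentSpace I x} (hX : X ∈ F) {f : M × ℝ → ℝ}
    (hf : ContMDiff (I.prod 𝓘(ℝ)) 𝓘(ℝ) ∞ f) (hfc : HasCompactSupport f) :
    (fun p : M × ℝ => (p.2 * f p) • extendField X p) ∈ adiabaticFoliation I F :=
  ⟨1, fun _ => f, fun _ => X, fun _ => ⟨hf, hfc, hX⟩, fun p => by simp⟩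

omit [IsManifold I ∞ M] in
theorem smul_mem_adiabaticFoliation {Y : ∀ p : M × ℝ, TangentSpace (I.prod 𝓘(ℝ)) p}
    (hY : Y ∈ adiabaticFoliation I F) {g : M × ℝ → ℝ} (hg : ContMDiff (I.prod 𝓘(ℝ)) 𝓘(ℝ) ∞ g) :
    (fun p => g p • Y p) ∈ adiabaticFoliation I F := by
  obtain ⟨k, f, X, h1, h2⟩ := hY
  refine ⟨k, fun i u => g u * f i u, X, fun i => ⟨hg.mul (h1 i).1, (h1 i).2.1.mul_left, (h1 i).2.2⟩,
    fun u => ?_⟩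
  simp only [h2 u, Finset.smul_sum, smul_smul]
  exact Finset.sum_congr rfl fun i _ => by rw [mul_left_comm]

omit [IsManifold I ∞ M] in
-- In the additive step both summands are known to be members of the foliation. This is needed for
-- brackets, which are additive only on differentiable fields.
theorem adiabaticFoliation_induction {P : (∀ p : M × ℝ, TangentSpace (I.prod 𝓘(ℝ)) p) → Prop}
    (h0 : P 0)
    (hadd : ∀ Y ∈ adiabaticFoliation I F, ∀ Z ∈ adiabaticFoliation I F, P Y → P Z → P (Y + Z))
    (hgen : ∀ f : M × ℝ → ℝ, ContMDiff (I.prod 𝓘(ℝ)) 𝓘(ℝ) ∞ f → HasCompactSupport f →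
      ∀ X ∈ F, P (fun p => (p.2 * f p) • extendField X p))
    {Y : ∀ p : M × ℝ, TangentSpace (I.prod 𝓘(ℝ)) p} (hY : Y ∈ adiabaticFoliation I F) : P Y := by
  obtain ⟨k, f, X, h1, h2⟩ := hY
  have : Y = ∑ i, fun p : M × ℝ => (p.2 * f i p) • extendField (X i) p := by
    ext p
    rw [h2, Finset.sum_apply]
  rw [this]
  refine (Finset.sum_induction _ (fun Y => Y ∈ adiabaticFoliation I F ∧ P Y) ?_
    ⟨zero_mem_adiabaticFoliation, h0⟩ fun i _ => ⟨smul_extendField_mem (h1 i).2.2 (h1 i).1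
      (h1 i).2.1, hgen _ (h1 i).1 (h1 i).2.1 _ (h1 i).2.2⟩).2
  exact fun Y Z hY hZ => ⟨add_mem_adiabaticFoliation hY.1 hZ.1, hadd _ hY.1 _ hZ.1 hY.2 hZ.2⟩

theorem isSmoothCompactField_of_mem_adiabaticFoliation
    (hF : ∀ X ∈ F, IsSmoothCompactField I X)
    {Y : ∀ p : M × ℝ, TangentSpace (I.prod 𝓘(ℝ)) p} (hY : Y ∈ adiabaticFoliation I F) :
    IsSmoothCompactField (I.prod 𝓘(ℝ)) Y := by
  refine adiabaticFoliation_induction (isSmoothCompactField_zero _ _)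
    (fun _ _ _ _ => isSmoothCompactField_add) (fun f hf hfc X hX => ⟨?_, ?_⟩) hY
  · exact (contMDiff_snd.mul hf).smul_section (contMDiff_extendField (hF X hX).1)
  · refine hfc.of_isClosed_subset isClosed_closure (closure_mono fun p hp h => hp ?_)
    change (p.2 * f p) • extendField X p = 0
    rw [show f p = 0 from h, mul_zero, zero_smul]

/-- With X and Y extended to M × ℝ, the Leibniz rule gives [λf X, λg Y] = (λf)(λg) [X, Y] + λf X(λg)
Y - λg Y(λf) X. A factor λ can be taken out of each term, and what remains is a smooth compactly
supported function times an extended field of F. -/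
theorem mlieBracket_mem_adiabaticFoliation [CompleteSpace E] [I.Boundaryless]
    (hF : IsFoliation I F)
    {Y Z : ∀ p : M × ℝ, TangentSpace (I.prod 𝓘(ℝ)) p} (hY : Y ∈ adiabaticFoliation I F)
    (hZ : Z ∈ adiabaticFoliation I F) :
    mlieBracket (I.prod 𝓘(ℝ)) Y Z ∈ adiabaticFoliation I F := by
  have h2M : IsManifold I 2 M := .of_le (n := ∞) (by norm_cast)
  have h3M : IsManifold I (minSmoothness ℝ 2) M := by simpa using h2M
  have hsm : ∀ {Y : ∀ p : M × ℝ, TangentSpace (I.prod 𝓘(ℝ)) p}, Y ∈ adiabaticFoliation I F →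
      ∀ p, MDifferentiableAt (I.prod 𝓘(ℝ)) (I.prod 𝓘(ℝ)).tangent
        (fun p => (⟨p, Y p⟩ : TangentBundle (I.prod 𝓘(ℝ)) (M × ℝ))) p := fun hY p =>
    ((isSmoothCompactField_of_mem_adiabaticFoliation hF.smooth hY).1 p).mdifferentiableAt (by simp)
  refine adiabaticFoliation_induction (P := fun Y => mlieBracket (I.prod 𝓘(ℝ)) Y Z ∈ _) ?_ ?_ ?_ hY
  · rw [mlieBracket_zero_left]
    exact zero_mem_adiabaticFoliation
  · intro Y₁ k₁ Y₂ k₂ h₁ h₂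
    have : mlieBracket (I.prod 𝓘(ℝ)) (Y₁ + Y₂) Z =
        mlieBracket (I.prod 𝓘(ℝ)) Y₁ Z + mlieBracket (I.prod 𝓘(ℝ)) Y₂ Z := by
      ext p
      exact mlieBracket_add_left (hsm k₁ p) (hsm k₂ p)
    rw [this]
    exact add_mem_adiabaticFoliation h₁ h₂
  intro f hf hfc X hX
  refine adiabaticFoliation_induction (P := fun Z => mlieBracket (I.prod 𝓘(ℝ)) _ Z ∈ _) ?_ ?_ ?_ hZ
  · rw [mlieBracket_zero_right]
    exact zero_mem_adiabaticFoliation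
  · intro Y₁ k₁ Y₂ k₂ h₁ h₂
    have : ∀ Y, mlieBracket (I.prod 𝓘(ℝ)) Y (Y₁ + Y₂) =
        mlieBracket (I.prod 𝓘(ℝ)) Y Y₁ + mlieBracket (I.prod 𝓘(ℝ)) Y Y₂ := fun Y => by
      ext p
      exact mlieBracket_add_right (hsm k₁ p) (hsm k₂ p)
    rw [this]
    exact add_mem_adiabaticFoliation h₁ h₂
  intro g hg hgc Y hY
  have ha : ContMDiff (I.prod 𝓘(ℝ)) 𝓘(ℝ) ∞ fun p : M × ℝ => p.2 * f p := contMDiff_snd.mul hf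
  have hb : ContMDiff (I.prod 𝓘(ℝ)) 𝓘(ℝ) ∞ fun p : M × ℝ => p.2 * g p := contMDiff_snd.mul hg
  have hX' := contMDiff_extendField (hF.smooth X hX).1
  have hY' := contMDiff_extendField (hF.smooth Y hY).1
  -- The derivatives Y(λf) and X(λg) are named as real functions, since as values of derivatives
  -- they are typed in tangent spaces, where products of functions are not available.
  obtain ⟨da, hda, hdaY⟩ : ∃ da : M × ℝ → ℝ, ContMDiff (I.prod 𝓘(ℝ)) 𝓘(ℝ) ∞ da ∧ ∀ p, da p =
      mfderiv (I.prod 𝓘(ℝ)) 𝓘(ℝ) (fun p : M × ℝ => p.2 * f p) p (extendField Y p) :=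
    ⟨_, contMDiff_mfderiv_apply ha hY', fun _ => rfl⟩
  obtain ⟨db, hdb, hdbX⟩ : ∃ db : M × ℝ → ℝ, ContMDiff (I.prod 𝓘(ℝ)) 𝓘(ℝ) ∞ db ∧ ∀ p, db p =
      mfderiv (I.prod 𝓘(ℝ)) 𝓘(ℝ) (fun p : M × ℝ => p.2 * g p) p (extendField X p) :=
    ⟨_, contMDiff_mfderiv_apply hb hX', fun _ => rfl⟩
  -- The three terms of the Leibniz rule; f or g provides the compact support of the coefficient.
  have h1 := smul_extendField_mem (I := I) (f := fun p => f p * (p.2 * g p))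
    (hF.lie_mem X hX Y hY) (hf.mul hb) hfc.mul_right
  have h2 := smul_extendField_mem (I := I) (f := fun p => f p * db p) hY (hf.mul hdb) hfc.mul_right
  have h3 := smul_extendField_mem (I := I) (f := fun p => -1 * (g p * da p)) hX
    (contMDiff_const.mul (hg.mul hda)) hgc.mul_right.mul_left
  convert add_mem_adiabaticFoliation (add_mem_adiabaticFoliation h1 h2) h3 using 1
  ext p
  have e1 := mlieBracket_smul_left (I := I.prod 𝓘(ℝ)) (V := extendField X)
    (W := fun p => (p.2 * g p) • extendField Y p) (f := fun p : M × ℝ => p.2 * f p)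
    (x := p) ((ha p).mdifferentiableAt (by simp)) ((hX' p).mdifferentiableAt (by simp))
  have e2 := mlieBracket_smul_right (I := I.prod 𝓘(ℝ)) (V := extendField X)
    (W := extendField Y) (f := fun p : M × ℝ => p.2 * g p)
    (x := p) ((hb p).mdifferentiableAt (by simp)) ((hY' p).mdifferentiableAt (by simp))
  have e3 := mlieBracket_extendField I (hF.smooth X hX).1 (hF.smooth Y hY).1 p
  -- The Leibniz rule is rearranged in the model space E × ℝ, where `module` can work.
  have key : ∀ (a b da db : ℝ) (x y w w' : E × ℝ), w = w' →
      -(b * da) • x + a • (db • y + b • w) =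
        (a * b) • w' + (a * db) • y + (-(b * da)) • x := fun a b da db x y w w' h => by
    subst h
    module
  refine Eq.trans (b := (_ : E × ℝ)) (e1.trans ?_) ((key (p.2 * f p) (p.2 * g p)
    (da p) (db p)
    (extendField X p) (extendField Y p) _ _ e3).trans ?_)
  · refine congrArg₂ (fun a b : E × ℝ => a + b) ?_ ?_
    · refine congrArg (fun r : ℝ => -r • (extendField X p : E × ℝ)) ?_
      rw [hdaY]
      exact map_smul (mfderiv (I.prod 𝓘(ℝ)) 𝓘(ℝ) (fun p : M × ℝ => p.2 * f p) p) _ _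
    · exact congrArg (fun w : E × ℝ => (p.2 * f p) • w) (e2.trans (by rw [hdbX]; rfl))
  · simp only [Pi.add_apply]
    refine congrArg₂ (fun a b : E × ℝ => a + b) (congrArg₂ (fun a b : E × ℝ => a + b) ?_ ?_) ?_
    all_goals refine congrArg (fun r : ℝ => r • (_ : E × ℝ)) ?_
    all_goals ring

variable [FiniteDimensional ℝ E] [T2Space M] [SigmaCompactSpace M]

/-- Local generators are λθ (Xₐ ⊗ 1), where the Xₐ generate F locally and θ is a bump function. If Y
= ∑ λ fᵢ (Zᵢ ⊗ 1), it remains to expand each Zᵢ in the Xₐ after a cut-off. -/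
theorem exists_generators_adiabaticFoliation (hF : IsFoliation I F) (x₀ : M × ℝ) :
    ∃ W : Set (M × ℝ), IsOpen W ∧ x₀ ∈ W ∧
    ∃ (k : ℕ) (X : Fin k → ∀ p : M × ℝ, TangentSpace (I.prod 𝓘(ℝ)) p),
      (∀ i, X i ∈ adiabaticFoliation I F) ∧
      ∀ Y ∈ adiabaticFoliation I F, closure {x | Y x ≠ 0} ⊆ W →
        ∃ f : Fin k → M × ℝ → ℝ, (∀ i, ContMDiff (I.prod 𝓘(ℝ)) 𝓘(ℝ) ∞ (f i) ∧
          HasCompactSupport (f i) ∧ tsupport (f i) ⊆ W) ∧ ∀ x, Y x = ∑ i, f i x • X i x := by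
  obtain ⟨W, hW, hxW, k, X, hX, hgen⟩ := hF.locally_fg x₀.1
  -- Members of the adiabatic foliation need compactly supported coefficients, hence the factor θ.
  -- It equals 1 on W₁ and so does not affect fields supported there.
  obtain ⟨θ, hθ, hθc, -, hθ1⟩ := exists_bump_nhds (I.prod 𝓘(ℝ)) (u := x₀) (W := univ)
    Filter.univ_mem
  obtain ⟨W₁, hθ1, hW₁, hxW₁⟩ := eventually_nhds_iff.1 hθ1
  refine ⟨W₁ ∩ Prod.fst ⁻¹' W, hW₁.inter (hW.preimage continuous_fst), ⟨hxW₁, hxW⟩, k,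
    fun i p => (p.2 * θ p) • extendField (X i) p, fun i => smul_extendField_mem (hX i) hθ hθc,
    fun Y hY hYW => ?_⟩
  have hYc := (isSmoothCompactField_of_mem_adiabaticFoliation hF.smooth hY).2
  -- There are two cut-offs: χ on M × ℝ is 1 near the support of Y, and χ' on M is 1 near the
  -- projection of the support of χ. The fields χ' Zᵢ are supported in W, as the local generation of
  -- F requires.
  obtain ⟨χ, hχ, hχc, hχW, hχ1⟩ := exists_bump (I.prod 𝓘(ℝ)) hYc
    (hW₁.inter (hW.preimage continuous_fst)) hYW
  obtain ⟨χ', hχ', hχc', hχW', hχ1'⟩ := exists_bump I (hχc.image continuous_fst) hW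
    (image_subset_iff.2 (hχW.trans inter_subset_right))
  obtain ⟨n, f, Z, hf, hYf⟩ := hY
  have hZ : ∀ i, ∃ g : Fin k → M → ℝ, (∀ a, ContMDiff I 𝓘(ℝ) ∞ (g a)) ∧
      ∀ x, χ' x • Z i x = ∑ a, g a x • X a x := fun i => by
    obtain ⟨g, hg, h⟩ := hgen _ (hF.smul_mem χ' hχ' _ (hf i).2.2) (Subset.trans
      (closure_mono fun x hx h => hx (by rw [h, zero_smul]) :
        closure {x | χ' x • Z i x ≠ 0} ⊆ tsupport χ') hχW')
    exact ⟨g, fun a => (hg a).1, h⟩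
  choose g hg hgZ using hZ
  refine ⟨fun a p => χ p * ∑ i, f i p * g i a p.1, fun a => ⟨hχ.mul ?_, hχc.mul_right,
    (tsupport_mul_subset_left).trans hχW⟩, fun p => ?_⟩
  · exact contMDiff_finsetSum fun i _ => (hf i).1.mul ((hg i a).comp contMDiff_fst)
  have h1 : Y p = χ p • Y p := by
    by_cases hp : p ∈ closure {x | Y x ≠ 0}
    · rw [(hχ1.self_of_nhdsSet) p hp, one_smul]
    · rw [not_not.1 fun h : Y p ≠ 0 => hp (subset_closure h), smul_zero]
  rw [h1, hYf]
  by_cases hp : χ p = 0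
  · simp [hp]
  have hps : p ∈ tsupport χ := subset_tsupport _ hp
  have h2 : ∀ i, extendField (Z i) p = ∑ a, g i a p.1 • extendField (X a) p := fun i => by
    refine extendField_eq_sum ?_
    rw [← hgZ, hχ1'.self_of_nhdsSet p.1 (mem_image_of_mem _ hps), one_smul]
  simp only [h2, hθ1 p (hχW hps).1, mul_one, Finset.smul_sum, smul_smul, Finset.mul_sum,
    Finset.sum_mul, Finset.sum_smul]
  rw [Finset.sum_comm]
  exact Finset.sum_congr rfl fun a _ => Finset.sum_congr rfl fun i _ => by congr 1; ring

theorem isFoliation_adiabaticFoliation [I.Boundaryless] (hF : IsFoliation I F) :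
    IsFoliation (I.prod 𝓘(ℝ)) (adiabaticFoliation I F) where
  smooth _ := isSmoothCompactField_of_mem_adiabaticFoliation hF.smooth
  zero_mem := zero_mem_adiabaticFoliation
  add_mem _ hY _ hZ := add_mem_adiabaticFoliation hY hZ
  smul_mem _ hf _ hY := smul_mem_adiabaticFoliation hY hf
  lie_mem _ hY _ hZ := mlieBracket_mem_adiabaticFoliation hF hY hZ
  locally_fg := exists_generators_adiabaticFoliation hF

end Adiabatic

/-! ### The manifold `D(U, V)` -/

section Deformation

open NormalConeDeformation

variable {EV : Type v} [NormedAddCommGroup EV] [NormedSpace ℝ EV]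
  {EU : Type u} [NormedAddCommGroup EU] [NormedSpace ℝ EU] [FiniteDimensional ℝ EU]
  {V : Type w} [TopologicalSpace V] [ChartedSpace EV V]
  {U : Type z} [TopologicalSpace U] [ChartedSpace EU U] [IsManifold 𝓘(ℝ, EU) ∞ U]
  {j : EmbeddedSubmanifold EV EU V U}
  {e : OpenPartialHomeomorph (NormalConeDeformation j) (EU × ℝ)}
  {ψ : OpenPartialHomeomorph U EU} {π : EU →L[ℝ] EU} {T : Prop}

theorem exists_chart_of_mem_deformationAtlas
    {e : PartialEquiv (NormalConeDeformation j) (EU × ℝ)} (he : e ∈ deformationAtlas j) :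
    ∃ f : OpenPartialHomeomorph (NormalConeDeformation j) (EU × ℝ), f.toPartialEquiv = e ∧
      f ∈ IsManifold.maximalAtlas 𝓘(ℝ, EU × ℝ) ∞ (NormalConeDeformation j) := by
  refine ⟨(chartedSpaceCore j).openPartialHomeomorph e he, rfl, IsManifold.subset_maximalAtlas ?_⟩
  change (chartedSpaceCore j).openPartialHomeomorph e he ∈
    ⋃ (e : PartialEquiv (NormalConeDeformation j) (EU × ℝ))
      (he : e ∈ (chartedSpaceCore j).atlas), {(chartedSpaceCore j).openPartialHomeomorph e he}
  exact mem_iUnion₂.2 ⟨e, he, rfl⟩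

theorem exists_slice_openPartialHomeomorph (c : SliceChart j) :
    ∃ f : OpenPartialHomeomorph (NormalConeDeformation j) (EU × ℝ),
      f ∈ IsManifold.maximalAtlas 𝓘(ℝ, EU × ℝ) ∞ (NormalConeDeformation j) ∧
      IsDeformationChart f.toPartialEquiv c.chart c.proj True := by
  obtain ⟨f, hf, h⟩ := exists_chart_of_mem_deformationAtlas (Or.inl ⟨c, rfl⟩)
  exact ⟨f, h, hf ▸ isDeformationChart_slice c⟩

theorem exists_off_openPartialHomeomorph (j : EmbeddedSubmanifold EV EU V U)
    (hψ : ψ ∈ IsManifold.maximalAtlas 𝓘(ℝ, EU) ∞ U) :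
    ∃ f : OpenPartialHomeomorph (NormalConeDeformation j) (EU × ℝ),
      f ∈ IsManifold.maximalAtlas 𝓘(ℝ, EU × ℝ) ∞ (NormalConeDeformation j) ∧
      IsDeformationChart f.toPartialEquiv ψ (ContinuousLinearMap.id ℝ EU) False := by
  obtain ⟨f, hf, h⟩ := exists_chart_of_mem_deformationAtlas (j := j) (Or.inr ⟨ψ, hψ, rfl⟩)
  exact ⟨f, h, hf ▸ isDeformationChart_off hψ⟩

theorem exists_deformationChart (x : NormalConeDeformation j) :
    ∃ (f : OpenPartialHomeomorph (NormalConeDeformation j) (EU × ℝ))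
      (ψ : OpenPartialHomeomorph U EU) (π : EU →L[ℝ] EU) (T : Prop),
      f ∈ IsManifold.maximalAtlas 𝓘(ℝ, EU × ℝ) ∞ (NormalConeDeformation j) ∧
      IsDeformationChart f.toPartialEquiv ψ π T ∧ x ∈ f.source := by
  cases x with
  | off p β hβ =>
    obtain ⟨f, h, hf⟩ := exists_off_openPartialHomeomorph j
      (IsManifold.chart_mem_maximalAtlas (I := 𝓘(ℝ, EU)) (n := ∞) p)
    exact ⟨f, _, _, _, h, hf, (hf.source _).2 ⟨mem_chart_source EU p, Or.inl hβ⟩⟩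
  | normal v n =>
    obtain ⟨c, hc⟩ := j.exists_sliceChart v
    obtain ⟨f, h, hf⟩ := exists_slice_openPartialHomeomorph c
    exact ⟨f, _, _, _, h, hf, (hf.source _).2 ⟨hc, Or.inr trivial⟩⟩

omit [FiniteDimensional ℝ EU] [IsManifold 𝓘(ℝ, EU) ∞ U] in
theorem proj_eq_of_isDeformationChart {e : PartialEquiv (NormalConeDeformation j) (EU × ℝ)}
    (h : IsDeformationChart e ψ π T) {x : NormalConeDeformation j}
    (hx : x ∈ e.source) : x.proj = (ψ.symm (scale π (e x).2 (e x).1), (e x).2) := by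
  rw [← h.symm_proj (e.map_source hx), e.left_inv hx]

/-- In a chart of D(U, V) the map q is (y, β) ↦ (ψ⁻¹ of the rescaled y, β), and the rescaling is
polynomial. -/
theorem contMDiff_proj : ContMDiff 𝓘(ℝ, EU × ℝ) (𝓘(ℝ, EU).prod 𝓘(ℝ)) ∞
    (proj : NormalConeDeformation j → U × ℝ) := by
  intro x
  obtain ⟨e, ψ, π, T, he, h, hx⟩ := exists_deformationChart x
  have h1 := contMDiffOn_of_mem_maximalAtlas he
  have h2 : ContMDiffOn 𝓘(ℝ, EU × ℝ) 𝓘(ℝ, EU) ∞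
      (fun x => ψ.symm (scale π (e x).2 (e x).1)) e.source :=
    (contMDiffOn_symm_of_mem_maximalAtlas h.mem).comp
      ((contDiff_scale π).contMDiff.comp_contMDiffOn h1) fun x hx =>
        ((h.target _).1 (e.map_source hx)).1
  have h3 : ContMDiffOn 𝓘(ℝ, EU × ℝ) 𝓘(ℝ) ∞ (fun x => (e x).2) e.source :=
    contDiff_snd.contMDiff.comp_contMDiffOn h1
  exact ((h2.prodMk h3).congr fun x hx => proj_eq_of_isDeformationChart h hx).contMDiffAt
    (e.open_source.mem_nhds hx)

theorem continuous_proj : Continuous (proj : NormalConeDeformation j → U × ℝ) :=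
  contMDiff_proj.continuous

/-- Points with different images by q are separated in U × ℝ. Distinct points with the same image
lie in one fibre of the normal bundle, and a slice chart contains that whole fibre. -/
theorem t2Space_deformation [T2Space U] : T2Space (NormalConeDeformation j) := by
  refine ⟨fun x y hxy => ?_⟩
  by_cases hp : x.proj = y.proj
  · have key : ∃ e : OpenPartialHomeomorph (NormalConeDeformation j) (EU × ℝ),
        x ∈ e.source ∧ y ∈ e.source := by
      cases x with
      | off p β hβ =>
        cases y with
        | off p' β' hβ' =>
          simp only [proj, Prod.mk.injEq] at hp
          obtain ⟨rfl, rfl⟩ := hp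
          exact absurd rfl hxy
        | normal v n => exact absurd (congrArg Prod.snd hp) hβ
      | normal v n =>
        obtain ⟨c, hc⟩ := j.exists_sliceChart v
        obtain ⟨f, h, hf⟩ := exists_slice_openPartialHomeomorph c
        exact ⟨f, (hf.source _).2 ⟨hc, Or.inr trivial⟩, (hf.source _).2 ⟨hp ▸ hc, Or.inr trivial⟩⟩
    obtain ⟨e, hx, hy⟩ := key
    obtain ⟨A, B, hA, hB, hxA, hyB, hAB⟩ := t2_separation (e.injOn.ne hx hy hxy)
    exact ⟨e.source ∩ e ⁻¹' A, e.source ∩ e ⁻¹' B, e.isOpen_inter_preimage hA,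
      e.isOpen_inter_preimage hB, ⟨hx, hxA⟩, ⟨hy, hyB⟩,
      (hAB.preimage e).mono inter_subset_right inter_subset_right⟩
  · exact separated_by_continuous continuous_proj hp

/-- Countably many charts suffice: a countable cover of U gives those over β ≠ 0, and a countable
cover of V gives slice charts that contain the normal bundle. -/
theorem secondCountable_deformation [SecondCountableTopology U] :
    SecondCountableTopology (NormalConeDeformation j) := by
  have : SecondCountableTopology (EU × ℝ) := inferInstance
  have hV : SecondCountableTopology V :=
    j.isSmoothEmbedding.isEmbedding.secondCountableTopology
  obtain ⟨A, hA, hAU⟩ := countable_cover_nhds fun p : U => chart_source_mem_nhds EU p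
  choose c hc using j.exists_sliceChart
  obtain ⟨B, hB, hBV⟩ := countable_cover_nhds fun v : V =>
    (j.isSmoothEmbedding.isEmbedding.continuous.tendsto v).eventually
      ((c v).chart.open_source.mem_nhds (hc v))
  choose f hf using fun p => exists_off_openPartialHomeomorph j
    (IsManifold.chart_mem_maximalAtlas (I := 𝓘(ℝ, EU)) (n := ∞) p)
  choose g hg using fun v => exists_slice_openPartialHomeomorph (c v)
  have : Countable A := hA.to_subtype
  have : Countable B := hB.to_subtype
  let S : A ⊕ B → Set (NormalConeDeformation j) := Sum.elim (fun p => (f p).source)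
    (fun v => (g v).source)
  have : ∀ i, SecondCountableTopology (S i) := by
    rintro (p | v)
    · exact (f p).secondCountableTopology_source
    · exact (g v).secondCountableTopology_source
  refine TopologicalSpace.secondCountableTopology_of_countable_cover (U := S) ?_ ?_
  · rintro (p | v)
    · exact (f p).open_source
    · exact (g v).open_source
  · refine eq_univ_of_forall fun x => mem_iUnion.2 ?_
    cases x with
    | off p β hβ =>
      obtain ⟨a, ha, hpa⟩ := mem_iUnion₂.1 (hAU.symm ▸ mem_univ p)
      exact ⟨Sum.inl ⟨a, ha⟩, ((hf a).2.source _).2 ⟨hpa, Or.inl hβ⟩⟩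
    | normal v n =>
      obtain ⟨b, hb, hvb⟩ := mem_iUnion₂.1 (hBV.symm ▸ mem_univ v)
      exact ⟨Sum.inr ⟨b, hb⟩, ((hg b).2.source _).2 ⟨hvb, Or.inr trivial⟩⟩

end Deformation

/-! ### Charts adapted to a submersion and to a section of it -/

section SliceSubmersion

variable {E : Type*} [NormedAddCommGroup E] [NormedSpace ℝ E]
  {M : Type*} [TopologicalSpace M] [ChartedSpace E M]
  {EU : Type*} [NormedAddCommGroup EU] [NormedSpace ℝ EU]
  {U : Type*} [TopologicalSpace U] [ChartedSpace EU U] [IsManifold 𝓘(ℝ, EU) ∞ U]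
  {V : Type*} [TopologicalSpace V] [ChartedSpace E V]
  {N : Type*} [NormedAddCommGroup N] [NormedSpace ℝ N]
  {j : EmbeddedSubmanifold E EU V U} {p : U → M}
  {ψ : OpenPartialHomeomorph U EU} {φ : OpenPartialHomeomorph M E} {L : EU ≃L[ℝ] E × N}

/-- The translation `(x, k) ↦ (x, k - h x)` of `E × N`, seen in `EU`. -/
def graphShear (L : EU ≃L[ℝ] E × N) {h : E → N} {O : Set E} (hO : IsOpen O)
    (hh : ContinuousOn h O) : OpenPartialHomeomorph EU EU where
  toFun y := L.symm ((L y).1, (L y).2 - h (L y).1)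
  invFun y := L.symm ((L y).1, (L y).2 + h (L y).1)
  source := {y | (L y).1 ∈ O}
  target := {y | (L y).1 ∈ O}
  map_source' y hy := by simpa using hy
  map_target' y hy := by simpa using hy
  left_inv' y _ := by simp
  right_inv' y _ := by simp
  open_source := hO.preimage (continuous_fst.comp L.continuous)
  open_target := hO.preimage (continuous_fst.comp L.continuous)
  continuousOn_toFun := L.symm.continuous.comp_continuousOn (by
    have h1 : Continuous fun y => (L y).1 := continuous_fst.comp L.continuous
    have h2 : Continuous fun y => (L y).2 := continuous_snd.comp L.continuous
    exact h1.continuousOn.prodMk (h2.continuousOn.sub (hh.comp h1.continuousOn fun y hy => hy)))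
  continuousOn_invFun := L.symm.continuous.comp_continuousOn (by
    have h1 : Continuous fun y => (L y).1 := continuous_fst.comp L.continuous
    have h2 : Continuous fun y => (L y).2 := continuous_snd.comp L.continuous
    exact h1.continuousOn.prodMk (h2.continuousOn.add (hh.comp h1.continuousOn fun y hy => hy)))

theorem contDiffOn_graphShear (L : EU ≃L[ℝ] E × N) {h : E → N} {O : Set E} (hO : IsOpen O)
    (hh : ContDiffOn ℝ ∞ h O) :
    ContDiffOn ℝ ∞ (graphShear L hO hh.continuousOn) {y | (L y).1 ∈ O} ∧
      ContDiffOn ℝ ∞ (graphShear L hO hh.continuousOn).symm {y | (L y).1 ∈ O} := by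
  have h1 : ContDiff ℝ ∞ fun y => (L y).1 := contDiff_fst.comp L.contDiff
  have h2 : ContDiff ℝ ∞ fun y => (L y).2 := contDiff_snd.comp L.contDiff
  have h3 : ContDiffOn ℝ ∞ (fun y => h (L y).1) {y | (L y).1 ∈ O} :=
    hh.comp h1.contDiffOn fun y hy => hy
  exact ⟨L.symm.contDiff.comp_contDiffOn (h1.contDiffOn.prodMk (h2.contDiffOn.sub h3)),
    L.symm.contDiff.comp_contDiffOn (h1.contDiffOn.prodMk (h2.contDiffOn.add h3))⟩

/-- Near a point of a submanifold on which the submersion `p` is étale, there is a chart adapted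
both to `p` and to the submanifold. -/
theorem exists_sliceChart_isSubmersionChart
    (hp : IsSubmersionOfComplement N 𝓘(ℝ, EU) 𝓘(ℝ, E) ∞ p)
    (hV : IsLocalDiffeomorph 𝓘(ℝ, E) 𝓘(ℝ, E) ∞ (fun v => p (j.incl v))) (v : V) :
    ∃ (c : SliceChart j) (φ : OpenPartialHomeomorph M E) (L : EU ≃L[ℝ] E × N),
      IsSubmersionChart p c.chart φ L ∧ j.incl v ∈ c.chart.source ∧
      ∀ y, c.proj y = L.symm ((L y).1, 0) := by
  obtain ⟨ψ, φ, L, hL, hv⟩ := exists_isSubmersionChart hp (j.incl v)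
  obtain ⟨Φ, hvΦ, hΦ⟩ := hV v
  -- The open set S isolates the sheet of V on which p restricts to the diffeomorphism Φ; other
  -- sheets of V could meet the domain of ψ.
  obtain ⟨S, hS, hSΦ⟩ := j.isSmoothEmbedding.isEmbedding.isInducing.isOpen_iff.1 Φ.open_source
  have hSmem : ∀ x, x ∈ Φ.source ↔ j.incl x ∈ S := fun x => by rw [← hSΦ]; rfl
  let Ψ := Φ.toOpenPartialHomeomorph
  have hΨ : ∀ x ∈ Φ.source, p (j.incl x) = Ψ x := fun x hx => hΦ hx
  -- the section of `p` defined by `V`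
  have hσ : ContMDiffOn 𝓘(ℝ, E) 𝓘(ℝ, EU) ∞ (fun x => j.incl (Ψ.symm x)) Φ.target :=
    j.isSmoothEmbedding.contMDiff.comp_contMDiffOn Φ.contMDiffOn_invFun
  let O₁ : Set M := Φ.target ∩ (fun x => j.incl (Ψ.symm x)) ⁻¹' ψ.source
  have hO₁ : IsOpen O₁ := hσ.continuousOn.isOpen_inter_preimage Φ.open_target ψ.open_source
  let O : Set E := φ.target ∩ φ.symm ⁻¹' O₁
  have hO : IsOpen O := φ.isOpen_inter_preimage_symm hO₁
  -- In the chart, the sheet of V is the graph of h over O. The shear (x, k) ↦ (x, k - h x) turns it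
  -- into the zero section and preserves the projection to E.
  let h : E → N := fun x => (L (ψ (j.incl (Ψ.symm (φ.symm x))))).2
  have hh : ContDiffOn ℝ ∞ h O := by
    rw [← contMDiffOn_iff_contDiffOn]
    have h1 : ContMDiffOn 𝓘(ℝ, E) 𝓘(ℝ, EU) ∞ (fun x => ψ (j.incl (Ψ.symm (φ.symm x)))) O :=
      (contMDiffOn_of_mem_maximalAtlas hL.mem).comp (hσ.comp
        ((contMDiffOn_symm_of_mem_maximalAtlas hL.mem').mono inter_subset_left)
        fun x hx => hx.2.1) fun x hx => hx.2.2
    have h2 : ContDiff ℝ ∞ fun y : EU => (L y).2 := contDiff_snd.comp L.contDiff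
    exact h2.contMDiff.comp_contMDiffOn h1
  let τ := graphShear L hO hh.continuousOn
  have hτ := contDiffOn_graphShear L hO hh
  have hLτ : ∀ y, L (τ y) = ((L y).1, (L y).2 - h (L y).1) := fun y => L.apply_symm_apply _
  let χ := (ψ.restr S).trans τ
  have hχs : ∀ u, u ∈ χ.source ↔ (u ∈ ψ.source ∧ u ∈ S) ∧ (L (ψ u)).1 ∈ O := fun u => by
    simp only [χ, OpenPartialHomeomorph.trans_source, ψ.restr_source' S hS]
    rfl
  have hχ : χ ∈ IsManifold.maximalAtlas 𝓘(ℝ, EU) ∞ U := by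
    have h1 := restr_mem_maximalAtlas _ hL.mem hS
    refine χ.mem_maximalAtlas_of_contMDiffOn ?_ ?_
    · exact hτ.1.contMDiffOn.comp ((contMDiffOn_of_mem_maximalAtlas h1).mono inter_subset_left)
        inter_subset_right
    · exact (contMDiffOn_symm_of_mem_maximalAtlas h1).comp
        (hτ.2.contMDiffOn.mono inter_subset_left) inter_subset_right
  have hLχ : ∀ u, L (χ u) = ((L (ψ u)).1, (L (ψ u)).2 - h (L (ψ u)).1) := fun u => hLτ _
  have hsec : ∀ x ∈ O, (L (ψ (j.incl (Ψ.symm (φ.symm x))))) = (x, h x) := fun x hx => by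
    refine Prod.ext ?_ rfl
    rw [← hL.eq _ hx.2.2]
    refine (congrArg φ (hΨ _ (Φ.map_target hx.2.1))).trans ?_
    exact (congrArg φ (Φ.right_inv hx.2.1)).trans (φ.right_inv hx.1)
  let P : EU →L[ℝ] EU := (L.symm : E × N →L[ℝ] EU).comp
    ((ContinuousLinearMap.inl ℝ E N).comp ((ContinuousLinearMap.fst ℝ E N).comp
      (L : EU →L[ℝ] E × N)))
  have hP : ∀ y, P y = L.symm ((L y).1, 0) := fun y => rfl
  refine ⟨⟨χ, hχ, P, fun y => by simp [hP], fun u hu => ?_⟩, φ, L, ⟨hχ, hL.mem', fun u hu => ?_,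
    fun u hu => ?_⟩, ?_, hP⟩
  · obtain ⟨⟨hu1, hu2⟩, hu3⟩ := (hχs u).1 hu
    -- After the shear, being fixed by P means that the N-coordinate vanishes, that is, that u lies
    -- on the graph of h.
    have e1 : P (χ u) = χ u ↔ L (ψ u) = ((L (ψ u)).1, h (L (ψ u)).1) := by
      rw [hP, L.symm_apply_eq, hLχ, Prod.ext_iff, Prod.ext_iff]
      simp only [true_and]
      rw [eq_comm, sub_eq_zero]
    rw [e1, ← hsec _ hu3]
    constructor
    · rintro ⟨x, rfl⟩
      have hx := (hSmem x).2 hu2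
      have e2 : φ.symm (L (ψ (j.incl x))).1 = Φ x := by
        rw [← hL.eq _ hu1, φ.left_inv (hL.mapsTo _ hu1)]
        exact hΨ x hx
      rw [e2]
      exact congrArg (fun z => L (ψ (j.incl z))) (Φ.left_inv hx).symm
    · intro e2
      exact ⟨_, (ψ.injOn hu1 hu3.2.2 (L.injective e2)).symm⟩
  · exact hL.mapsTo u ((hχs u).1 hu).1.1
  · change φ (p u) = (L (χ u)).1
    rw [hLχ]
    exact hL.eq u ((hχs u).1 hu).1.1
  · have e1 : φ.symm (L (ψ (j.incl v))).1 = Φ v := by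
      rw [← hL.eq _ hv, φ.left_inv (hL.mapsTo _ hv)]
      exact hΨ v hvΦ
    have e2 : Ψ.symm (φ.symm (L (ψ (j.incl v))).1) = v := by
      rw [e1]
      exact Φ.left_inv hvΦ
    refine (hχs _).2 ⟨⟨hv, (hSmem v).1 hvΦ⟩, ?_, ?_, ?_⟩
    · rw [← hL.eq _ hv]
      exact φ.map_source (hL.mapsTo _ hv)
    · rw [e1]
      exact Φ.map_source hvΦ
    · change j.incl (Ψ.symm (φ.symm (L (ψ (j.incl v))).1)) ∈ ψ.source
      rw [e2]
      exact hv

end SliceSubmersion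

/-! ### Submersions in the charts of `D(U, V)` -/

section DeformationSubmersion

open NormalConeDeformation

variable {E : Type*} [NormedAddCommGroup E] [NormedSpace ℝ E]
  {M : Type*} [TopologicalSpace M] [ChartedSpace E M]   {EU : Type*} [NormedAddCommGroup EU] [NormedSpace ℝ EU] [FiniteDimensional ℝ EU]
  {U : Type*} [TopologicalSpace U] [ChartedSpace EU U] [IsManifold 𝓘(ℝ, EU) ∞ U]
  {V : Type*} [TopologicalSpace V] [ChartedSpace E V]
  {N : Type*} [NormedAddCommGroup N] [NormedSpace ℝ N]
  {j : EmbeddedSubmanifold E EU V U} {p t : U → M}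
  {e : OpenPartialHomeomorph (NormalConeDeformation j) (EU × ℝ)}
  {ψ : OpenPartialHomeomorph U EU} {φ : OpenPartialHomeomorph M E} {L : EU ≃L[ℝ] E × N}
  {π : EU →L[ℝ] EU} {T : Prop} {r g g' : ℝ → ℝ}

/-- A chart `e` of `D(U, V)` in which `p ∘ q` is a linear projection; along the fibres of `p` the
deformation is the multiplication by `r β`, where `r` and `β` are multiples of each other. -/
structure IsDeformationSubmersionChart (p : U → M)
    (e : OpenPartialHomeomorph (NormalConeDeformation j) (EU × ℝ)) (ψ : OpenPartialHomeomorph U EU)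
    (φ : OpenPartialHomeomorph M E) (L : EU ≃L[ℝ] E × N) (π : EU →L[ℝ] EU) (T : Prop)
    (r g g' : ℝ → ℝ) : Prop where
  mem : e ∈ IsManifold.maximalAtlas 𝓘(ℝ, EU × ℝ) ∞ (NormalConeDeformation j)
  chart : IsDeformationChart e.toPartialEquiv ψ π T
  submersion : IsSubmersionChart p ψ φ L
  scale_fst : ∀ β y, (L (scale π β y)).1 = (L y).1
  scale_vertical : ∀ β ξ, scale π β (L.symm (0, ξ)) = r β • L.symm (0, ξ)
  eq_mul : ∀ x ∈ e.source, r x.proj.2 = x.proj.2 * g x.proj.2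
  eq_mul' : ∀ x ∈ e.source, x.proj.2 = r x.proj.2 * g' x.proj.2
  contDiffAt : ∀ x ∈ e.source, ContDiffAt ℝ ∞ g x.proj.2
  contDiffAt' : ∀ x ∈ e.source, ContDiffAt ℝ ∞ g' x.proj.2

/-- Where β ≠ 0 the chart ψ × id rescales nothing: r = 1, a multiple of β by the factor β⁻¹. At a
normal vector the slice chart also adapted to p rescales exactly the fibre N, and r β = β. -/
theorem exists_isDeformationSubmersionChart
    (hp : IsSubmersionOfComplement N 𝓘(ℝ, EU) 𝓘(ℝ, E) ∞ p)
    (hV : IsLocalDiffeomorph 𝓘(ℝ, E) 𝓘(ℝ, E) ∞ (fun v => p (j.incl v)))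
    (x : NormalConeDeformation j) :
    ∃ (e : OpenPartialHomeomorph (NormalConeDeformation j) (EU × ℝ))
      (ψ : OpenPartialHomeomorph U EU) (φ : OpenPartialHomeomorph M E) (L : EU ≃L[ℝ] E × N)
      (π : EU →L[ℝ] EU) (T : Prop) (r g g' : ℝ → ℝ),
      IsDeformationSubmersionChart p e ψ φ L π T r g g' ∧ x ∈ e.source := by
  cases x with
  | off u β hβ =>
    obtain ⟨ψ, φ, L, hL, hu⟩ := exists_isSubmersionChart hp u
    obtain ⟨e, he, h⟩ := exists_off_openPartialHomeomorph j hL.mem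
    have hne : ∀ x ∈ e.source, x.proj.2 ≠ 0 := fun x hx =>
      ((h.source x).1 hx).2.resolve_right id
    refine ⟨e, ψ, φ, L, _, _, fun _ => 1, fun β => β⁻¹, fun β => β,
      ⟨he, h, hL, fun β y => by simp [scale], fun β ξ => by simp [scale],
        fun x hx => (mul_inv_cancel₀ (hne x hx)).symm, fun x hx => (one_mul _).symm,
        fun x hx => contDiffAt_inv ℝ (hne x hx), fun x hx => contDiffAt_id⟩,
      (h.source _).2 ⟨hu, Or.inl hβ⟩⟩
  | normal v n =>
    obtain ⟨c, φ, L, hL, hv, hc⟩ := exists_sliceChart_isSubmersionChart hp hV v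
    obtain ⟨e, he, h⟩ := exists_slice_openPartialHomeomorph c
    refine ⟨e, _, φ, L, _, _, fun β => β, fun _ => 1, fun _ => 1,
      ⟨he, h, hL, fun β y => by simp [scale, hc], fun β ξ => ?_,
        fun x hx => (mul_one _).symm, fun x hx => (mul_one _).symm,
        fun x hx => contDiffAt_const, fun x hx => contDiffAt_const⟩,
      (h.source _).2 ⟨hv, Or.inr trivial⟩⟩
    have : L.symm ((0 : E), (0 : N)) = 0 := map_zero L.symm
    simp [scale, hc, this]

theorem contMDiff_deformationMap (hp : ContMDiff 𝓘(ℝ, EU) 𝓘(ℝ, E) ∞ p) :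
    ContMDiff 𝓘(ℝ, EU × ℝ) (𝓘(ℝ, E).prod 𝓘(ℝ)) ∞ (deformationMap j p) :=
  (hp.comp (contMDiff_fst.comp contMDiff_proj)).prodMk (contMDiff_snd.comp contMDiff_proj)

namespace IsDeformationSubmersionChart

section

variable (h : IsDeformationSubmersionChart p e ψ φ L π T r g g')

include h

theorem chart_fst {x : NormalConeDeformation j} (hx : x ∈ e.source) :
    φ (p x.proj.1) = (L (e x).1).1 := by
  have h1 := h.chart.scale_eq x hx
  rw [h.submersion.eq _ ((h.chart.source x).1 hx).1, ← h1]
  exact h.scale_fst _ _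

/-- In the chart p ∘ q is (E-component, β), so a vector in the kernel of its derivative has only an
N-component. -/
theorem vertical {Y : ∀ x : NormalConeDeformation j, TangentSpace 𝓘(ℝ, EU × ℝ) x}
    (hp : ContMDiff 𝓘(ℝ, EU) 𝓘(ℝ, E) ∞ p) {x : NormalConeDeformation j} (hx : x ∈ e.source)
    (hY : mfderiv 𝓘(ℝ, EU × ℝ) (𝓘(ℝ, E).prod 𝓘(ℝ)) (deformationMap j p) x (Y x) = 0) :
    (mfderiv 𝓘(ℝ, EU × ℝ) 𝓘(ℝ, EU × ℝ) e x (Y x) : EU × ℝ) =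
      (L.symm (0, (L (mfderiv 𝓘(ℝ, EU × ℝ) 𝓘(ℝ, EU × ℝ) e x (Y x) : EU × ℝ).1).2), 0) := by
  have hm := ((contMDiff_deformationMap (j := j) hp x).mdifferentiableAt (by simp)).hasMFDerivAt
  have he := ((mdifferentiable_of_mem_maximalAtlas h.mem).mdifferentiableAt hx).hasMFDerivAt
  have hφ := ((mdifferentiable_of_mem_maximalAtlas h.submersion.mem').mdifferentiableAt
    (h.submersion.mapsTo _ ((h.chart.source x).1 hx).1)).hasMFDerivAt
  have h1 : HasMFDerivAt 𝓘(ℝ, EU × ℝ) 𝓘(ℝ, E) (fun x => φ (p x.proj.1)) x _ :=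
    (hφ.comp (deformationMap j p x) (hasMFDerivAt_fst (I := 𝓘(ℝ, E)) (I' := 𝓘(ℝ)) _)).comp x hm
  have h2 : HasMFDerivAt 𝓘(ℝ, EU × ℝ) 𝓘(ℝ) (fun x : NormalConeDeformation j => x.proj.2) x _ :=
    (hasMFDerivAt_snd (I := 𝓘(ℝ, E)) (I' := 𝓘(ℝ)) (deformationMap j p x)).comp x hm
  have h3 : HasMFDerivAt 𝓘(ℝ, EU × ℝ) 𝓘(ℝ, E) (fun x => (L (e x).1).1) x _ :=
    (((ContinuousLinearMap.fst ℝ E N).comp ((L : EU →L[ℝ] E × N).comp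
      (ContinuousLinearMap.fst ℝ EU ℝ))).hasMFDerivAt (x := e x)).comp x he
  have h4 : HasMFDerivAt 𝓘(ℝ, EU × ℝ) 𝓘(ℝ) (fun x => (e x).2) x _ :=
    ((ContinuousLinearMap.snd ℝ EU ℝ).hasMFDerivAt (x := e x)).comp x he
  have hev := e.open_source.mem_nhds hx
  have h5 := hasMFDerivAt_unique h3 (h1.congr_of_eventuallyEq (Filter.mem_of_superset hev
    fun x hx => (h.chart_fst hx).symm))
  have h6 := hasMFDerivAt_unique h4 (h2.congr_of_eventuallyEq (Filter.mem_of_superset hev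
    fun x hx => h.chart.snd x))
  have h7 : (L (mfderiv 𝓘(ℝ, EU × ℝ) 𝓘(ℝ, EU × ℝ) e x (Y x) : EU × ℝ).1).1 = 0 := by
    refine (congrArg (fun f => f (Y x)) h5).trans ?_
    refine (congrArg (fun w : E × ℝ => (mfderiv 𝓘(ℝ, E) 𝓘(ℝ, E) φ (p x.proj.1) w.1 : E)) hY).trans ?_
    exact map_zero (mfderiv 𝓘(ℝ, E) 𝓘(ℝ, E) φ (p x.proj.1))
  have h8 : (mfderiv 𝓘(ℝ, EU × ℝ) 𝓘(ℝ, EU × ℝ) e x (Y x) : EU × ℝ).2 = 0 :=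
    (congrArg (fun f => f (Y x)) h6).trans (congrArg (fun w : E × ℝ => w.2) hY)
  refine Prod.ext ?_ h8
  rw [L.eq_symm_apply]
  exact Prod.ext h7 rfl

/-- In the chart t ∘ q is (y, β) ↦ (t (ψ⁻¹ (scale π β y)), β). The derivative of the rescaling
multiplies a vertical vector by r β, and this is the source of the factor λ of the adiabatic
foliation. -/
theorem mfderiv_ofCoord (ht : ContMDiff 𝓘(ℝ, EU) 𝓘(ℝ, E) ∞ t) {x : NormalConeDeformation j}
    (hx : x ∈ e.source) {w : NormalConeDeformation j → EU × ℝ} {ξ : N}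
    (hw : w x = (L.symm (0, ξ), 0)) :
    (mfderiv 𝓘(ℝ, EU × ℝ) (𝓘(ℝ, E).prod 𝓘(ℝ)) (deformationMap j t) x (ofCoord e w x) : E × ℝ) =
      (r x.proj.2 • mfderiv 𝓘(ℝ, EU) 𝓘(ℝ, E) t x.proj.1
        (ofCoord ψ (fun _ => L.symm (0, ξ)) x.proj.1), (0 : ℝ)) := by
  have hu := ((h.chart.source x).1 hx).1
  have hm := (contMDiff_deformationMap (j := j) ht x).mdifferentiableAt (by simp)
  have hsc : scale π (e x).2 (e x).1 = ψ x.proj.1 := h.chart.scale_eq x hx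
  have hsnd : (e x).2 = x.proj.2 := h.chart.snd x
  have h1 : (fun z => deformationMap j t (e.symm z)) =ᶠ[𝓝 (e x)]
      fun z => (t (ψ.symm (scale π z.2 z.1)), z.2) := by
    filter_upwards [e.open_target.mem_nhds (e.map_source hx)] with z hz
    have := h.chart.symm_proj hz
    exact Prod.ext (congrArg (fun q : U × ℝ => t q.1) this) (congrArg (fun q : U × ℝ => q.2) this)
  have hS : HasFDerivAt (fun z : EU × ℝ => scale π z.2 z.1)
      (π.comp (ContinuousLinearMap.fst ℝ EU ℝ) +
        ((e x).2 • (ContinuousLinearMap.fst ℝ EU ℝ - π.comp (ContinuousLinearMap.fst ℝ EU ℝ)) +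
          (ContinuousLinearMap.snd ℝ EU ℝ).smulRight ((e x).1 - π (e x).1))) (e x) := by
    have hf : HasFDerivAt (fun z : EU × ℝ => z.1) (ContinuousLinearMap.fst ℝ EU ℝ) (e x) :=
      hasFDerivAt_fst
    have hπ : HasFDerivAt (fun z : EU × ℝ => π z.1) (π.comp (ContinuousLinearMap.fst ℝ EU ℝ))
      (e x) := π.hasFDerivAt.comp _ hf
    exact hπ.add (hasFDerivAt_snd.smul (hf.sub hπ))
  have hψ := ((mdifferentiable_of_mem_maximalAtlas h.submersion.mem).mdifferentiableAt_symm
    (ψ.map_source hu))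
  have htψ : MDifferentiableAt 𝓘(ℝ, EU) 𝓘(ℝ, E) (fun y => t (ψ.symm y))
      (scale π (e x).2 (e x).1) := by
    rw [hsc]
    exact ((ht _).mdifferentiableAt (by simp)).comp (ψ x.proj.1) hψ
  have h2 : HasMFDerivAt 𝓘(ℝ, EU × ℝ) (𝓘(ℝ, E).prod 𝓘(ℝ))
      (fun z : EU × ℝ => (t (ψ.symm (scale π z.2 z.1)), z.2)) (e x) _ :=
    (htψ.hasMFDerivAt.comp (e x) hS.hasMFDerivAt).prodMk
      ((ContinuousLinearMap.snd ℝ EU ℝ).hasMFDerivAt (x := e x))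
  refine (SingularFoliation.mfderiv_ofCoord h.mem hx hm w).trans ?_
  refine (congrArg (fun f : EU × ℝ →L[ℝ] E × ℝ => f (w x)) (h1.mfderiv_eq.trans h2.mfderiv)).trans ?_
  rw [hw]
  refine Prod.ext ?_ rfl
  have h3 := SingularFoliation.mfderiv_ofCoord h.submersion.mem hu
    ((ht x.proj.1).mdifferentiableAt (by simp)) (fun _ => L.symm (0, ξ))
  refine Eq.trans ?_ (congrArg (fun w : E => r x.proj.2 • w) h3).symm
  rw [← hsc]
  refine Eq.trans (b := mfderiv 𝓘(ℝ, EU) 𝓘(ℝ, E) (fun y => t (ψ.symm y))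
    (scale π (e x).2 (e x).1) (r x.proj.2 • L.symm (0, ξ))) ?_ (map_smul _ _ _)
  refine congrArg (mfderiv 𝓘(ℝ, EU) 𝓘(ℝ, E) (fun y => t (ψ.symm y)) (scale π (e x).2 (e x).1)) ?_
  rw [← h.scale_vertical, ← hsnd]
  -- The direction has no ℝ-component, so the term of the product rule that differentiates β
  -- vanishes.
  change π (L.symm (0, ξ)) + ((e x).2 • (L.symm (0, ξ) - π (L.symm (0, ξ))) +
    (0 : ℝ) • ((e x).1 - π (e x).1)) = _
  rw [zero_smul, add_zero]
  rfl

end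

end IsDeformationSubmersionChart

/-- The identification of `EU × ℝ` with `(E × ℝ) × N` defined by `EU ≃ E × N`. -/
def prodRealEquiv (L : EU ≃L[ℝ] E × N) : (EU × ℝ) ≃L[ℝ] (E × ℝ) × N :=
  ContinuousLinearEquiv.equivOfInverse
    ((((ContinuousLinearMap.fst ℝ E N).comp ((L : EU →L[ℝ] E × N).comp
      (ContinuousLinearMap.fst ℝ EU ℝ))).prod (ContinuousLinearMap.snd ℝ EU ℝ)).prod
      ((ContinuousLinearMap.snd ℝ E N).comp ((L : EU →L[ℝ] E × N).comp
      (ContinuousLinearMap.fst ℝ EU ℝ))))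
    (((L.symm : E × N →L[ℝ] EU).comp
      (((ContinuousLinearMap.fst ℝ E ℝ).comp (ContinuousLinearMap.fst ℝ (E × ℝ) N)).prod
        (ContinuousLinearMap.snd ℝ (E × ℝ) N))).prod
      ((ContinuousLinearMap.snd ℝ E ℝ).comp (ContinuousLinearMap.fst ℝ (E × ℝ) N)))
    (fun y => by simp) (fun y => by simp)

theorem isSubmersionOfComplement_deformationMap [IsManifold 𝓘(ℝ, E) ∞ M]
    (hp : IsSubmersionOfComplement N 𝓘(ℝ, EU) 𝓘(ℝ, E) ∞ p)
    (hV : IsLocalDiffeomorph 𝓘(ℝ, E) 𝓘(ℝ, E) ∞ (fun v => p (j.incl v))) :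
    IsSubmersionOfComplement N 𝓘(ℝ, EU × ℝ) (𝓘(ℝ, E).prod 𝓘(ℝ)) ∞ (deformationMap j p) := by
  intro x
  obtain ⟨e, ψ, φ, L, π, T, r, g, g', h, hx⟩ := exists_isDeformationSubmersionChart hp hV x
  have hsm := contMDiff_deformationMap (j := j) hp.contMDiff
  refine IsSubmersionAtOfComplement.mk_of_continuousAt hsm.continuous.continuousAt
    (prodRealEquiv L) e (φ.prod (OpenPartialHomeomorph.refl ℝ)) hx
    ⟨h.submersion.mapsTo _ ((h.chart.source x).1 hx).1, mem_univ _⟩ h.mem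
    (IsManifold.mem_maximalAtlas_prod h.submersion.mem'
      ((contDiffGroupoid ∞ 𝓘(ℝ)).id_mem_maximalAtlas)) fun z hz => ?_
  have hz' : z ∈ e.target := by simpa only [mfld_simps] using hz
  have h1 := h.chart_fst (e.map_target hz')
  have h2 := h.chart.snd (e.symm z)
  rw [e.right_inv hz'] at h1
  have h3 : (e (e.symm z)).2 = (e.symm z).proj.2 := h2
  rw [e.right_inv hz'] at h3
  refine Prod.ext ?_ h3.symm
  exact h1

end DeformationSubmersion

/-! ### The deformation of a bi-submersion -/

section LocalCoefficients

variable {E : Type*} [NormedAddCommGroup E] [NormedSpace ℝ E]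
  {H : Type*} [TopologicalSpace H] {I : ModelWithCorners ℝ E H}
  {M : Type*} [TopologicalSpace M] [ChartedSpace H M]
  {E' : Type*} [NormedAddCommGroup E'] [NormedSpace ℝ E'] [FiniteDimensional ℝ E']
  {H' : Type*} [TopologicalSpace H'] {J : ModelWithCorners ℝ E' H'}
  {U : Type*} [TopologicalSpace U] [ChartedSpace H' U] [IsManifold J ∞ U] [T2Space U]
  [SigmaCompactSpace U]

theorem exists_contMDiff_eventuallyEq {f : U → ℝ} {O : Set U} (hO : IsOpen O)
    (hf : ContMDiffOn J 𝓘(ℝ) ∞ f O) {u : U} (hu : u ∈ O) :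
    ∃ f' : U → ℝ, ContMDiff J 𝓘(ℝ) ∞ f' ∧ HasCompactSupport f' ∧ f' =ᶠ[𝓝 u] f := by
  obtain ⟨χ, h1, h2, h3, h4⟩ := exists_bump_nhds J (hO.mem_nhds hu)
  refine ⟨fun u => χ u * f u, fun u => ?_, h2.mul_right, ?_⟩
  · by_cases hu : u ∈ tsupport χ
    · exact h1.contMDiffAt.mul (hf.contMDiffAt (hO.mem_nhds (h3 hu)))
    · refine (contMDiffAt_const (c := (0 : ℝ))).congr_of_eventuallyEq ?_
      filter_upwards [notMem_tsupport_iff_eventuallyEq.1 hu] with x hx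
      rw [hx, Pi.zero_apply, zero_mul]
  · filter_upwards [h4] with x hx
    rw [hx, one_mul]

variable {F : Set (∀ x : M, TangentSpace I x)} {p : U → M} {ζ : ∀ u, TangentSpace I (p u)}

theorem SpansOn.exists_smul {W : Set U} {u : U} (h : SpansOn I J F p ζ W) (hW : W ∈ 𝓝 u)
    {f : U → ℝ} {O : Set U} (hO : IsOpen O) (hf : ContMDiffOn J 𝓘(ℝ) ∞ f O) (hu : u ∈ O) :
    ∃ W ∈ 𝓝 u, SpansOn I J F p (fun u => f u • ζ u) W := by
  obtain ⟨f', h1, -, h2⟩ := exists_contMDiff_eventuallyEq hO hf hu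
  refine ⟨W ∩ {u | f' u = f u}, Filter.inter_mem hW h2,
    ((h.smul h1).mono inter_subset_left).congr fun u hu => ?_⟩
  rw [show f' u = f u from hu.2]

omit [FiniteDimensional ℝ E'] [IsManifold J ∞ U] [T2Space U] [SigmaCompactSpace U] in
theorem SpansOn.exists_sum {ι : Type*} [Fintype ι] {u : U}
    {ζ : ι → ∀ u, TangentSpace I (p u)} (h : ∀ i, ∃ W ∈ 𝓝 u, SpansOn I J F p (ζ i) W) :
    ∃ W ∈ 𝓝 u, SpansOn I J F p (fun u => ∑ i, ζ i u) W := by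
  choose W hW h using h
  refine ⟨⋂ i, W i, Filter.iInter_mem.2 hW, (SpansOn.sum Finset.univ fun i _ =>
    (h i).mono (iInter_subset _ i)).congr fun u _ => ?_⟩
  rw [Finset.sum_apply]

end LocalCoefficients

/-! ### The two halves of the sweeping condition on D(U, V) -/

section DeformationBisubmersion

open NormalConeDeformation

variable {E : Type*} [NormedAddCommGroup E] [NormedSpace ℝ E] [FiniteDimensional ℝ E]
  {M : Type*} [TopologicalSpace M] [ChartedSpace E M] [IsManifold 𝓘(ℝ, E) ∞ M]
  [T2Space M] [SigmaCompactSpace M]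
  {F : Set (∀ x : M, TangentSpace 𝓘(ℝ, E) x)}
  {EU : Type*} [NormedAddCommGroup EU] [NormedSpace ℝ EU] [FiniteDimensional ℝ EU]
  {U : Type*} [TopologicalSpace U] [ChartedSpace EU U] [IsManifold 𝓘(ℝ, EU) ∞ U]
  [T2Space U] [SecondCountableTopology U]
  {V : Type*} [TopologicalSpace V] [ChartedSpace E V]
  {N : Type*} [NormedAddCommGroup N] [NormedSpace ℝ N]
  {j : EmbeddedSubmanifold E EU V U} {s t : U → M}

/-- If ζ = ∑ fᵢ (Xᵢ ∘ t), then β ζ = ∑ (fᵢ ∘ q) (λ (Xᵢ ⊗ 1)) along t ∘ q. The rest of the proof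
makes the coefficients compactly supported. -/
theorem spansOn_adiabaticFoliation (ht : ContMDiff 𝓘(ℝ, EU) 𝓘(ℝ, E) ∞ t)
    {ζ : ∀ u, TangentSpace 𝓘(ℝ, E) (t u)} {W : Set U} {x : NormalConeDeformation j}
    (h : SpansOn 𝓘(ℝ, E) 𝓘(ℝ, EU) F t ζ W) (hW : W ∈ 𝓝 x.proj.1) :
    ∃ W' ∈ 𝓝 x, SpansOn (𝓘(ℝ, E).prod 𝓘(ℝ)) 𝓘(ℝ, EU × ℝ) (adiabaticFoliation 𝓘(ℝ, E) F)
      (deformationMap j t) (fun x => ((x.proj.2 • ζ x.proj.1 : E), (0 : ℝ))) W' := by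
  have := t2Space_deformation (j := j)
  have := secondCountable_deformation (j := j)
  have := locallyCompactSpace 𝓘(ℝ, EU × ℝ) (U := NormalConeDeformation j)
  have hdt := contMDiff_deformationMap (j := j) ht
  obtain ⟨k, f, X, hf, hζ⟩ := h
  -- The field λ (Xᵢ ⊗ 1) need not have compact support; multiplied by θ it belongs to the adiabatic
  -- foliation, and near the image of x nothing changes.
  obtain ⟨θ, hθ, hθc, -, hθ1⟩ := exists_bump_nhds (𝓘(ℝ, E).prod 𝓘(ℝ))
    (u := deformationMap j t x) (W := univ) Filter.univ_mem
  have hterm : ∀ i, ∃ W' ∈ 𝓝 x, SpansOn (𝓘(ℝ, E).prod 𝓘(ℝ)) 𝓘(ℝ, EU × ℝ)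
      (adiabaticFoliation 𝓘(ℝ, E) F) (deformationMap j t)
      (fun x => f i x.proj.1 • ((x.proj.2 * θ (deformationMap j t x)) •
        extendField (X i) (deformationMap j t x))) W' := fun i => by
    -- The pull-back of fᵢ to D(U, V) need not have compact support, since the fibres of the normal
    -- bundle need not be compact; it is cut off near x.
    obtain ⟨f', h1, h2, h3⟩ := exists_contMDiff_eventuallyEq isOpen_univ
      (((hf i).1.comp (contMDiff_fst.comp contMDiff_proj)).contMDiffOn) (mem_univ x)
    refine ⟨_, h3, (SpansOn.of_mem (smul_extendField_mem (I := 𝓘(ℝ, E)) (hf i).2.2 hθ hθc)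
      h1 h2).congr fun u hu => ?_⟩
    have hu' : f' u = f i u.proj.1 := hu
    rw [hu']
    rfl
  obtain ⟨W', hW', h⟩ := SpansOn.exists_sum hterm
  have e1 : ∀ᶠ x' in 𝓝 x, θ (deformationMap j t x') = 1 := hdt.continuous.continuousAt.eventually hθ1
  have e2 : ∀ᶠ x' : NormalConeDeformation j in 𝓝 x, x'.proj.1 ∈ W :=
    (continuous_fst.comp continuous_proj).continuousAt.eventually hW
  refine ⟨W' ∩ {x' | θ (deformationMap j t x') = 1 ∧ x'.proj.1 ∈ W},
    Filter.inter_mem hW' (e1.and e2), (h.mono inter_subset_left).congr fun x' hx' => ?_⟩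
  have h1 : θ (deformationMap j t x') = 1 := hx'.2.1
  have key : ∀ (w : E) (v : Fin k → E) (c : Fin k → ℝ) (β θ : ℝ), θ = 1 → w = ∑ i, c i • v i →
      ((β • w, (0 : ℝ)) : E × ℝ) = ∑ i, c i • ((β * θ) • ((v i, (0 : ℝ)) : E × ℝ)) := by
    rintro w v c β θ rfl rfl
    refine Prod.ext ?_ ?_
    · rw [Prod.fst_sum]
      dsimp only
      rw [Finset.smul_sum]
      refine Finset.sum_congr rfl fun i _ => ?_
      simp only [Prod.smul_fst, mul_one]
      rw [smul_comm]
    · simp [Prod.snd_sum]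
  exact key _ _ _ _ _ h1 (hζ _ hx'.2.2)

variable {e : OpenPartialHomeomorph (NormalConeDeformation j) (EU × ℝ)}
  {ψ : OpenPartialHomeomorph U EU} {φ : OpenPartialHomeomorph M E} {L : EU ≃L[ℝ] E × N}
  {π : EU →L[ℝ] EU} {T : Prop} {r g g' : ℝ → ℝ} [FiniteDimensional ℝ N]

/-- Let ξₐ be the coordinates of Y in a basis bₐ of N. Its image is r(β) ∑ ξₐ dt(bₐ) = ∑ ξₐ g(β) · β
dt(bₐ), because r(β) = β g(β), and `spansOn_adiabaticFoliation` treats each β dt(bₐ). -/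
theorem IsDeformationSubmersionChart.exists_spansOn
    (h : IsDeformationSubmersionChart s e ψ φ L π T r g g')
    (hs : ContMDiff 𝓘(ℝ, EU) 𝓘(ℝ, E) ∞ s) (ht : ContMDiff 𝓘(ℝ, EU) 𝓘(ℝ, E) ∞ t)
    (hst : SweepsOut 𝓘(ℝ, E) 𝓘(ℝ, EU) F s t)
    {Y : ∀ x : NormalConeDeformation j, TangentSpace 𝓘(ℝ, EU × ℝ) x}
    (hY : Y ∈ verticalFields (𝓘(ℝ, E).prod 𝓘(ℝ)) 𝓘(ℝ, EU × ℝ) (deformationMap j s))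
    {x : NormalConeDeformation j} (hx : x ∈ e.source) :
    ∃ W ∈ 𝓝 x, SpansOn (𝓘(ℝ, E).prod 𝓘(ℝ)) 𝓘(ℝ, EU × ℝ) (adiabaticFoliation 𝓘(ℝ, E) F)
      (deformationMap j t) (fun x => mfderiv 𝓘(ℝ, EU × ℝ) (𝓘(ℝ, E).prod 𝓘(ℝ))
        (deformationMap j t) x (Y x)) W := by
  have := t2Space_deformation (j := j)
  have := secondCountable_deformation (j := j)
  have := locallyCompactSpace 𝓘(ℝ, EU × ℝ) (U := NormalConeDeformation j)
  have := locallyCompactSpace 𝓘(ℝ, EU) (U := U)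
  let b := Module.finBasis ℝ N
  let w : NormalConeDeformation j → EU × ℝ := fun x =>
    mfderiv 𝓘(ℝ, EU × ℝ) 𝓘(ℝ, EU × ℝ) e x (Y x)
  have hw : ContMDiffOn 𝓘(ℝ, EU × ℝ) 𝓘(ℝ, EU × ℝ) ∞ w e.source :=
    contMDiffOn_mfderiv_apply e.open_source (contMDiffOn_of_mem_maximalAtlas h.mem)
      hY.1.1.contMDiffOn
  let ξ : Fin _ → NormalConeDeformation j → ℝ := fun a x => b.repr (L (w x).1).2 a
  have hξ : ∀ a, ContMDiffOn 𝓘(ℝ, EU × ℝ) 𝓘(ℝ) ∞ (ξ a) e.source := fun a => by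
    have h1 : ContDiff ℝ ∞ (b.coord a).toContinuousLinearMap :=
      (b.coord a).toContinuousLinearMap.contDiff
    have h2 : ContDiff ℝ ∞ fun z : EU × ℝ => (b.coord a).toContinuousLinearMap (L z.1).2 :=
      h1.comp (contDiff_snd.comp (L.contDiff.comp contDiff_fst))
    exact h2.contMDiff.comp_contMDiffOn hw
  have hg : ContMDiffOn 𝓘(ℝ, EU × ℝ) 𝓘(ℝ) ∞ (fun x : NormalConeDeformation j => g x.proj.2)
      e.source := fun x hx => by
    exact ((h.contDiffAt x hx).contMDiffAt.comp x
      (contMDiff_snd.comp contMDiff_proj).contMDiffAt).contMDiffWithinAt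
  have hterm : ∀ a, ∃ W ∈ 𝓝 x, SpansOn (𝓘(ℝ, E).prod 𝓘(ℝ)) 𝓘(ℝ, EU × ℝ)
      (adiabaticFoliation 𝓘(ℝ, E) F) (deformationMap j t) (fun x => (ξ a x * g x.proj.2) •
        ((x.proj.2 • mfderiv 𝓘(ℝ, EU) 𝓘(ℝ, E) t x.proj.1
          (ofCoord ψ (fun _ => L.symm (0, b a)) x.proj.1) : E), (0 : ℝ))) W := fun a => by
    obtain ⟨W, hW, h1⟩ := hst.exists_spansOn h.submersion hs
      ((h.chart.source x).1 hx).1 (b a)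
    obtain ⟨W', hW', h2⟩ := spansOn_adiabaticFoliation (j := j) ht h1 hW
    exact h2.exists_smul hW' e.open_source ((hξ a).mul hg) hx
  obtain ⟨W, hW, h1⟩ := SpansOn.exists_sum hterm
  refine ⟨W ∩ e.source, Filter.inter_mem hW (e.open_source.mem_nhds hx),
    (h1.mono inter_subset_left).congr fun x' hx' => ?_⟩
  have h2 := h.vertical hs hx'.2 (hY.2 x')
  have h3 := h.mfderiv_ofCoord ht hx'.2 (w := w) h2
  have h4 : ofCoord e w x' = Y x' := ofCoord_mfderiv h.mem hx'.2 Y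
  rw [h4] at h3
  refine Eq.trans (b := (_ : E × ℝ)) h3 ?_
  let D₁ : EU →L[ℝ] E := mfderiv 𝓘(ℝ, EU) 𝓘(ℝ, E) t x'.proj.1
  let D₂ : EU →L[ℝ] EU := mfderiv 𝓘(ℝ, EU) 𝓘(ℝ, EU) ψ.symm (ψ x'.proj.1)
  let A : N →L[ℝ] E := D₁.comp (D₂.comp ((L.symm : E × N →L[ℝ] EU).comp
    (ContinuousLinearMap.inr ℝ E N)))
  have key : ∀ n : N, ∀ β : ℝ, r β = β * g β → ((r β • A n, (0 : ℝ)) : E × ℝ) =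
      ∑ a, (b.repr n a * g β) • ((β • A (b a), (0 : ℝ)) : E × ℝ) := fun n β hβ => by
    refine Prod.ext ?_ ?_
    · have := congrArg A (b.sum_repr n)
      rw [map_sum] at this
      simp only [map_smul] at this
      rw [Prod.fst_sum, ← this]
      dsimp only
      rw [Finset.smul_sum, hβ]
      refine Finset.sum_congr rfl fun a _ => ?_
      simp only [Prod.smul_fst, smul_smul]
      congr 1
      ring
    · simp [Prod.snd_sum]
  exact key _ _ (h.eq_mul x' hx'.2)

omit [FiniteDimensional ℝ E] [IsManifold 𝓘(ℝ, E) ∞ M] [T2Space M] [SigmaCompactSpace M]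
  [FiniteDimensional ℝ N] in
-- If κ lifts X, the vertical field with N-component f g'(β) κ has image r(β) g'(β) f X = β f X,
-- because β = r(β) g'(β). So the generator λf (X ⊗ 1) lifts even where β = 0.
theorem IsDeformationSubmersionChart.exists_lift
    (h : IsDeformationSubmersionChart s e ψ φ L π T r g g')
    (hs : ContMDiff 𝓘(ℝ, EU) 𝓘(ℝ, E) ∞ s) (ht : ContMDiff 𝓘(ℝ, EU) 𝓘(ℝ, E) ∞ t)
    (hst : SweepsOut 𝓘(ℝ, E) 𝓘(ℝ, EU) F s t)
    {Z : ∀ x : M × ℝ, TangentSpace (𝓘(ℝ, E).prod 𝓘(ℝ)) x} (hZ : Z ∈ adiabaticFoliation 𝓘(ℝ, E) F)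
    {x : NormalConeDeformation j} (hx : x ∈ e.source) :
    ∃ K ∈ verticalFields (𝓘(ℝ, E).prod 𝓘(ℝ)) 𝓘(ℝ, EU × ℝ) (deformationMap j s),
      ∀ᶠ x' in 𝓝 x, mfderiv 𝓘(ℝ, EU × ℝ) (𝓘(ℝ, E).prod 𝓘(ℝ)) (deformationMap j t) x' (K x') =
        Z (deformationMap j t x') := by
  have := t2Space_deformation (j := j)
  have := secondCountable_deformation (j := j)
  have := locallyCompactSpace 𝓘(ℝ, EU × ℝ) (U := NormalConeDeformation j)
  have := locallyCompactSpace 𝓘(ℝ, EU) (U := U)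
  have hdt := contMDiff_deformationMap (j := j) ht
  refine adiabaticFoliation_induction (P := fun Z => ∃ K ∈ verticalFields
    (𝓘(ℝ, E).prod 𝓘(ℝ)) 𝓘(ℝ, EU × ℝ) (deformationMap j s), ∀ᶠ x' in 𝓝 x,
      mfderiv 𝓘(ℝ, EU × ℝ) (𝓘(ℝ, E).prod 𝓘(ℝ)) (deformationMap j t) x' (K x') =
        Z (deformationMap j t x')) ?_ ?_ ?_ hZ
  · exact ⟨0, zero_mem_verticalFields _ _ _, Filter.Eventually.of_forall fun x' => map_zero _⟩
  · rintro Y - Z - ⟨K, hK, h1⟩ ⟨K', hK', h2⟩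
    refine ⟨K + K', add_mem_verticalFields hK hK', ?_⟩
    filter_upwards [h1, h2] with x' h1 h2
    rw [Pi.add_apply, map_add, h1, h2]
    rfl
  intro f hf hfc X hX
  obtain ⟨W, hW, hxW, hWψ, κ, hκ, hκX⟩ := hst.exists_lift h.submersion hs
    ((h.chart.source x).1 hx).1 hX
  have hcp : Continuous fun x : NormalConeDeformation j => x.proj.1 :=
    continuous_fst.comp continuous_proj
  let O : Set (NormalConeDeformation j) := e.source ∩ (fun x => x.proj.1) ⁻¹' W
  have hO : IsOpen O := e.open_source.inter (hW.preimage hcp)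
  let ξ : NormalConeDeformation j → N := fun x =>
    (f (deformationMap j t x) * g' x.proj.2) • κ x.proj.1
  have hξ : ContMDiffOn 𝓘(ℝ, EU × ℝ) 𝓘(ℝ, N) ∞ ξ O := by
    have hg : ContMDiffOn 𝓘(ℝ, EU × ℝ) 𝓘(ℝ) ∞ (fun x : NormalConeDeformation j => g' x.proj.2)
        O := fun x hx => by
      exact ((h.contDiffAt' x hx.1).contMDiffAt.comp x
        (contMDiff_snd.comp contMDiff_proj).contMDiffAt).contMDiffWithinAt
    exact ((hf.comp hdt).contMDiffOn.mul hg).smul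
      (hκ.comp (contMDiff_fst.comp contMDiff_proj).contMDiffOn fun x hx => hx.2)
  let w : NormalConeDeformation j → EU × ℝ := fun x => (L.symm (0, ξ x), 0)
  have hw : ContMDiffOn 𝓘(ℝ, EU × ℝ) 𝓘(ℝ, EU × ℝ) ∞ w O := by
    have h1 : ContDiff ℝ ∞ fun n : N => (L.symm ((0 : E), n), (0 : ℝ)) := by fun_prop
    exact h1.contMDiff.comp_contMDiffOn hξ
  obtain ⟨χ, hχ, hχc, hχO, hχ1⟩ := exists_bump_nhds 𝓘(ℝ, EU × ℝ) (hO.mem_nhds ⟨hx, hxW⟩)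
  refine ⟨fun x => χ x • ofCoord e w x, ⟨isSmoothCompactField_smul hO hχ hχc hχO
    (contMDiffOn_ofCoord h.mem inter_subset_left hw), fun x' => ?_⟩, ?_⟩
  · rw [map_smul]
    by_cases hx' : x' ∈ O
    · have h1 := h.mfderiv_ofCoord hs hx'.1 (w := w) rfl
      have h2 : mfderiv 𝓘(ℝ, EU) 𝓘(ℝ, E) s x'.proj.1
          (ofCoord ψ (fun _ => L.symm (0, ξ x')) x'.proj.1) = 0 := by
        rw [h.submersion.mfderiv_eq_iff hs (hWψ hx'.2),
          mfderiv_ofCoord_self h.submersion.mem (hWψ hx'.2), map_zero]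
        exact congrArg Prod.fst (L.apply_symm_apply _)
      have h3 : mfderiv 𝓘(ℝ, EU × ℝ) (𝓘(ℝ, E).prod 𝓘(ℝ)) (deformationMap j s) x'
          (ofCoord e w x') = 0 := by
        refine Eq.trans (b := (_ : E × ℝ)) h1 ?_
        refine Prod.ext ?_ rfl
        exact (congrArg (fun v : E => r x'.proj.2 • v) h2).trans
          (show r x'.proj.2 • (0 : E) = 0 from smul_zero _)
      rw [h3, smul_zero]
    · rw [image_eq_zero_of_notMem_tsupport fun h => hx' (hχO h), zero_smul]
  · filter_upwards [hχ1, hO.mem_nhds ⟨hx, hxW⟩] with x' h1 hx'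
    rw [h1, one_smul]
    have h2 := h.mfderiv_ofCoord ht hx'.1 (w := w) rfl
    refine Eq.trans (b := (_ : E × ℝ)) h2 ?_
    have h3 := hκX _ hx'.2
    let D₁ : EU →L[ℝ] E := mfderiv 𝓘(ℝ, EU) 𝓘(ℝ, E) t x'.proj.1
    let D₂ : EU →L[ℝ] EU := mfderiv 𝓘(ℝ, EU) 𝓘(ℝ, EU) ψ.symm (ψ x'.proj.1)
    let A : N →L[ℝ] E := D₁.comp (D₂.comp ((L.symm : E × N →L[ℝ] EU).comp
      (ContinuousLinearMap.inr ℝ E N)))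
    have key : ∀ (n : N) (v : E) (c β : ℝ), A n = v → β = r β * g' β →
        ((r β • A ((c * g' β) • n), (0 : ℝ)) : E × ℝ) = (β * c) • ((v, (0 : ℝ)) : E × ℝ) := by
      rintro n v c β rfl hβ
      refine Prod.ext ?_ (by simp)
      simp only [map_smul, smul_smul, Prod.smul_fst]
      congr 1
      conv_rhs => rw [hβ]
      ring
    exact key _ _ _ _ h3 (h.eq_mul' x' hx'.1)

omit [FiniteDimensional ℝ N] in
theorem sweepsOut_deformation (hs : IsSubmersion 𝓘(ℝ, EU) 𝓘(ℝ, E) ∞ s)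
    (hV : IsLocalDiffeomorph 𝓘(ℝ, E) 𝓘(ℝ, E) ∞ (fun v => s (j.incl v)))
    (ht : ContMDiff 𝓘(ℝ, EU) 𝓘(ℝ, E) ∞ t) (hst : SweepsOut 𝓘(ℝ, E) 𝓘(ℝ, EU) F s t) :
    SweepsOut (𝓘(ℝ, E).prod 𝓘(ℝ)) 𝓘(ℝ, EU × ℝ) (adiabaticFoliation 𝓘(ℝ, E) F)
      (deformationMap j s) (deformationMap j t) := by
  obtain ⟨N, _, _, hN⟩ := hs
  constructor
  all_goals
    intro Y hY x
    obtain ⟨e, ψ, φ, L, π, T, r, g, g', h, hx⟩ := exists_isDeformationSubmersionChart hN hV x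
    have : FiniteDimensional ℝ N := Module.Finite.of_surjective
      ((LinearMap.snd ℝ E N) ∘ₗ (L : EU →ₗ[ℝ] E × N)) (Prod.snd_surjective.comp L.surjective)
  · exact h.exists_spansOn hN.contMDiff ht hst hY hx
  · exact h.exists_lift hN.contMDiff ht hst hY hx

end DeformationBisubmersion

/-- The situation is symmetric in s and t: they coincide on V, so t is étale there too, and the
roles can be exchanged. -/
theorem isBisubmersion_deformation
    {E : Type*} [NormedAddCommGroup E] [NormedSpace ℝ E] [FiniteDimensional ℝ E]
    {M : Type*} [TopologicalSpace M] [ChartedSpace E M] [IsManifold 𝓘(ℝ, E) ∞ M]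
    [T2Space M] [SigmaCompactSpace M] {F : Set (∀ x : M, TangentSpace 𝓘(ℝ, E) x)}
    {EU : Type*} [NormedAddCommGroup EU] [NormedSpace ℝ EU] [FiniteDimensional ℝ EU]
    {U : Type*} [TopologicalSpace U] [ChartedSpace EU U] [IsManifold 𝓘(ℝ, EU) ∞ U]
    {V : Type*} [TopologicalSpace V] [ChartedSpace E V]
    {t s : U → M} (hU : IsBisubmersion 𝓘(ℝ, E) 𝓘(ℝ, EU) F t s)
    {j : EmbeddedSubmanifold E EU V U} (hV : IsIdentityBisection t s j) :
    IsBisubmersion (𝓘(ℝ, E).prod 𝓘(ℝ)) 𝓘(ℝ, EU × ℝ) (adiabaticFoliation 𝓘(ℝ, E) F)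
      (deformationMap j t) (deformationMap j s) := by
  have := hU.t2Space
  have := hU.secondCountable
  have := t2Space_deformation (j := j)
  have := secondCountable_deformation (j := j)
  have := locallyCompactSpace 𝓘(ℝ, EU × ℝ) (U := NormalConeDeformation j)
  have hVt : IsLocalDiffeomorph 𝓘(ℝ, E) 𝓘(ℝ, E) ∞ (fun v => t (j.incl v)) := by
    rw [← funext hV.coincide]
    exact hV.etale
  have hsub : ∀ {p : U → M}, IsSubmersion 𝓘(ℝ, EU) 𝓘(ℝ, E) ∞ p →
      IsLocalDiffeomorph 𝓘(ℝ, E) 𝓘(ℝ, E) ∞ (fun v => p (j.incl v)) →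
      IsSubmersion 𝓘(ℝ, EU × ℝ) (𝓘(ℝ, E).prod 𝓘(ℝ)) ∞ (deformationMap j p) := by
    rintro p ⟨N, _, _, hN⟩ hp
    exact ⟨N, _, _, isSubmersionOfComplement_deformationMap hN hp⟩
  exact isBisubmersion_of_sweepsOut (isFoliation_adiabaticFoliation hU.isFoliation)
    (hsub hU.submersion_t hVt) (hsub hU.submersion_s hV.etale)
    (sweepsOut_deformation hU.submersion_s hV.etale hU.submersion_t.contMDiff
      (sweepsOut_of_isBisubmersion hU))
    (sweepsOut_deformation hU.submersion_t hVt hU.submersion_s.contMDiff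
      (sweepsOut_of_isBisubmersion (isBisubmersion_symm hU)))

/-! ### Smooth dependence of the solutions of a differential equation on the initial condition -/

section Flow

open ContinuousMap

/-- Composition with continuous linear maps depending on the point. -/
noncomputable def applyCLM (K : Type*) [TopologicalSpace K] [CompactSpace K]
    (E G : Type*) [NormedAddCommGroup E] [NormedSpace ℝ E]
    [NormedAddCommGroup G] [NormedSpace ℝ G] :
    C(K, E →L[ℝ] G) →L[ℝ] C(K, E) →L[ℝ] C(K, G) :=
  LinearMap.mkContinuous₂
    (LinearMap.mk₂ ℝ (fun (a : C(K, E →L[ℝ] G)) (γ : C(K, E)) =>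
        (⟨fun τ => a τ (γ τ), a.continuous.clm_apply γ.continuous⟩ : C(K, G)))
      (fun a b γ => by ext; simp) (fun c a γ => by ext; simp)
      (fun a γ δ => by ext; simp) (fun c a γ => by ext; simp)) 1 fun a γ => by
    rw [one_mul, ContinuousMap.norm_le _ (by positivity)]
    exact fun τ => (a τ).le_of_opNorm_le_of_le (a.norm_coe_le_norm τ) (γ.norm_coe_le_norm τ)

/-- The range of γ is compact, so the derivative of g varies uniformly little near it. The mean
value inequality then bounds the remainder uniformly in the parameter of the curve. -/
theorem hasFDerivAt_comp_continuousMap {K : Type*} [TopologicalSpace K] [CompactSpace K]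
    {E G : Type*} [NormedAddCommGroup E] [NormedSpace ℝ E]
    [NormedAddCommGroup G] [NormedSpace ℝ G] {g : C(E, G)} {g' : C(E, E →L[ℝ] G)}
    (hg : ∀ x, HasFDerivAt g (g' x) x) (γ : C(K, E)) :
    HasFDerivAt (fun γ : C(K, E) => g.comp γ) (applyCLM K E G (g'.comp γ)) γ := by
  rw [hasFDerivAt_iff_isLittleO_nhds_zero, Asymptotics.isLittleO_iff]
  intro c hc
  have h1 := (isCompact_range γ.continuous).uniformContinuousAt_of_continuousAt g'
    (fun x _ => g'.continuous.continuousAt) (Metric.dist_mem_uniformity hc)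
  obtain ⟨δ, hδ, h2⟩ := Metric.mem_uniformity_dist.1 h1
  filter_upwards [Metric.ball_mem_nhds (0 : C(K, E)) hδ] with η hη
  rw [ContinuousMap.norm_le _ (by positivity)]
  intro τ
  have h3 : ‖η τ‖ ≤ ‖η‖ := η.norm_coe_le_norm τ
  have h4 : ∀ z ∈ Metric.ball (γ τ) δ, ‖g' z - g' (γ τ)‖ ≤ c := fun z hz => by
    rw [Metric.mem_ball, dist_comm] at hz
    have := h2 hz (mem_range_self τ)
    rw [← dist_eq_norm, dist_comm]
    exact le_of_lt this
  have h5 : γ τ + η τ ∈ Metric.ball (γ τ) δ := by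
    rw [mem_ball_zero_iff] at hη
    simpa using h3.trans_lt hη
  have h6 := (convex_ball (γ τ) δ).norm_image_sub_le_of_norm_hasFDerivWithin_le'
    (fun z hz => (hg z).hasFDerivWithinAt) h4 (Metric.mem_ball_self hδ) h5
  rw [add_sub_cancel_left] at h6
  exact h6.trans (mul_le_mul_of_nonneg_left h3 hc.le)

/-- The derivative of γ ↦ g ∘ γ is γ ↦ g' ∘ γ followed by the bounded linear map `applyCLM`, which
allows induction on n. The target G varies because g' takes its values in another space. -/
theorem contDiff_comp_continuousMap (K : Type*) [TopologicalSpace K] [CompactSpace K]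
    {E : Type u} [NormedAddCommGroup E] [NormedSpace ℝ E] (n : ℕ) :
    ∀ {G : Type u} [NormedAddCommGroup G] [NormedSpace ℝ G] (g : C(E, G)), ContDiff ℝ ∞ g →
      ContDiff ℝ n (fun γ : C(K, E) => g.comp γ) := by
  induction n with
  | zero =>
    intro G _ _ g _
    rw [Nat.cast_zero, contDiff_zero]
    exact g.continuous_postcomp
  | succ n ih =>
    intro G _ _ g hg
    have hg' : ContDiff ℝ ∞ (fderiv ℝ g) := hg.fderiv_right (by norm_cast)
    rw [Nat.cast_add, Nat.cast_one, contDiff_succ_iff_hasFDerivAt]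
    exact ⟨_, (applyCLM K E G).contDiff.comp (ih ⟨fderiv ℝ g, hg'.continuous⟩ hg'),
      fun γ => hasFDerivAt_comp_continuousMap
        (fun x => (hg.differentiable (by simp) x).hasFDerivAt) γ⟩

variable {E : Type u} [NormedAddCommGroup E] [NormedSpace ℝ E]

/-- The primitive of a continuous curve on `[0, 1]`. -/
noncomputable def primitive (γ : C(unitInterval, E)) (τ : ℝ) : E :=
  ∫ σ in (0 : ℝ)..τ, γ (projIcc 0 1 zero_le_one σ)

omit [NormedSpace ℝ E] in
theorem continuous_comp_projIcc (γ : C(unitInterval, E)) :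
    Continuous fun σ : ℝ => γ (projIcc 0 1 zero_le_one σ) :=
  γ.continuous.comp continuous_projIcc

/-- The curve is extended by constants outside [0, 1], so the derivative is two-sided even at the
end points. -/
theorem hasDerivAt_primitive [CompleteSpace E] (γ : C(unitInterval, E)) (τ : ℝ) :
    HasDerivAt (primitive γ) (γ (projIcc 0 1 zero_le_one τ)) τ :=
  intervalIntegral.integral_hasDerivAt_right
    ((continuous_comp_projIcc γ).intervalIntegrable _ _)
    ((continuous_comp_projIcc γ).stronglyMeasurableAtFilter _ _)
    (continuous_comp_projIcc γ).continuousAt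

theorem norm_primitive_le (γ : C(unitInterval, E)) (τ : unitInterval) : ‖primitive γ τ‖ ≤ ‖γ‖ := by
  refine (intervalIntegral.norm_integral_le_of_norm_le_const (C := ‖γ‖)
    fun σ _ => γ.norm_coe_le_norm _).trans ?_
  rw [sub_zero, abs_of_nonneg τ.2.1]
  exact mul_le_of_le_one_right (norm_nonneg _) τ.2.2

/-- The primitive as an operator on curves. -/
noncomputable def primitiveCLM (E : Type*) [NormedAddCommGroup E] [NormedSpace ℝ E]
    [CompleteSpace E] : C(unitInterval, E) →L[ℝ] C(unitInterval, E) :=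
  LinearMap.mkContinuous
    { toFun := fun γ => ⟨fun τ => primitive γ τ,
        (continuous_iff_continuousAt.2 fun τ => (hasDerivAt_primitive γ τ).continuousAt).comp
          continuous_subtype_val⟩
      map_add' := fun γ δ => by
        ext τ
        exact intervalIntegral.integral_add ((continuous_comp_projIcc γ).intervalIntegrable _ _)
          ((continuous_comp_projIcc δ).intervalIntegrable _ _)
      map_smul' := fun c γ => by
        ext τ
        exact intervalIntegral.integral_smul c (fun σ : ℝ => γ (projIcc 0 1 zero_le_one σ)) } 1 fun γ => by
    rw [one_mul, ContinuousMap.norm_le _ (by positivity)]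
    exact norm_primitive_le γ

theorem norm_primitiveCLM_apply_le [CompleteSpace E] (γ : C(unitInterval, E)) :
    ‖primitiveCLM E γ‖ ≤ ‖γ‖ := by
  rw [ContinuousMap.norm_le _ (by positivity)]
  exact norm_primitive_le γ

/-- The map `x ↦ γ_x`, where `γ_x` is the curve on `[0, 1]` with `γ_x = x + ε ∫ g ∘ γ_x`, is smooth
when `ε` is small. -/
theorem exists_contDiff_integralCurve [CompleteSpace E] {g : C(E, E)} (hg : ContDiff ℝ ∞ g)
    {C ε : NNReal} (hC : LipschitzWith C g) (hε : ε * C < 1) :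
    ∃ Γ : E → C(unitInterval, E), ContDiff ℝ ∞ Γ ∧
      ∀ x τ, Γ x τ = x + (ε : ℝ) • primitive (g.comp (Γ x)) τ := by
  -- The integral equation for the curve issued from x is A γ = const x, so Γ is the inverse of A
  -- restricted to the constants.
  let A : C(unitInterval, E) → C(unitInterval, E) := fun γ =>
    γ - (ε : ℝ) • primitiveCLM E (g.comp γ)
  have hA : ContDiff ℝ ∞ A := contDiff_infty.2 fun n => contDiff_id.sub
    (((primitiveCLM E).contDiff.comp (contDiff_comp_continuousMap unitInterval n g hg)).const_smul _)
  have hlip : ∀ γ δ : C(unitInterval, E), ‖g.comp γ - g.comp δ‖ ≤ C * ‖γ - δ‖ := fun γ δ => by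
    rw [ContinuousMap.norm_le _ (by positivity)]
    exact fun τ => (hC.norm_sub_le _ _).trans
      (mul_le_mul_of_nonneg_left ((γ - δ).norm_coe_le_norm τ) C.coe_nonneg)
  -- A differs from the identity by a map with Lipschitz constant εC < 1, hence is a homeomorphism
  -- of the space of curves.
  have happ : ApproximatesLinearOn A ((ContinuousLinearEquiv.refl ℝ C(unitInterval, E) :
      C(unitInterval, E) ≃L[ℝ] C(unitInterval, E)) : C(unitInterval, E) →L[ℝ] C(unitInterval, E))
      univ (ε * C) := by
    intro γ _ δ _
    have h1 : A γ - A δ - (γ - δ) = -((ε : ℝ) • primitiveCLM E (g.comp γ - g.comp δ)) := by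
      simp only [A, map_sub, smul_sub]
      abel
    change ‖A γ - A δ - (γ - δ)‖ ≤ _
    rw [h1, norm_neg, norm_smul, Real.norm_of_nonneg ε.coe_nonneg, NNReal.coe_mul, mul_assoc]
    exact mul_le_mul_of_nonneg_left ((norm_primitiveCLM_apply_le _).trans (hlip γ δ)) ε.coe_nonneg
  let Λ := happ.toHomeomorph A (by
    -- The identity has norm 1 only on a nontrivial space.
    rcases subsingleton_or_nontrivial C(unitInterval, E) with hsub | hnt
    · exact Or.inl hsub
    · right
      have : ‖((ContinuousLinearEquiv.refl ℝ C(unitInterval, E)).symm :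
          C(unitInterval, E) →L[ℝ] C(unitInterval, E))‖₊ = 1 := by
        rw [ContinuousLinearEquiv.refl_symm, ContinuousLinearEquiv.coe_refl]
        exact NNReal.eq ContinuousLinearMap.norm_id
      rw [this, inv_one]
      exact hε)
  let g' : C(E, E →L[ℝ] E) := ⟨fderiv ℝ g, hg.continuous_fderiv (by simp)⟩
  have hd : ∀ γ, ∃ D : C(unitInterval, E) ≃L[ℝ] C(unitInterval, E),
      HasFDerivAt Λ (D : C(unitInterval, E) →L[ℝ] C(unitInterval, E)) γ := fun γ => by
    -- The derivative of A is 1 - D with ‖D‖ ≤ εC < 1, hence invertible by a Neumann series; so the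
    -- inverse of A is smooth.
    let D : C(unitInterval, E) →L[ℝ] C(unitInterval, E) :=
      (ε : ℝ) • (primitiveCLM E).comp (applyCLM unitInterval E E (g'.comp γ))
    have hD : ‖D‖ < 1 := by
      refine (D.opNorm_le_bound (by positivity) fun η => ?_).trans_lt
        (show (ε * C : ℝ) < 1 by exact_mod_cast hε)
      change ‖(ε : ℝ) • primitiveCLM E (applyCLM unitInterval E E (g'.comp γ) η)‖ ≤ _
      rw [norm_smul, Real.norm_of_nonneg ε.coe_nonneg, mul_assoc]
      refine mul_le_mul_of_nonneg_left ((norm_primitiveCLM_apply_le _).trans ?_) ε.coe_nonneg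
      rw [ContinuousMap.norm_le _ (by positivity)]
      exact fun τ => (g' (γ τ)).le_of_opNorm_le_of_le (norm_fderiv_le_of_lipschitz ℝ hC)
        (η.norm_coe_le_norm τ)
    refine ⟨ContinuousLinearEquiv.ofUnit (Units.oneSub D hD), ?_⟩
    exact (hasFDerivAt_id γ).sub (((primitiveCLM E).hasFDerivAt.comp γ
      (hasFDerivAt_comp_continuousMap (g' := g')
        (fun x => (hg.differentiable (by simp) x).hasFDerivAt) γ)).const_smul (ε : ℝ))
  choose D hD using hd
  have hΛ : ContDiff ℝ ∞ Λ.symm := Λ.contDiff_symm hD hA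
  refine ⟨fun x => Λ.symm (ContinuousMap.const unitInterval x), hΛ.comp ?_, fun x τ => ?_⟩
  · let c : E →L[ℝ] C(unitInterval, E) := LinearMap.mkContinuous
      { toFun := fun x => ContinuousMap.const unitInterval x
        map_add' := fun x y => rfl
        map_smul' := fun r x => rfl } 1 fun x => by
      rw [one_mul, ContinuousMap.norm_le _ (by positivity)]
      exact fun τ => le_rfl
    exact c.contDiff
  · have h1 : A (Λ.symm (ContinuousMap.const unitInterval x)) = _ := Λ.apply_symm_apply _
    have h2 : A (Λ.symm (ContinuousMap.const unitInterval x)) τ = x :=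
      congrArg (fun γ : C(unitInterval, E) => γ τ) h1
    exact sub_eq_iff_eq_add.1 h2

/-- The local flow of a smooth vector field, in small time, with its smoothness in the initial
condition. -/
theorem exists_smooth_flow [FiniteDimensional ℝ E] {O : Set E} (hO : IsOpen O) {x₀ : E}
    (hx₀ : x₀ ∈ O) {g : E → E} (hg : ContDiffOn ℝ ∞ g O) :
    ∃ ε : ℝ, 0 < ε ∧ ∃ W : Set E, IsOpen W ∧ x₀ ∈ W ∧ ∃ Φ : E → ℝ → E, (∀ x, Φ x 0 = x) ∧
      (∀ x ∈ W, ∀ τ ∈ Icc (0 : ℝ) 1, Φ x τ ∈ O ∧ HasDerivAt (Φ x) (ε • g (Φ x τ)) τ) ∧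
      ContDiff ℝ ∞ fun x => Φ x 1 := by
  have : CompleteSpace E := FiniteDimensional.complete ℝ E
  obtain ⟨r, hr, hrO⟩ := Metric.isOpen_iff.1 hO _ hx₀
  -- The cut-off makes the field bounded and globally Lipschitz; it equals g on the closed ball of
  -- radius r / 2.
  let χ : ContDiffBump x₀ := ⟨r / 2, 3 * r / 4, by positivity, by linarith⟩
  have hχO : tsupport χ ⊆ O := by
    rw [χ.tsupport_eq]
    exact (Metric.closedBall_subset_ball (by simp only [χ]; linarith)).trans hrO
  have hk : ContDiff ℝ ∞ fun y => χ y • g y := by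
    refine contDiff_iff_contDiffAt.2 fun x => ?_
    by_cases hx : x ∈ tsupport (χ : E → ℝ)
    · exact χ.contDiffAt.smul (hg.contDiffAt (hO.mem_nhds (hχO hx)))
    · refine (contDiffAt_const (c := (0 : E))).congr_of_eventuallyEq ?_
      filter_upwards [notMem_tsupport_iff_eventuallyEq.1 hx] with y hy
      rw [hy, Pi.zero_apply, zero_smul]
  have hkc : HasCompactSupport fun y => χ y • g y := χ.hasCompactSupport.smul_right
  obtain ⟨C, hC⟩ := hk.lipschitzWith_of_hasCompactSupport hkc (by simp)
  obtain ⟨B, hB⟩ := hkc.exists_bound_of_continuous hk.continuous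
  have hB0 : 0 ≤ B := (norm_nonneg _).trans (hB x₀)
  let k : C(E, E) := ⟨fun y => χ y • g y, hk.continuous⟩
  -- With ε = d⁻¹ one has εC < 1, for the integral equation, and εB ≤ r / 4: a curve issued from the
  -- ball of radius r / 4 stays where χ = 1.
  let d : ℝ := C + 4 * B / r + 1
  have hd : 0 < d := by positivity
  let ε : NNReal := ⟨d⁻¹, by positivity⟩
  have hεd : (ε : ℝ) = d⁻¹ := rfl
  have hεC : ε * C < 1 := by
    have h1 : (ε * C : ℝ) < 1 := by
      rw [hεd, inv_mul_lt_one₀ hd]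
      have : 0 ≤ 4 * B / r := by positivity
      simp only [d]
      linarith
    exact_mod_cast h1
  have hεB : ε * B ≤ r / 4 := by
    rw [hεd, inv_mul_le_iff₀ hd]
    have : 0 ≤ (C : ℝ) * r := by positivity
    have h2 : d * (r / 4) = (C * r + r) / 4 + B := by
      simp only [d]
      field_simp
      ring
    rw [h2]
    linarith
  obtain ⟨Γ, hΓ, hΓ'⟩ := exists_contDiff_integralCurve (g := k) hk hC hεC
  refine ⟨ε, inv_pos.2 hd, Metric.ball x₀ (r / 4), Metric.isOpen_ball,
    Metric.mem_ball_self (by positivity), fun x τ => x + (ε : ℝ) • primitive (k.comp (Γ x)) τ,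
    fun x => ?_, fun x hx τ hτ => ?_, ?_⟩
  · simp [primitive]
  · have h1 : ‖primitive (k.comp (Γ x)) τ‖ ≤ B :=
      (norm_primitive_le _ ⟨τ, hτ⟩).trans ((ContinuousMap.norm_le _ hB0).2 fun σ => hB _)
    have h2 : x + (ε : ℝ) • primitive (k.comp (Γ x)) τ ∈ Metric.closedBall x₀ (r / 2) := by
      rw [Metric.mem_ball, dist_eq_norm] at hx
      rw [Metric.mem_closedBall, dist_eq_norm, add_sub_right_comm]
      refine (norm_add_le _ _).trans ?_
      rw [norm_smul, Real.norm_of_nonneg ε.coe_nonneg]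
      have := mul_le_mul_of_nonneg_left h1 ε.coe_nonneg
      linarith
    have h3 := (hasDerivAt_primitive (k.comp (Γ x)) τ).const_smul (ε : ℝ)
    have h4 : k.comp (Γ x) (projIcc 0 1 zero_le_one τ) =
        g (x + (ε : ℝ) • primitive (k.comp (Γ x)) τ) := by
      have h5 : Γ x (projIcc 0 1 zero_le_one τ) = x + (ε : ℝ) • primitive (k.comp (Γ x)) τ := by
        rw [projIcc_of_mem zero_le_one hτ]
        exact hΓ' x ⟨τ, hτ⟩
      change χ _ • g _ = _
      rw [h5, χ.one_of_mem_closedBall h2, one_smul]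
    rw [h4] at h3
    refine ⟨hrO (Metric.closedBall_subset_ball (by linarith) h2), h3.const_add x⟩
  -- By the integral equation the time-one map is Γ followed by evaluation at 1, which is continuous
  -- and linear.
  · have h1 : (fun x => x + (ε : ℝ) • primitive (k.comp (Γ x)) 1) =
        fun x => ContinuousMap.evalCLM ℝ (1 : unitInterval) (Γ x) :=
      funext fun x => (hΓ' x 1).symm
    rw [h1]
    exact (ContinuousMap.evalCLM ℝ (1 : unitInterval)).contDiff.comp hΓ

end Flow

/-! ### The bi-submersions in coordinates -/

section Coordinates

variable {E : Type*} [NormedAddCommGroup E] [NormedSpace ℝ E]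
  {M : Type*} [TopologicalSpace M] [ChartedSpace E M] [IsManifold 𝓘(ℝ, E) ∞ M]
  {EU : Type*} [NormedAddCommGroup EU] [NormedSpace ℝ EU]
  {U : Type*} [TopologicalSpace U] [ChartedSpace EU U] [IsManifold 𝓘(ℝ, EU) ∞ U]
  {N : Type*} [NormedAddCommGroup N] [NormedSpace ℝ N]
  {F : Set (∀ x : M, TangentSpace 𝓘(ℝ, E) x)} {s t : U → M}
  {ψ : OpenPartialHomeomorph U EU} {φ φ₁ : OpenPartialHomeomorph M E}
  {L : EU ≃L[ℝ] E × N}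

/-- The coordinate expression of a vector field in a chart. -/
noncomputable def chartRep (φ : OpenPartialHomeomorph M E) (X : ∀ x : M, TangentSpace 𝓘(ℝ, E) x)
    (y : E) : E :=
  mfderiv 𝓘(ℝ, E) 𝓘(ℝ, E) φ (φ.symm y) (X (φ.symm y))

theorem contDiffOn_chartRep (hφ : φ ∈ IsManifold.maximalAtlas 𝓘(ℝ, E) ∞ M)
    {X : ∀ x : M, TangentSpace 𝓘(ℝ, E) x} (hX : IsSmoothCompactField 𝓘(ℝ, E) X) :
    ContDiffOn ℝ ∞ (chartRep φ X) φ.target := by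
  rw [← contMDiffOn_iff_contDiffOn]
  exact (contMDiffOn_mfderiv_apply φ.open_source (contMDiffOn_of_mem_maximalAtlas hφ)
    hX.1.contMDiffOn).comp (contMDiffOn_symm_of_mem_maximalAtlas hφ) φ.mapsTo_symm

omit [IsManifold 𝓘(ℝ, E) ∞ M] [IsManifold 𝓘(ℝ, EU) ∞ U] in
theorem contDiffOn_comp_symm (hφ : φ ∈ IsManifold.maximalAtlas 𝓘(ℝ, E) ∞ M)
    (hψ : ψ ∈ IsManifold.maximalAtlas 𝓘(ℝ, EU) ∞ U) (ht : ContMDiff 𝓘(ℝ, EU) 𝓘(ℝ, E) ∞ t) :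
    ContDiffOn ℝ ∞ (fun y => φ (t (ψ.symm y))) {y | y ∈ ψ.target ∧ t (ψ.symm y) ∈ φ.source} := by
  rw [← contMDiffOn_iff_contDiffOn]
  exact (contMDiffOn_of_mem_maximalAtlas hφ).comp (ht.comp_contMDiffOn
    ((contMDiffOn_symm_of_mem_maximalAtlas hψ).mono fun y hy => hy.1)) fun y hy => hy.2

omit [IsManifold 𝓘(ℝ, E) ∞ M] [IsManifold 𝓘(ℝ, EU) ∞ U] in
theorem fderiv_comp_symm (hφ : φ ∈ IsManifold.maximalAtlas 𝓘(ℝ, E) ∞ M)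
    (hψ : ψ ∈ IsManifold.maximalAtlas 𝓘(ℝ, EU) ∞ U) (ht : ContMDiff 𝓘(ℝ, EU) 𝓘(ℝ, E) ∞ t) {y : EU}
    (hy : y ∈ ψ.target) (hty : t (ψ.symm y) ∈ φ.source) (w : EU) :
    fderiv ℝ (fun y => φ (t (ψ.symm y))) y w =
      mfderiv 𝓘(ℝ, E) 𝓘(ℝ, E) φ (t (ψ.symm y))
        (mfderiv 𝓘(ℝ, EU) 𝓘(ℝ, E) t (ψ.symm y) (ofCoord ψ (fun _ => w) (ψ.symm y))) := by
  have h1 := ((mdifferentiable_of_mem_maximalAtlas hφ).mdifferentiableAt hty).hasMFDerivAt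
  have h2 := ((ht (ψ.symm y)).mdifferentiableAt (by simp)).hasMFDerivAt
  have h3 := ((mdifferentiable_of_mem_maximalAtlas hψ).mdifferentiableAt_symm hy).hasMFDerivAt
  have h4 : HasMFDerivAt 𝓘(ℝ, EU) 𝓘(ℝ, E) (fun y => φ (t (ψ.symm y))) y _ := h1.comp y (h2.comp y h3)
  have h5 : ofCoord ψ (fun _ => w) (ψ.symm y) = mfderiv 𝓘(ℝ, EU) 𝓘(ℝ, EU) ψ.symm y w :=
    congrArg (fun z => (mfderiv 𝓘(ℝ, EU) 𝓘(ℝ, EU) ψ.symm z : EU →L[ℝ] EU) w) (ψ.right_inv hy)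
  let Dφ : E →L[ℝ] E := mfderiv 𝓘(ℝ, E) 𝓘(ℝ, E) φ (t (ψ.symm y))
  let Dt : EU →L[ℝ] E := mfderiv 𝓘(ℝ, EU) 𝓘(ℝ, E) t (ψ.symm y)
  let Dψ : EU →L[ℝ] EU := mfderiv 𝓘(ℝ, EU) 𝓘(ℝ, EU) ψ.symm y
  have h6 : HasFDerivAt (fun y => φ (t (ψ.symm y))) (Dφ.comp (Dt.comp Dψ)) y := h4.hasFDerivAt
  refine (DFunLike.congr_fun h6.fderiv w).trans ?_
  exact (congrArg (fun z : EU => (mfderiv 𝓘(ℝ, E) 𝓘(ℝ, E) φ (t (ψ.symm y))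
    (mfderiv 𝓘(ℝ, EU) 𝓘(ℝ, E) t (ψ.symm y) z) : E)) h5).symm

omit [IsManifold 𝓘(ℝ, E) ∞ M] [IsManifold 𝓘(ℝ, EU) ∞ U] in
/-- A field that is the image by `dt` of a field with coordinates `w`, in charts. -/
theorem fderiv_eq_chartRep (hφ : φ ∈ IsManifold.maximalAtlas 𝓘(ℝ, E) ∞ M)
    (hψ : ψ ∈ IsManifold.maximalAtlas 𝓘(ℝ, EU) ∞ U) (ht : ContMDiff 𝓘(ℝ, EU) 𝓘(ℝ, E) ∞ t) {y : EU}
    (hy : y ∈ ψ.target) (hty : t (ψ.symm y) ∈ φ.source) {w : EU} {ι : Type*} [Fintype ι]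
    {c : ι → ℝ} {X : ι → ∀ x : M, TangentSpace 𝓘(ℝ, E) x}
    (h : mfderiv 𝓘(ℝ, EU) 𝓘(ℝ, E) t (ψ.symm y) (ofCoord ψ (fun _ => w) (ψ.symm y)) =
      ∑ i, c i • X i (t (ψ.symm y))) :
    fderiv ℝ (fun y => φ (t (ψ.symm y))) y w =
      ∑ i, c i • chartRep φ (X i) (φ (t (ψ.symm y))) := by
  rw [fderiv_comp_symm hφ hψ ht hy hty]
  refine (congrArg (fun z => (mfderiv 𝓘(ℝ, E) 𝓘(ℝ, E) φ (t (ψ.symm y)) z : E)) h).trans ?_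
  refine (map_sum (mfderiv 𝓘(ℝ, E) 𝓘(ℝ, E) φ (t (ψ.symm y))) _ _).trans ?_
  refine Finset.sum_congr rfl fun i _ => ?_
  refine (map_smul (mfderiv 𝓘(ℝ, E) 𝓘(ℝ, E) φ (t (ψ.symm y))) _ _).trans ?_
  exact congrArg (fun m => c i • (mfderiv 𝓘(ℝ, E) 𝓘(ℝ, E) φ m (X i m) : E)) (φ.left_inv hty).symm

variable [FiniteDimensional ℝ EU] [T2Space U] [SigmaCompactSpace U]
  (hφ : φ ∈ IsManifold.maximalAtlas 𝓘(ℝ, E) ∞ M) (hL : IsSubmersionChart s ψ φ₁ L)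
  (hs : ContMDiff 𝓘(ℝ, EU) 𝓘(ℝ, E) ∞ s) (ht : ContMDiff 𝓘(ℝ, EU) 𝓘(ℝ, E) ∞ t)
  (h : SweepsOut 𝓘(ℝ, E) 𝓘(ℝ, EU) F s t)

include hφ hL hs ht h

omit [IsManifold 𝓘(ℝ, E) ∞ M] in
/-- The images by `dt` of the vertical constant fields, in charts, as combinations of fields
of `F`. -/
theorem SweepsOut.exists_coefficients [FiniteDimensional ℝ N] {u : U} (hu : u ∈ ψ.source)
    (htu : t u ∈ φ.source) :
    ∃ (ι : Type) (_ : Fintype ι) (c : ι → EU → (N →L[ℝ] ℝ))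
      (X : ι → ∀ x : M, TangentSpace 𝓘(ℝ, E) x) (O : Set EU) (C : ℝ), (∀ i, X i ∈ F) ∧
      IsOpen O ∧ ψ u ∈ O ∧ O ⊆ ψ.target ∧ (∀ y ∈ O, t (ψ.symm y) ∈ φ.source) ∧
      (∀ i, ContDiffOn ℝ ∞ (c i) O) ∧ (∀ i y, ‖c i y‖ ≤ C) ∧
      ∀ y ∈ O, ∀ ξ, fderiv ℝ (fun y => φ (t (ψ.symm y))) y (L.symm (0, ξ)) =
        ∑ i, c i y ξ • chartRep φ (X i) (φ (t (ψ.symm y))) := by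
  let b := Module.finBasis ℝ N
  choose W hW hspan using fun a => h.exists_spansOn hL hs hu (b a)
  choose k f X hf hX using hspan
  have hcont : ContinuousAt (fun y => t (ψ.symm y)) (ψ u) :=
    ht.continuous.continuousAt.comp (ψ.continuousAt_symm (ψ.map_source hu))
  have e1 : ∀ᶠ y in 𝓝 (ψ u), ∀ a, ψ.symm y ∈ W a := Filter.eventually_all.2 fun a =>
    (ψ.continuousAt_symm (ψ.map_source hu)).eventually (by simpa [ψ.left_inv hu] using hW a)
  have e2 : ∀ᶠ y in 𝓝 (ψ u), t (ψ.symm y) ∈ φ.source :=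
    hcont.eventually (φ.open_source.mem_nhds (by simpa [ψ.left_inv hu] using htu))
  have e0 : ∀ᶠ y in 𝓝 (ψ u), y ∈ ψ.target := ψ.open_target.mem_nhds (ψ.map_source hu)
  obtain ⟨O, hO, hOo, huO⟩ := eventually_nhds_iff.1 (e0.and (e1.and e2))
  -- The coefficients have compact support, hence global bounds, which later give one Lipschitz
  -- constant for a time-dependent equation.
  have hbound : ∀ q : Σ a, Fin (k a), ∃ B, ∀ u, ‖f q.1 q.2 u‖ ≤ B := fun q =>
    (hf q.1 q.2).2.1.exists_bound_of_continuous (hf q.1 q.2).1.continuous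
  choose B hB using hbound
  let θ : Fin _ → N →L[ℝ] ℝ := fun a => (b.coord a).toContinuousLinearMap
  refine ⟨Σ a, Fin (k a), inferInstance, fun q y => f q.1 q.2 (ψ.symm y) • θ q.1,
    fun q => X q.1 q.2, O, ∑ q : Σ a, Fin (k a), |B q| * ‖θ q.1‖, fun q => (hf q.1 q.2).2.2, hOo, huO,
    fun y hy => (hO y hy).1, fun y hy => (hO y hy).2.2, fun q => ?_, fun q y => ?_,
    fun y hy ξ => ?_⟩
  · have h1 : ContDiffOn ℝ ∞ (fun y => f q.1 q.2 (ψ.symm y)) O := by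
      rw [← contMDiffOn_iff_contDiffOn]
      exact (hf q.1 q.2).1.comp_contMDiffOn
        ((contMDiffOn_symm_of_mem_maximalAtlas hL.mem).mono fun y hy => (hO y hy).1)
    exact h1.smul contDiffOn_const
  · rw [norm_smul]
    refine (mul_le_mul_of_nonneg_right ((hB q _).trans (le_abs_self _)) (norm_nonneg _)).trans ?_
    exact Finset.single_le_sum (f := fun q : Σ a, Fin (k a) => |B q| * ‖θ q.1‖)
      (fun q _ => by positivity) (Finset.mem_univ q)
  · let Λ : N →ₗ[ℝ] EU := (L.symm : E × N →ₗ[ℝ] EU) ∘ₗ LinearMap.inr ℝ E N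
    have h1 : L.symm (0, ξ) = ∑ a, b.repr ξ a • L.symm ((0 : E), b a) := by
      change Λ ξ = ∑ a, b.repr ξ a • Λ (b a)
      conv_lhs => rw [← b.sum_repr ξ]
      simp only [map_sum, map_smul]
    rw [h1, map_sum, Fintype.sum_sigma]
    refine Finset.sum_congr rfl fun a _ => ?_
    have h2 := fderiv_eq_chartRep hφ hL.mem ht (hO y hy).1 (hO y hy).2.2
      (hX a (ψ.symm y) ((hO y hy).2.1 a))
    rw [map_smul, h2, Finset.smul_sum]
    refine Finset.sum_congr rfl fun i _ => ?_
    rw [smul_smul]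
    congr 1
    exact mul_comm _ _

omit [IsManifold 𝓘(ℝ, E) ∞ M] [FiniteDimensional ℝ EU] [T2Space U] [SigmaCompactSpace U] in
/-- The lifts of the fields of `F` to the fibres of `s`, in charts. -/
theorem SweepsOut.exists_chart_lift {u : U} (hu : u ∈ ψ.source) (htu : t u ∈ φ.source)
    {X : ∀ x : M, TangentSpace 𝓘(ℝ, E) x} (hX : X ∈ F) :
    ∃ (O : Set EU) (κ : EU → N), IsOpen O ∧ ψ u ∈ O ∧ O ⊆ ψ.target ∧
      (∀ y ∈ O, t (ψ.symm y) ∈ φ.source) ∧ ContDiffOn ℝ ∞ κ O ∧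
      ∀ y ∈ O, fderiv ℝ (fun y => φ (t (ψ.symm y))) y (L.symm (0, κ y)) =
        chartRep φ X (φ (t (ψ.symm y))) := by
  obtain ⟨W, hW, huW, hWψ, κ, hκ, hκX⟩ := h.exists_lift hL hs hu hX
  have hcont : ContinuousAt (fun y => t (ψ.symm y)) (ψ u) :=
    ht.continuous.continuousAt.comp (ψ.continuousAt_symm (ψ.map_source hu))
  have e1 : ∀ᶠ y in 𝓝 (ψ u), ψ.symm y ∈ W :=
    (ψ.continuousAt_symm (ψ.map_source hu)).eventually
      (hW.mem_nhds (by simpa [ψ.left_inv hu] using huW))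
  have e2 : ∀ᶠ y in 𝓝 (ψ u), t (ψ.symm y) ∈ φ.source :=
    hcont.eventually (φ.open_source.mem_nhds (by simpa [ψ.left_inv hu] using htu))
  have e0 : ∀ᶠ y in 𝓝 (ψ u), y ∈ ψ.target := ψ.open_target.mem_nhds (ψ.map_source hu)
  obtain ⟨O, hO, hOo, huO⟩ := eventually_nhds_iff.1 (e0.and (e1.and e2))
  refine ⟨O, fun y => κ (ψ.symm y), hOo, huO, fun y hy => (hO y hy).1,
    fun y hy => (hO y hy).2.2, ?_, fun y hy => ?_⟩
  · rw [← contMDiffOn_iff_contDiffOn]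
    exact hκ.comp ((contMDiffOn_symm_of_mem_maximalAtlas hL.mem).mono fun y hy => (hO y hy).1)
      fun y hy => (hO y hy).2.1
  · have h1 := hκX (ψ.symm y) (hO y hy).2.1
    have h2 := fderiv_eq_chartRep (ι := Fin 1) (c := fun _ => 1) (X := fun _ => X) hφ hL.mem ht
      (hO y hy).1 (hO y hy).2.2 (w := L.symm (0, κ (ψ.symm y))) (by
        rw [Fin.sum_univ_one, one_smul]
        exact h1)
    rwa [Fin.sum_univ_one, one_smul] at h2

end Coordinates

/-! ### Transport along the fields of the foliation -/

section Transport

theorem hasDerivAt_fst_of_prod {G G' : Type*} [NormedAddCommGroup G] [NormedSpace ℝ G]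
    [NormedAddCommGroup G'] [NormedSpace ℝ G'] {f : ℝ → G × G'} {d : G × G'} {τ : ℝ}
    (hf : HasDerivAt f d τ) : HasDerivAt (fun τ => (f τ).1) d.1 τ :=
  (ContinuousLinearMap.fst ℝ G G').hasFDerivAt.comp_hasDerivAt τ hf

theorem hasDerivAt_snd_of_prod {G G' : Type*} [NormedAddCommGroup G] [NormedSpace ℝ G]
    [NormedAddCommGroup G'] [NormedSpace ℝ G'] {f : ℝ → G × G'} {d : G × G'} {τ : ℝ}
    (hf : HasDerivAt f d τ) : HasDerivAt (fun τ => (f τ).2) d.2 τ :=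
  (ContinuousLinearMap.snd ℝ G G').hasFDerivAt.comp_hasDerivAt τ hf

theorem eq_add_smul_of_hasDerivAt {G : Type*} [NormedAddCommGroup G] [NormedSpace ℝ G]
    {f : ℝ → G} {d : G} (hf : ∀ τ ∈ Icc (0 : ℝ) 1, HasDerivAt f d τ) {τ : ℝ}
    (hτ : τ ∈ Icc (0 : ℝ) 1) : f τ = f 0 + τ • d := by
  have h1 : ∀ τ ∈ Icc (0 : ℝ) 1, HasDerivAt (fun τ => f τ - τ • d) 0 τ := fun τ hτ => by
    have := (hf τ hτ).sub ((hasDerivAt_id τ).smul_const d)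
    rwa [one_smul, sub_self] at this
  have h2 := constant_of_has_deriv_right_zero (f := fun τ => f τ - τ • d) (a := 0) (b := 1)
    (fun τ hτ => (h1 τ hτ).continuousAt.continuousWithinAt)
    (fun τ hτ => (h1 τ (Ico_subset_Icc_self hτ)).hasDerivWithinAt) τ hτ
  simp only [zero_smul, sub_zero] at h2
  rw [← h2]
  abel

variable {E : Type*} [NormedAddCommGroup E] [NormedSpace ℝ E]
  {N : Type*} [NormedAddCommGroup N] [NormedSpace ℝ N]
  {N' : Type*} [NormedAddCommGroup N'] [NormedSpace ℝ N']
  {ι : Type*} [Fintype ι]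

/-- Locally Lipschitz functions are Lipschitz on a common open neighbourhood. -/
theorem exists_isOpen_lipschitzOnWith {X : ι → E → E} {x₀ : E}
    (hX : ∀ i, ContDiffAt ℝ ∞ (X i) x₀) :
    ∃ (S : Set E) (K : NNReal), IsOpen S ∧ x₀ ∈ S ∧ ∀ i, LipschitzOnWith K (X i) S := by
  choose K S hS hK using fun i => ((hX i).of_le (by simp) :
    ContDiffAt ℝ 1 (X i) x₀).exists_lipschitzOnWith
  refine ⟨interior (⋂ i, S i), ∑ i, K i, isOpen_interior,
    mem_interior_iff_mem_nhds.2 (Filter.iInter_mem.2 hS), fun i => ?_⟩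
  exact ((hK i).mono (interior_subset.trans (iInter_subset _ _))).weaken
    (Finset.single_le_sum (fun _ _ => zero_le) (Finset.mem_univ i))

theorem lipschitzOnWith_sum_smul {X : ι → E → E} {S : Set E} {K : NNReal}
    (hK : ∀ i, LipschitzOnWith K (X i) S) {a : ι → ℝ} {B : NNReal} (ha : ∀ i, ‖a i‖ ≤ B) :
    LipschitzOnWith (Fintype.card ι * (B * K)) (fun x => ∑ i, a i • X i x) S := by
  rw [lipschitzOnWith_iff_norm_sub_le]
  intro x hx y hy
  rw [← Finset.sum_sub_distrib]
  refine (norm_sum_le _ _).trans ?_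
  have h : ∀ i ∈ Finset.univ, ‖a i • X i x - a i • X i y‖ ≤ B * K * ‖x - y‖ := fun i _ => by
    rw [← smul_sub, norm_smul, mul_assoc]
    exact mul_le_mul (ha i) ((lipschitzOnWith_iff_norm_sub_le.1 (hK i)) hx hy) (norm_nonneg _)
      B.coe_nonneg
  refine (Finset.sum_le_sum h).trans (le_of_eq ?_)
  simp [mul_assoc]

variable [FiniteDimensional ℝ E] [FiniteDimensional ℝ N] [FiniteDimensional ℝ N']

/-- The submersions `T'` and `T`, given in coordinates in which the fibres of two other submersions
are the vertical subspaces, sweep out the fields `X i` along these fibres; the points of the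
fibres of the first one can then be transported to the second one in such a way that `T'` becomes
`T`. -/
theorem exists_transport {O' : Set (E × N')} {O : Set (E × N)} {Q : Set E} (hO' : IsOpen O')
    (hO : IsOpen O) (hQ : IsOpen Q) {T' : E × N' → E} {T : E × N → E}
    (hT' : ContDiffOn ℝ ∞ T' O') (hT : ContDiffOn ℝ ∞ T O) {c : ι → E × N' → N' →L[ℝ] ℝ}
    (hc : ∀ i, ContDiffOn ℝ ∞ (c i) O') {C : ℝ} (hC : ∀ i z, ‖c i z‖ ≤ C) {κ : ι → E × N → N}
    (hκ : ∀ i, ContDiffOn ℝ ∞ (κ i) O) {X : ι → E → E}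
    (hTX' : ∀ z ∈ O', ∀ ξ, fderiv ℝ T' z (0, ξ) = ∑ i, c i z ξ • X i (T' z))
    (hTX : ∀ i, ∀ z ∈ O, fderiv ℝ T z (0, κ i z) = X i (T z)) {a₀ : E} {γ : E → E}
    (hγ : ContDiffOn ℝ ∞ γ Q) (h0' : (a₀, 0) ∈ O') (haQ : a₀ ∈ Q) (h0 : (γ a₀, 0) ∈ O)
    (hX : ∀ i, ContDiffAt ℝ ∞ (X i) (T (γ a₀, 0)))
    (hinit : ∀ a ∈ Q, (a, 0) ∈ O' → T' (a, 0) = T (γ a, 0)) :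
    ∃ (Ω : Set (E × N')) (f : E × N' → E × N), IsOpen Ω ∧ (a₀, 0) ∈ Ω ∧ Ω ⊆ O' ∧
      (∀ z ∈ Ω, z.1 ∈ Q) ∧ ContDiffOn ℝ ∞ f Ω ∧
      ∀ z ∈ Ω, f z ∈ O ∧ (f z).1 = γ z.1 ∧ T (f z) = T' z ∧ (z.2 = 0 → (f z).2 = 0) := by
  obtain ⟨S, K, hS, hS0, hK⟩ := exists_isOpen_lipschitzOnWith hX
  -- Parameters and time are made part of the state, so the equation becomes autonomous: the pair
  -- (a, ξ) is constant, time has speed 1, and the last component moves along the lifts.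
  let P := (E × N') × ℝ × (E × N)
  let sc : P → E × N' := fun p => (p.1.1, p.2.1 • p.1.2)
  have hsc : ContDiff ℝ ∞ sc := by fun_prop
  let O₁ : Set (E × N') := O' ∩ T' ⁻¹' S
  let O₂ : Set (E × N) := O ∩ T ⁻¹' S
  have hO₁ : IsOpen O₁ := hT'.continuousOn.isOpen_inter_preimage hO' hS
  have hO₂ : IsOpen O₂ := hT.continuousOn.isOpen_inter_preimage hO hS
  -- The images by T' and T are also kept in S, where the Xᵢ are Lipschitz, for the uniqueness
  -- argument.
  let R : Set P := {p | sc p ∈ O₁ ∧ p.2.2 ∈ O₂}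
  have hR : IsOpen R := (hO₁.preimage hsc.continuous).inter
    (hO₂.preimage (continuous_snd.comp continuous_snd))
  let g : P → P := fun p => (0, 1, 0, ∑ i, c i (sc p) p.1.2 • κ i p.2.2)
  have hg : ContDiffOn ℝ ∞ g R := by
    refine contDiffOn_const.prodMk (contDiffOn_const.prodMk (contDiffOn_const.prodMk ?_))
    refine ContDiffOn.sum fun i _ => ?_
    refine (ContDiffOn.clm_apply ((hc i).comp hsc.contDiffOn fun p hp => hp.1.1) ?_).smul
      ((hκ i).comp (by fun_prop) fun p hp => hp.2.1)
    fun_prop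
  have hx₀ : (((a₀, 0), 0, (γ a₀, 0)) : P) ∈ R := by
    refine ⟨?_, h0, hS0⟩
    simp only [sc, smul_zero]
    refine ⟨h0', ?_⟩
    rw [mem_preimage, hinit a₀ haQ h0']
    exact hS0
  obtain ⟨ε, hε, W, hW, hx₀W, Φ, hΦ0, hΦ, hΦ1⟩ := exists_smooth_flow hR hx₀ hg
  -- The flow is known only for the field multiplied by ε. Starting from ε⁻¹ ξ compensates for this:
  -- at parameter τ the clock shows τε, so the point on the segment is (a, τξ), and the factors ε
  -- and ε⁻¹ also cancel in the velocity, which is linear in ξ.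
  let A : E × N' → P := fun z => ((z.1, ε⁻¹ • z.2), 0, (γ z.1, 0))
  have hA : ContDiffOn ℝ ∞ A {z | z.1 ∈ Q} := by
    have h1 : ContDiffOn ℝ ∞ (fun z : E × N' => γ z.1) {z | z.1 ∈ Q} :=
      hγ.comp contDiff_fst.contDiffOn fun z hz => hz
    exact ContDiffOn.prodMk (by fun_prop) (contDiffOn_const.prodMk (h1.prodMk contDiffOn_const))
  have hQ' : IsOpen {z : E × N' | z.1 ∈ Q} := hQ.preimage continuous_fst
  refine ⟨O' ∩ ({z | z.1 ∈ Q} ∩ A ⁻¹' W), fun z => (Φ (A z) 1).2.2,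
    hO'.inter (hA.continuousOn.isOpen_inter_preimage hQ' hW), ⟨h0', haQ, ?_⟩, inter_subset_left,
    fun z hz => hz.2.1, ?_, fun z hz => ?_⟩
  · simpa [A] using hx₀W
  · exact ((contDiff_snd.comp (contDiff_snd.comp hΦ1)).comp_contDiffOn hA).mono fun z hz => hz.2.1
  · obtain ⟨hzO, hzQ, hzW⟩ := hz
    have hΦz := hΦ (A z) hzW
    have hone : (1 : ℝ) ∈ Icc (0 : ℝ) 1 := ⟨zero_le_one, le_rfl⟩
    have hp : ∀ τ ∈ Icc (0 : ℝ) 1, (Φ (A z) τ).1 = (z.1, ε⁻¹ • z.2) := fun τ hτ => by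
      have := eq_add_smul_of_hasDerivAt (f := fun τ => (Φ (A z) τ).1) (d := 0)
        (fun τ hτ => (hasDerivAt_fst_of_prod (hΦz τ hτ).2).congr_deriv (smul_zero ε)) hτ
      simpa [hΦ0, A] using this
    have hq : ∀ τ ∈ Icc (0 : ℝ) 1, (Φ (A z) τ).2.1 = τ * ε := fun τ hτ => by
      have := eq_add_smul_of_hasDerivAt (f := fun τ => (Φ (A z) τ).2.1) (d := ε)
        (fun τ hτ => (hasDerivAt_fst_of_prod
          (hasDerivAt_snd_of_prod (hΦz τ hτ).2)).congr_deriv (mul_one ε)) hτ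
      simpa [hΦ0, A] using this
    have hsc' : ∀ τ ∈ Icc (0 : ℝ) 1, sc (Φ (A z) τ) = (z.1, τ • z.2) := fun τ hτ => by
      simp only [sc, hp τ hτ, hq τ hτ, smul_smul]
      rw [mul_assoc, mul_inv_cancel₀ hε.ne', mul_one]
    have hr : ∀ τ ∈ Icc (0 : ℝ) 1, HasDerivAt (fun τ => (Φ (A z) τ).2.2)
        (0, ∑ i, c i (z.1, τ • z.2) z.2 • κ i (Φ (A z) τ).2.2) τ := fun τ hτ => by
      have h1 := hasDerivAt_snd_of_prod (hasDerivAt_snd_of_prod (hΦz τ hτ).2)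
      refine h1.congr_deriv ?_
      refine Prod.ext (smul_zero ε) ?_
      change ε • ∑ i, c i (sc (Φ (A z) τ)) (Φ (A z) τ).1.2 • κ i (Φ (A z) τ).2.2 = _
      rw [hsc' τ hτ, hp τ hτ, Finset.smul_sum]
      refine Finset.sum_congr rfl fun i _ => ?_
      rw [map_smul, smul_smul, smul_eq_mul]
      rw [← mul_assoc, mul_inv_cancel₀ hε.ne', one_mul]
    have hin : ∀ τ ∈ Icc (0 : ℝ) 1, (z.1, τ • z.2) ∈ O₁ ∧ (Φ (A z) τ).2.2 ∈ O₂ := fun τ hτ => by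
      have := (hΦz τ hτ).1
      exact ⟨by rw [← hsc' τ hτ]; exact this.1, this.2⟩
    have hfst : ∀ τ ∈ Icc (0 : ℝ) 1, (Φ (A z) τ).2.2.1 = γ z.1 := fun τ hτ => by
      have := eq_add_smul_of_hasDerivAt (f := fun τ => (Φ (A z) τ).2.2.1) (d := 0)
        (fun τ hτ => hasDerivAt_fst_of_prod (hr τ hτ)) hτ
      simpa [hΦ0, A] using this
    refine ⟨(hin 1 hone).2.1, hfst 1 hone, ?_, fun hz0 => ?_⟩
    -- The curves T'(a, τξ) and T(r(τ)) solve the same equation x' = ∑ cᵢ(a, τξ)(ξ) Xᵢ(x) and start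
    -- at the same point, so they agree at τ = 1.
    · have d1 : ∀ τ ∈ Icc (0 : ℝ) 1, HasDerivAt (fun τ => T' (z.1, τ • z.2))
          (∑ i, c i (z.1, τ • z.2) z.2 • X i (T' (z.1, τ • z.2))) τ := fun τ hτ => by
        have hm := (hin τ hτ).1.1
        have e1 := ((hT'.contDiffAt (hO'.mem_nhds hm)).differentiableAt (by simp)).hasFDerivAt
        have e2 : HasDerivAt (fun τ : ℝ => (z.1, τ • z.2)) ((0 : E), z.2) τ :=
          (hasDerivAt_const τ z.1).prodMk (by simpa using (hasDerivAt_id τ).smul_const z.2)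
        exact (e1.comp_hasDerivAt τ e2).congr_deriv (hTX' _ hm _)
      have d2 : ∀ τ ∈ Icc (0 : ℝ) 1, HasDerivAt (fun τ => T (Φ (A z) τ).2.2)
          (∑ i, c i (z.1, τ • z.2) z.2 • X i (T (Φ (A z) τ).2.2)) τ := fun τ hτ => by
        have hm := (hin τ hτ).2.1
        have e1 := ((hT.contDiffAt (hO.mem_nhds hm)).differentiableAt (by simp)).hasFDerivAt
        refine (e1.comp_hasDerivAt τ (hr τ hτ)).congr_deriv ?_
        let D := (fderiv ℝ T (Φ (A z) τ).2.2).comp (ContinuousLinearMap.inr ℝ E N)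
        change D (∑ i, c i (z.1, τ • z.2) z.2 • κ i (Φ (A z) τ).2.2) = _
        rw [map_sum]
        refine Finset.sum_congr rfl fun i _ => ?_
        rw [map_smul]
        exact congrArg (fun w => c i (z.1, τ • z.2) z.2 • w) (hTX i _ hm)
      have hC' : ∀ (τ : ℝ) i, ‖c i (z.1, τ • z.2) z.2‖ ≤ (Real.toNNReal (C * ‖z.2‖) : ℝ) := fun τ i =>
        ((c i _).le_of_opNorm_le (hC i _) _).trans (Real.le_coe_toNNReal _)
      have := ODE_solution_unique_of_mem_Icc_right (a := 0) (b := 1) (s := fun _ => S)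
        (v := fun τ x => ∑ i, c i (z.1, τ • z.2) z.2 • X i x)
        (f := fun τ => T (Φ (A z) τ).2.2) (g := fun τ => T' (z.1, τ • z.2))
        (fun τ _ => lipschitzOnWith_sum_smul hK (hC' τ))
        (fun τ hτ => (d2 τ hτ).continuousAt.continuousWithinAt)
        (fun τ hτ => (d2 τ (Ico_subset_Icc_self hτ)).hasDerivWithinAt)
        (fun τ hτ => (hin τ (Ico_subset_Icc_self hτ)).2.2)
        (fun τ hτ => (d1 τ hτ).continuousAt.continuousWithinAt)
        (fun τ hτ => (d1 τ (Ico_subset_Icc_self hτ)).hasDerivWithinAt)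
        (fun τ hτ => (hin τ (Ico_subset_Icc_self hτ)).1.2)
        (by
          have h1 := (hin 0 ⟨le_rfl, zero_le_one⟩).1.1
          simp only [zero_smul] at h1 ⊢
          rw [hΦ0, hinit z.1 hzQ h1]) hone
      simpa using this
    -- For ξ = 0 all coefficients cᵢ(·)(ξ) vanish, so the lifted curve stays on the zero section.
    · have := eq_add_smul_of_hasDerivAt (f := fun τ => (Φ (A z) τ).2.2.2) (d := 0)
        (fun τ hτ => by simpa [hz0] using hasDerivAt_snd_of_prod (hr τ hτ)) hone
      simpa [hΦ0, A] using this

end Transport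

/-! ### Maps between deformations to the normal cone -/

section DeformationMaps

open NormalConeDeformation

/-- Hadamard's lemma for maps with values in another space. -/
theorem contDiffAt_difference_quotient {E : Type*} [NormedAddCommGroup E] [NormedSpace ℝ E]
    [FiniteDimensional ℝ E] {G : Type*} [NormedAddCommGroup G] [NormedSpace ℝ G]
    [FiniteDimensional ℝ G] (π : E →L[ℝ] E) {O : Set E} (hO : IsOpen O) {g : E → G}
    (hg : ContDiffOn ℝ ∞ g O) (h0 : ∀ y, π y ∈ O → g (π y) = 0) {Q : E × ℝ → G}
    (hQ : ∀ y β, β ≠ 0 → Q (y, β) = β⁻¹ • g (scale π β y))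
    (hQ0 : ∀ y, π y ∈ O → Q (y, 0) = fderiv ℝ g (π y) (y - π y))
    {y₀ : E} (hy₀ : π y₀ ∈ O) : ContDiffAt ℝ ∞ Q (y₀, 0) := by
  -- `contDiffAt_deformation` concerns self-maps; it is applied on E × G to (y, z) ↦ (0, g y).
  let π₁ : E × G →L[ℝ] E × G :=
    (ContinuousLinearMap.inl ℝ E G).comp (π.comp (ContinuousLinearMap.fst ℝ E G))
  let g₁ : E × G → E × G := fun p => (0, g p.1)
  have hg₁ : ContDiffOn ℝ ∞ g₁ (Prod.fst ⁻¹' O) :=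
    contDiffOn_const.prodMk (hg.comp contDiff_fst.contDiffOn fun p hp => hp)
  have hd : ∀ p : E × G, π p.1 ∈ O → fderiv ℝ g₁ (π₁ p) (p - π₁ p) =
      (0, fderiv ℝ g (π p.1) (p.1 - π p.1)) := fun p hp => by
    have h1 := ((hg.contDiffAt (hO.mem_nhds hp)).differentiableAt (by simp)).hasFDerivAt
    have h2 : HasFDerivAt (fun p : E × G => p.1) (ContinuousLinearMap.fst ℝ E G) (π₁ p) :=
      hasFDerivAt_fst
    have h3 : HasFDerivAt g₁ _ (π₁ p) :=
      (hasFDerivAt_const (0 : E) (π₁ p)).prodMk (HasFDerivAt.comp (g := g) (π₁ p) h1 h2)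
    rw [h3.fderiv]
    rfl
  have key := contDiffAt_deformation π₁ (hO.preimage continuous_fst) hg₁
    (fun p hp => congrArg (fun z => ((0 : E), z)) (h0 p.1 hp))
    (G := fun q : (E × G) × ℝ => (0, Q (q.1.1, q.2)))
    (fun p β hβ => by
      have h1 := hQ p.1 β hβ
      refine Prod.ext (smul_zero _).symm ?_
      exact h1)
    (fun p hp => by
      rw [hd p hp]
      exact congrArg (fun z => ((0 : E), z)) (hQ0 p.1 hp))
    (y₀ := ((y₀, 0) : E × G)) hy₀
  have h4 : ContDiffAt ℝ ∞ (fun q : E × ℝ => (((q.1, (0 : G)), q.2) : (E × G) × ℝ)) (y₀, 0) := by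
    fun_prop
  exact contDiffAt_snd.comp (y₀, (0 : ℝ)) (ContDiffAt.comp (y₀, (0 : ℝ)) key h4)

variable {EV : Type*} [NormedAddCommGroup EV] [NormedSpace ℝ EV]
  {EU : Type*} [NormedAddCommGroup EU] [NormedSpace ℝ EU] [FiniteDimensional ℝ EU]
  {V : Type*} [TopologicalSpace V] [ChartedSpace EV V]
  {U : Type*} [TopologicalSpace U] [ChartedSpace EU U] [IsManifold 𝓘(ℝ, EU) ∞ U]
  {EV' : Type*} [NormedAddCommGroup EV'] [NormedSpace ℝ EV']
  {EU' : Type*} [NormedAddCommGroup EU'] [NormedSpace ℝ EU'] [FiniteDimensional ℝ EU']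
  {V' : Type*} [TopologicalSpace V'] [ChartedSpace EV' V']
  {U' : Type*} [TopologicalSpace U'] [ChartedSpace EU' U'] [IsManifold 𝓘(ℝ, EU') ∞ U']
  {j : EmbeddedSubmanifold EV EU V U} {j' : EmbeddedSubmanifold EV' EU' V' U'}

/-- A smooth map `U' → U` induces a smooth map `D(U', V') → D(U, V)` off the normal bundles. -/
theorem exists_deformation_lift_off {O : Set U'} (hO : IsOpen O) {f : U' → U}
    (hf : ContMDiffOn 𝓘(ℝ, EU') 𝓘(ℝ, EU) ∞ f O) {d : NormalConeDeformation j'}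
    (hd : d.proj.1 ∈ O) (hd0 : d.proj.2 ≠ 0) :
    ∃ (W : Set (NormalConeDeformation j')) (F : NormalConeDeformation j' → NormalConeDeformation j),
      IsOpen W ∧ d ∈ W ∧ ContMDiffOn 𝓘(ℝ, EU' × ℝ) 𝓘(ℝ, EU × ℝ) ∞ F W ∧
      ∀ x ∈ W, x.proj.1 ∈ O ∧ (F x).proj = (f x.proj.1, x.proj.2) := by
  let ψ := chartAt EU (f d.proj.1)
  obtain ⟨e, he, h⟩ := exists_off_openPartialHomeomorph j
    (IsManifold.chart_mem_maximalAtlas (I := 𝓘(ℝ, EU)) (n := ∞) (f d.proj.1))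
  have hO' : IsOpen (O ∩ f ⁻¹' ψ.source) := hf.continuousOn.isOpen_inter_preimage hO ψ.open_source
  have hW : IsOpen {x : NormalConeDeformation j' | x.proj.1 ∈ O ∩ f ⁻¹' ψ.source ∧ x.proj.2 ≠ 0} :=
    (hO'.preimage (continuous_fst.comp continuous_proj)).inter
      (isOpen_ne.preimage (continuous_snd.comp continuous_proj))
  have hmem : ∀ x : NormalConeDeformation j', x.proj.1 ∈ O ∩ f ⁻¹' ψ.source ∧ x.proj.2 ≠ 0 →
      (ψ (f x.proj.1), x.proj.2) ∈ e.target := fun x hx => by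
    refine (h.target _).2 ⟨?_, Or.inl hx.2⟩
    simpa [scale] using ψ.map_source hx.1.2
  refine ⟨_, fun x => e.symm (ψ (f x.proj.1), x.proj.2), hW, ⟨⟨hd, mem_chart_source EU _⟩, hd0⟩,
    ?_, fun x hx => ⟨hx.1.1, ?_⟩⟩
  · refine (contMDiffOn_symm_of_mem_maximalAtlas he).comp ?_ fun x hx => hmem x hx
    have h1 : ContMDiffOn 𝓘(ℝ, EU' × ℝ) 𝓘(ℝ, EU) ∞ (fun x : NormalConeDeformation j' =>
        ψ (f x.proj.1)) {x | x.proj.1 ∈ O ∩ f ⁻¹' ψ.source ∧ x.proj.2 ≠ 0} := by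
      refine (contMDiffOn_of_mem_maximalAtlas (IsManifold.chart_mem_maximalAtlas
        (I := 𝓘(ℝ, EU)) (n := ∞) (f d.proj.1))).comp (hf.comp
          (contMDiff_fst.comp contMDiff_proj).contMDiffOn fun x hx => hx.1.1) fun x hx => hx.1.2
    have h2 : ContMDiffOn 𝓘(ℝ, EU' × ℝ) 𝓘(ℝ) ∞ (fun x : NormalConeDeformation j' => x.proj.2)
        {x | x.proj.1 ∈ O ∩ f ⁻¹' ψ.source ∧ x.proj.2 ≠ 0} :=
      (contMDiff_snd.comp contMDiff_proj).contMDiffOn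
    have := h1.prodMk_space h2
    exact this
  · refine (h.symm_proj (hmem x hx)).trans ?_
    simpa [scale] using ψ.left_inv hx.1.2

/-- A smooth map `U' → U` that maps `V'` to `V`, given in slice charts, induces a smooth map
`D(U', V') → D(U, V)`. -/
theorem exists_deformation_lift_slice (c : SliceChart j) (c' : SliceChart j') {Ω : Set EU'}
    (hΩ : IsOpen Ω) {f : EU' → EU} (hf : ContDiffOn ℝ ∞ f Ω)
    (hfc : ∀ y ∈ Ω, f y ∈ c.chart.target)
    (hproj : ∀ y ∈ Ω, c'.proj y = y → c.proj (f y) = f y) :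
    ∃ (W : Set (NormalConeDeformation j')) (F : NormalConeDeformation j' → NormalConeDeformation j),
      IsOpen W ∧ (∀ x, x ∈ W ↔ x.proj.1 ∈ c'.chart.source ∧ c'.chart x.proj.1 ∈ Ω) ∧
      ContMDiffOn 𝓘(ℝ, EU' × ℝ) 𝓘(ℝ, EU × ℝ) ∞ F W ∧
      ∀ x ∈ W, (F x).proj = (c.chart.symm (f (c'.chart x.proj.1)), x.proj.2) := by
  obtain ⟨e, he, h⟩ := exists_slice_openPartialHomeomorph c
  obtain ⟨e', he', h'⟩ := exists_slice_openPartialHomeomorph c'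
  let g : EU' → EU := fun y => f y - c.proj (f y)
  have hg : ContDiffOn ℝ ∞ g Ω := hf.sub (c.proj.contDiff.comp_contDiffOn hf)
  -- Q is the transverse part of f divided by β, with the transverse derivative as its value at β =
  -- 0. It is smooth there by Hadamard's lemma, because f maps the slice of V' into that of V.
  let Q : EU' × ℝ → EU := fun q => if q.2 = 0 then fderiv ℝ g (c'.proj q.1) (q.1 - c'.proj q.1)
    else q.2⁻¹ • g (scale c'.proj q.2 q.1)
  let S : Set (EU' × ℝ) := {q | scale c'.proj q.2 q.1 ∈ Ω}
  have hS : IsOpen S := hΩ.preimage (continuous_scale c'.proj)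
  have hfS : ∀ q ∈ S, ContDiffAt ℝ ∞ (fun q : EU' × ℝ => f (scale c'.proj q.2 q.1)) q :=
    fun q hq => ContDiffAt.comp (g := f) q (hf.contDiffAt (hΩ.mem_nhds hq))
      (contDiff_scale c'.proj).contDiffAt
  have hQ : ContDiffOn ℝ ∞ Q S := by
    rintro ⟨y, β⟩ hq
    refine ContDiffAt.contDiffWithinAt ?_
    by_cases hβ : β = 0
    · subst hβ
      refine contDiffAt_difference_quotient c'.proj hΩ hg (fun y hy => ?_)
        (fun y β hβ => by simp [Q, hβ]) (fun y _ => by simp [Q]) (by simpa [S] using hq)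
      exact sub_eq_zero.2 (hproj _ hy (c'.proj_proj y)).symm
    · have h1 : ContDiffAt ℝ ∞ (fun q : EU' × ℝ => q.2⁻¹ • g (scale c'.proj q.2 q.1)) (y, β) :=
        (contDiffAt_snd.inv hβ).smul
          ((hfS _ hq).sub (c.proj.contDiff.contDiffAt.comp (y, β) (hfS _ hq)))
      refine h1.congr_of_eventuallyEq ?_
      filter_upwards [continuousAt_snd.eventually (isOpen_ne.mem_nhds hβ)] with q hq0
      exact if_neg hq0
  -- The component along V is that of f and the transverse one is Q, so rescaling by β gives back f,
  -- also at β = 0. Subtracting c.proj (Q q) makes the second term visibly transverse.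
  let Fc : EU' × ℝ → EU × ℝ := fun q =>
    (c.proj (f (scale c'.proj q.2 q.1)) + (Q q - c.proj (Q q)), q.2)
  have hFc : ContDiffOn ℝ ∞ Fc S := by
    refine ContDiffOn.prodMk (ContDiffOn.add ?_ (hQ.sub (c.proj.contDiff.comp_contDiffOn hQ)))
      contDiffOn_snd
    exact c.proj.contDiff.comp_contDiffOn fun q hq => (hfS q hq).contDiffWithinAt
  have hscale : ∀ q ∈ S, scale c.proj (Fc q).2 (Fc q).1 = f (scale c'.proj q.2 q.1) := by
    rintro ⟨y, β⟩ hq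
    by_cases hβ : β = 0
    · subst hβ
      have h1 : c'.proj y ∈ Ω := by simpa [S] using hq
      simp [Fc, c.proj_proj, hproj _ h1 (c'.proj_proj y)]
    · simp [Fc, Q, g, hβ, scale, c.proj_proj, smul_smul]
  have hmem : ∀ q ∈ S, Fc q ∈ e.target := fun q hq =>
    (h.target _).2 ⟨by rw [hscale q hq]; exact hfc _ hq, Or.inr trivial⟩
  have hW : ∀ x, x ∈ e'.source ∩ e' ⁻¹' S ↔ x.proj.1 ∈ c'.chart.source ∧ c'.chart x.proj.1 ∈ Ω :=
    fun x => by
      constructor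
      · rintro ⟨hx, hxS⟩
        refine ⟨((h'.source x).1 hx).1, ?_⟩
        have := h'.scale_eq x hx
        rw [← this]
        exact hxS
      · rintro ⟨hx, hxΩ⟩
        have hx' := (h'.source x).2 ⟨hx, Or.inr trivial⟩
        refine ⟨hx', ?_⟩
        rw [← h'.scale_eq x hx'] at hxΩ
        exact hxΩ
  refine ⟨e'.source ∩ e' ⁻¹' S, fun x => e.symm (Fc (e' x)), e'.isOpen_inter_preimage hS, hW,
    ?_, fun x hx => ?_⟩
  · refine (contMDiffOn_symm_of_mem_maximalAtlas he).comp (hFc.contMDiffOn.comp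
      ((contMDiffOn_of_mem_maximalAtlas he').mono inter_subset_left) fun x hx => hx.2)
      fun x hx => hmem _ hx.2
  · refine (h.symm_proj (hmem _ hx.2)).trans ?_
    have h1 := hscale _ hx.2
    have h2 := h'.scale_eq x hx.1
    have h3 := h'.snd x
    refine Prod.ext ?_ h3
    refine congrArg c.chart.symm (h1.trans ?_)
    exact congrArg f h2

end DeformationMaps

/-! ### Morphisms of bi-submersions near identity bisections -/

section LocalMorphism

open NormalConeDeformation

variable {E : Type*} [NormedAddCommGroup E] [NormedSpace ℝ E] [FiniteDimensional ℝ E]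
  {M : Type*} [TopologicalSpace M] [ChartedSpace E M] [IsManifold 𝓘(ℝ, E) ∞ M]
  {F : Set (∀ x : M, TangentSpace 𝓘(ℝ, E) x)}
  {EU : Type*} [NormedAddCommGroup EU] [NormedSpace ℝ EU] [FiniteDimensional ℝ EU]
  {U : Type*} [TopologicalSpace U] [ChartedSpace EU U] [IsManifold 𝓘(ℝ, EU) ∞ U]
  {V : Type*} [TopologicalSpace V] [ChartedSpace E V]
  {EU' : Type*} [NormedAddCommGroup EU'] [NormedSpace ℝ EU'] [FiniteDimensional ℝ EU']
  {U' : Type*} [TopologicalSpace U'] [ChartedSpace EU' U'] [IsManifold 𝓘(ℝ, EU') ∞ U']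
  [T2Space U'] [SigmaCompactSpace U']
  {V' : Type*} [TopologicalSpace V'] [ChartedSpace E V']
  {N : Type*} [NormedAddCommGroup N] [NormedSpace ℝ N] [FiniteDimensional ℝ N]
  {N' : Type*} [NormedAddCommGroup N'] [NormedSpace ℝ N'] [FiniteDimensional ℝ N']
  {s t : U → M} {s' t' : U' → M}
  {j : EmbeddedSubmanifold E EU V U} {j' : EmbeddedSubmanifold E EU' V' U'}

omit [FiniteDimensional ℝ E] [IsManifold 𝓘(ℝ, E) ∞ M] [FiniteDimensional ℝ EU]
  [IsManifold 𝓘(ℝ, EU) ∞ U] [FiniteDimensional ℝ N] in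
/-- Points of an identity bisection in coordinates in which it is the zero section. -/
theorem apply_symm_of_mem_bisection {c : SliceChart j} {φ : OpenPartialHomeomorph M E}
    {L : EU ≃L[ℝ] E × N} (hL : IsSubmersionChart s c.chart φ L)
    (hc : ∀ y, c.proj y = L.symm ((L y).1, 0)) (hst : ∀ v, s (j.incl v) = t (j.incl v)) {a : E}
    (ha : L.symm (a, 0) ∈ c.chart.target) :
    t (c.chart.symm (L.symm (a, 0))) ∈ φ.source ∧ φ (t (c.chart.symm (L.symm (a, 0)))) = a := by
  have hu := c.chart.map_target ha
  obtain ⟨v, hv⟩ := (c.mem_range_iff _ hu).2 (by rw [c.chart.right_inv ha, hc]; simp)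
  have h1 := hL.eq _ hu
  have h2 := hL.mapsTo _ hu
  rw [c.chart.right_inv ha, L.apply_symm_apply] at h1
  rw [← hv, ← hst, hv]
  exact ⟨h2, h1⟩

omit [FiniteDimensional ℝ E] [IsManifold 𝓘(ℝ, E) ∞ M] [FiniteDimensional ℝ EU]
  [IsManifold 𝓘(ℝ, EU) ∞ U] [FiniteDimensional ℝ N] in
theorem chart_apply_incl {c : SliceChart j} {φ : OpenPartialHomeomorph M E}
    {L : EU ≃L[ℝ] E × N} (hL : IsSubmersionChart s c.chart φ L)
    (hc : ∀ y, c.proj y = L.symm ((L y).1, 0)) {v : V} (hv : j.incl v ∈ c.chart.source) :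
    L.symm (φ (s (j.incl v)), 0) = c.chart (j.incl v) := by
  have h1 := (c.mem_range_iff _ hv).1 ⟨v, rfl⟩
  rw [hc, ← hL.eq _ hv] at h1
  exact h1

omit [FiniteDimensional ℝ EU] in
/-- Near identity bisections over the same points of `M`, there is a morphism of bi-submersions that
maps one bisection to the other. -/
theorem exists_local_morphism {c : SliceChart j} {φ : OpenPartialHomeomorph M E}
    {L : EU ≃L[ℝ] E × N} (hL : IsSubmersionChart s c.chart φ L)
    (hc : ∀ y, c.proj y = L.symm ((L y).1, 0)) {c' : SliceChart j'}
    {φ' : OpenPartialHomeomorph M E} {L' : EU' ≃L[ℝ] E × N'}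
    (hL' : IsSubmersionChart s' c'.chart φ' L') (hc' : ∀ y, c'.proj y = L'.symm ((L' y).1, 0))
    (hF : ∀ X ∈ F, IsSmoothCompactField 𝓘(ℝ, E) X)
    (hs : ContMDiff 𝓘(ℝ, EU) 𝓘(ℝ, E) ∞ s) (ht : ContMDiff 𝓘(ℝ, EU) 𝓘(ℝ, E) ∞ t)
    (hs' : ContMDiff 𝓘(ℝ, EU') 𝓘(ℝ, E) ∞ s') (ht' : ContMDiff 𝓘(ℝ, EU') 𝓘(ℝ, E) ∞ t')
    (hst : SweepsOut 𝓘(ℝ, E) 𝓘(ℝ, EU) F s t) (hst' : SweepsOut 𝓘(ℝ, E) 𝓘(ℝ, EU') F s' t')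
    (hV : ∀ v, s (j.incl v) = t (j.incl v)) (hV' : ∀ v, s' (j'.incl v) = t' (j'.incl v))
    {v : V} {v' : V'} (hv : j.incl v ∈ c.chart.source) (hv' : j'.incl v' ∈ c'.chart.source)
    (hvv : s' (j'.incl v') = s (j.incl v)) :
    ∃ (Ω : Set EU') (f : EU' → EU), IsOpen Ω ∧ c'.chart (j'.incl v') ∈ Ω ∧ Ω ⊆ c'.chart.target ∧
      ContDiffOn ℝ ∞ f Ω ∧ (∀ y ∈ Ω, f y ∈ c.chart.target) ∧
      (∀ y ∈ Ω, c'.proj y = y → c.proj (f y) = f y) ∧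
      ∀ y ∈ Ω, s (c.chart.symm (f y)) = s' (c'.chart.symm y) ∧
        t (c.chart.symm (f y)) = t' (c'.chart.symm y) := by
  have hφ := hL.mem'
  have htv : t (j.incl v) ∈ φ.source := hV v ▸ hL.mapsTo _ hv
  have htv' : t' (j'.incl v') ∈ φ.source := by
    rw [← hV', hvv]
    exact hL.mapsTo _ hv
  obtain ⟨ι, _, co, X, O₁, C, hXF, hO₁, hvO₁, hO₁c, hO₁φ, hco, hC, hD'⟩ :=
    hst'.exists_coefficients hφ hL' hs' ht' hv' htv'
  choose O₂ κ hO₂ hvO₂ hO₂c hO₂φ hκ hD using fun i =>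
    hst.exists_chart_lift hφ hL hs ht hv htv (hXF i)
  -- These conditions are imposed separately: the index set ι may be empty, and then the O₂ i impose
  -- none.
  let O₃ : Set EU := {y | y ∈ c.chart.target ∧ t (c.chart.symm y) ∈ φ.source}
  have hO₃ : IsOpen O₃ := (ht.continuous.comp_continuousOn
    c.chart.continuousOn_symm).isOpen_inter_preimage c.chart.open_target φ.open_source
  let T' : E × N' → E := (fun y => φ (t' (c'.chart.symm y))) ∘ L'.symm
  let T : E × N → E := (fun y => φ (t (c.chart.symm y))) ∘ L.symm
  let O' : Set (E × N') := L'.symm ⁻¹' O₁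
  let O : Set (E × N) := L.symm ⁻¹' (O₃ ∩ ⋂ i, O₂ i)
  have hO' : IsOpen O' := hO₁.preimage L'.symm.continuous
  have hO : IsOpen O := (hO₃.inter (isOpen_iInter_of_finite hO₂)).preimage L.symm.continuous
  -- The chart of U' reads s' in φ' and that of U reads s in φ. The change of coordinates γ makes
  -- the two curves lie over the same point of M.
  let γ : E → E := φ'.symm.trans φ
  have hγ₀ : ContDiffOn ℝ ∞ γ (φ'.symm.trans φ).source := by
    rw [← contMDiffOn_iff_contDiffOn]
    exact (contMDiffOn_of_mem_maximalAtlas hφ).comp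
      ((contMDiffOn_symm_of_mem_maximalAtlas hL'.mem').mono fun a ha => ha.1) fun a ha => ha.2
  let Q : Set E := (φ'.symm.trans φ).source ∩ (fun a => (γ a, (0 : N))) ⁻¹' O
  have hQ : IsOpen Q := ContinuousOn.isOpen_inter_preimage
    (hγ₀.continuousOn.prodMk continuousOn_const) (φ'.symm.trans φ).open_source hO
  have e' := chart_apply_incl hL' hc' hv'
  have e := chart_apply_incl hL hc hv
  have hγs : γ (φ' (s' (j'.incl v'))) = φ (s (j.incl v)) := by
    change φ (φ'.symm _) = _
    rw [φ'.left_inv (hL'.mapsTo _ hv'), hvv]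
  have h0' : (φ' (s' (j'.incl v')), 0) ∈ O' := by
    change L'.symm _ ∈ O₁
    rwa [e']
  have h0 : (γ (φ' (s' (j'.incl v'))), 0) ∈ O := by
    change L.symm _ ∈ O₃ ∩ ⋂ i, O₂ i
    rw [hγs, e]
    refine ⟨⟨c.chart.map_source hv, ?_⟩, mem_iInter.2 hvO₂⟩
    rwa [c.chart.left_inv hv]
  have haQ : φ' (s' (j'.incl v')) ∈ Q := by
    refine ⟨⟨φ'.map_source (hL'.mapsTo _ hv'), ?_⟩, h0⟩
    change φ'.symm _ ∈ φ.source
    rw [φ'.left_inv (hL'.mapsTo _ hv'), hvv]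
    exact hL.mapsTo _ hv
  obtain ⟨Ω, f, hΩ, hΩ0, hΩO, hΩQ, hf, hfΩ⟩ := exists_transport hO' hO hQ (T' := T') (T := T)
    ((contDiffOn_comp_symm hφ hL'.mem ht').comp L'.symm.contDiff.contDiffOn fun z hz =>
      ⟨hO₁c hz, hO₁φ _ hz⟩)
    ((contDiffOn_comp_symm hφ hL.mem ht).comp L.symm.contDiff.contDiffOn fun z hz => hz.1)
    (c := fun i z => co i (L'.symm z))
    (fun i => (hco i).comp L'.symm.contDiff.contDiffOn fun z hz => hz)
    (fun i z => hC i _) (κ := fun i z => κ i (L.symm z))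
    (fun i => (hκ i).comp L.symm.contDiff.contDiffOn fun z hz => mem_iInter.1 hz.2 i)
    (X := fun i => chartRep φ (X i))
    (fun z hz ξ => by
      refine (DFunLike.congr_fun L'.symm.comp_right_fderiv (0, ξ)).trans ?_
      exact hD' _ hz ξ)
    (fun i z hz => by
      refine (DFunLike.congr_fun L.symm.comp_right_fderiv (0, κ i (L.symm z))).trans ?_
      exact hD i _ (mem_iInter.1 hz.2 i))
    (a₀ := φ' (s' (j'.incl v'))) (γ := γ) (hγ₀.mono inter_subset_left) h0' haQ h0
    (fun i => by
      refine (contDiffOn_chartRep hφ (hF _ (hXF i))).contDiffAt (φ.open_target.mem_nhds ?_)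
      exact φ.map_source h0.1.2)
    -- On zero sections t' and t agree with s' and s, so both sides are the φ-coordinates of the
    -- point of M with φ'-coordinates a.
    (fun a ha haO => by
      have h1 := (apply_symm_of_mem_bisection hL hc hV (a := γ a) ha.2.1.1).2
      obtain ⟨h2, h3⟩ := apply_symm_of_mem_bisection hL' hc' hV' (a := a) (hO₁c haO)
      refine Eq.trans ?_ h1.symm
      change _ = φ (φ'.symm a)
      conv_rhs => rw [← h3, φ'.left_inv h2]
      rfl)
  have hz : ∀ y, L' y ∈ Ω → y ∈ O₁ := fun y hy => by
    have : L'.symm (L' y) ∈ O₁ := hΩO hy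
    rwa [L'.symm_apply_apply] at this
  refine ⟨L' ⁻¹' Ω, fun y => L.symm (f (L' y)), hΩ.preimage L'.continuous, ?_,
    fun y hy => hO₁c (hz y hy), ?_, fun y hy => ?_, fun y hy hyV => ?_, fun y hy => ?_⟩
  · change L' _ ∈ Ω
    rwa [← e', L'.apply_symm_apply]
  · exact L.symm.contDiff.comp_contDiffOn (hf.comp L'.contDiff.contDiffOn fun y hy => hy)
  · exact (hfΩ _ hy).1.1.1
  · have h1 : (L' y).2 = 0 := by
      rw [← hyV, hc', L'.apply_symm_apply]
    have h2 := (hfΩ _ hy).2.2.2 h1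
    rw [hc, L.apply_symm_apply, ← h2]
  · obtain ⟨h1, h2, h3, -⟩ := hfΩ _ hy
    have hyc := hO₁c (hz y hy)
    constructor
    · have h4 := hL.eq _ (c.chart.map_target h1.1.1)
      have h5 := hL'.eq _ (c'.chart.map_target hyc)
      have h6 := hL'.mapsTo _ (c'.chart.map_target hyc)
      rw [c.chart.right_inv h1.1.1, L.apply_symm_apply, h2] at h4
      rw [c'.chart.right_inv hyc] at h5
      have h7 : φ'.symm (L' y).1 = s' (c'.chart.symm y) := by rw [← h5, φ'.left_inv h6]
      refine φ.injOn (hL.mapsTo _ (c.chart.map_target h1.1.1)) ?_ (h4.trans ?_)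
      · rw [← h7]
        exact (hΩQ _ hy).1.2
      · exact congrArg φ h7
    · refine φ.injOn h1.1.2 (hO₁φ y (hz y hy)) (h3.trans ?_)
      exact congrArg (fun y => φ (t' (c'.chart.symm y))) (L'.symm_apply_apply y)

end LocalMorphism

/-- Adaptedness of bi-submersions passes to the deformations to the normal cones of identity
bisections. -/
theorem isAdaptedTo_deformation
    {E : Type*} [NormedAddCommGroup E] [NormedSpace ℝ E] [FiniteDimensional ℝ E]
    {M : Type*} [TopologicalSpace M] [ChartedSpace E M] [IsManifold 𝓘(ℝ, E) ∞ M]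
    [T2Space M] [SigmaCompactSpace M] {F : Set (∀ x : M, TangentSpace 𝓘(ℝ, E) x)}
    {EU : Type*} [NormedAddCommGroup EU] [NormedSpace ℝ EU] [FiniteDimensional ℝ EU]
    {U : Type*} [TopologicalSpace U] [ChartedSpace EU U] [IsManifold 𝓘(ℝ, EU) ∞ U]
    {V : Type*} [TopologicalSpace V] [ChartedSpace E V]
    {t s : U → M} (hU : IsBisubmersion 𝓘(ℝ, E) 𝓘(ℝ, EU) F t s)
    {j : EmbeddedSubmanifold E EU V U} (hV : IsIdentityBisection t s j)
    {EU' : Type*} [NormedAddCommGroup EU'] [NormedSpace ℝ EU'] [FiniteDimensional ℝ EU']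
    {U' : Type*} [TopologicalSpace U'] [ChartedSpace EU' U'] [IsManifold 𝓘(ℝ, EU') ∞ U']
    {V' : Type*} [TopologicalSpace V'] [ChartedSpace E V']
    {t' s' : U' → M} (hU' : IsBisubmersion 𝓘(ℝ, E) 𝓘(ℝ, EU') F t' s')
    (had : IsAdaptedTo 𝓘(ℝ, EU) 𝓘(ℝ, EU') t' s' t s)
    {j' : EmbeddedSubmanifold E EU' V' U'} (hV' : IsIdentityBisection t' s' j')
    (hsub : ∀ v' : V', s' (j'.incl v') ∈ range (fun v : V => s (j.incl v))) :
    IsAdaptedTo 𝓘(ℝ, EU × ℝ) 𝓘(ℝ, EU' × ℝ) (deformationMap j' t') (deformationMap j' s')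
      (deformationMap j t) (deformationMap j s) := by
  have := hU.t2Space
  have := hU.secondCountable
  have := hU'.t2Space
  have := hU'.secondCountable
  have := locallyCompactSpace 𝓘(ℝ, EU) (U := U)
  have := locallyCompactSpace 𝓘(ℝ, EU') (U := U')
  intro d
  by_cases hd : d.proj.2 = 0
  -- At a normal vector the morphism given by adaptedness is not used, since it need not map V' into
  -- V. The one constructed by `exists_local_morphism` does, and it extends over β = 0.
  · have hdv : ∃ v', d.proj.1 = j'.incl v' := by
      cases d with
      | off p β hβ => exact absurd hd hβ
      | normal v' n => exact ⟨v', rfl⟩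
    obtain ⟨v', hv'⟩ := hdv
    obtain ⟨v, hv⟩ := hsub v'
    obtain ⟨N, _, _, hN⟩ := hU.submersion_s
    obtain ⟨N', _, _, hN'⟩ := hU'.submersion_s
    obtain ⟨c, φ, L, hL, hvc, hc⟩ := exists_sliceChart_isSubmersionChart hN hV.etale v
    obtain ⟨c', φ', L', hL', hvc', hc'⟩ := exists_sliceChart_isSubmersionChart hN' hV'.etale v'
    have : FiniteDimensional ℝ N := Module.Finite.of_surjective
      ((LinearMap.snd ℝ E N) ∘ₗ (L : EU →ₗ[ℝ] E × N)) (Prod.snd_surjective.comp L.surjective)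
    have : FiniteDimensional ℝ N' := Module.Finite.of_surjective
      ((LinearMap.snd ℝ E N') ∘ₗ (L' : EU' →ₗ[ℝ] E × N')) (Prod.snd_surjective.comp L'.surjective)
    obtain ⟨Ω, f, hΩ, hvΩ, -, hf, hfc, hproj, hfst⟩ := exists_local_morphism hL hc hL' hc'
      hU.isFoliation.smooth hU.submersion_s.contMDiff hU.submersion_t.contMDiff
      hU'.submersion_s.contMDiff hU'.submersion_t.contMDiff (sweepsOut_of_isBisubmersion hU)
      (sweepsOut_of_isBisubmersion hU') hV.coincide hV'.coincide hvc hvc' hv.symm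
    obtain ⟨W, G, hW, hWmem, hG, hGp⟩ := exists_deformation_lift_slice c c' hΩ hf hfc hproj
    refine ⟨W, hW, (hWmem d).2 (by rw [hv']; exact ⟨hvc', hvΩ⟩), G, hG, fun x hx => ?_⟩
    obtain ⟨h1, h2⟩ := hfst _ ((hWmem x).1 hx).2
    rw [c'.chart.left_inv ((hWmem x).1 hx).1] at h1 h2
    simp only [deformationMap, hGp x hx, h1, h2, and_self]
  -- For β ≠ 0 the bisections play no role, and the given morphism times the identity of ℝ suffices.
  · obtain ⟨O, hO, hdO, f, hf, hfst⟩ := had d.proj.1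
    obtain ⟨W, G, hW, hdW, hG, hGp⟩ := exists_deformation_lift_off (j := j) hO hf hdO hd
    refine ⟨W, hW, hdW, G, hG, fun x hx => ?_⟩
    obtain ⟨hxO, hxp⟩ := hGp x hx
    simp only [deformationMap, hxp, (hfst _ hxO).1, (hfst _ hxO).2, and_self]

end SingularFoliation

theorem mainTheorem4
    {E : Type*} [NormedAddCommGroup E] [NormedSpace ℝ E] [FiniteDimensional ℝ E]
    {M : Type*} [TopologicalSpace M] [ChartedSpace E M] [IsManifold 𝓘(ℝ, E) ∞ M]
    [T2Space M] [SecondCountableTopology M]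
    (F : Set (∀ x : M, TangentSpace 𝓘(ℝ, E) x))
    {EU : Type*} [NormedAddCommGroup EU] [NormedSpace ℝ EU] [FiniteDimensional ℝ EU]
    {U : Type*} [TopologicalSpace U] [ChartedSpace EU U] [IsManifold 𝓘(ℝ, EU) ∞ U]
    (t s : U → M) (hU : IsBisubmersion 𝓘(ℝ, E) 𝓘(ℝ, EU) F t s)
    {V : Type*} [TopologicalSpace V] [ChartedSpace E V] [IsManifold 𝓘(ℝ, E) ∞ V]
    (j : EmbeddedSubmanifold E EU V U) (hV : IsIdentityBisection t s j)
    (hVclosed : IsClosed (range j.incl)) :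
    IsBisubmersion (𝓘(ℝ, E).prod 𝓘(ℝ)) 𝓘(ℝ, EU × ℝ) (adiabaticFoliation 𝓘(ℝ, E) F)
      (deformationMap j t) (deformationMap j s) ∧
    ∀ {EU' : Type*} [NormedAddCommGroup EU'] [NormedSpace ℝ EU'] [FiniteDimensional ℝ EU']
      {U' : Type*} [TopologicalSpace U'] [ChartedSpace EU' U'] [IsManifold 𝓘(ℝ, EU') ∞ U']
      (t' s' : U' → M), IsBisubmersion 𝓘(ℝ, E) 𝓘(ℝ, EU') F t' s' →
      IsAdaptedTo 𝓘(ℝ, EU) 𝓘(ℝ, EU') t' s' t s →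
      ∀ {V' : Type*} [TopologicalSpace V'] [ChartedSpace E V'] [IsManifold 𝓘(ℝ, E) ∞ V']
        (j' : EmbeddedSubmanifold E EU' V' U'), IsIdentityBisection t' s' j' →
        IsClosed (range j'.incl) →
        (∀ v' : V', s' (j'.incl v') ∈ range (fun v : V => s (j.incl v))) →
        IsAdaptedTo 𝓘(ℝ, EU × ℝ) 𝓘(ℝ, EU' × ℝ) (deformationMap j' t') (deformationMap j' s')
          (deformationMap j t) (deformationMap j s) := by
  have := SingularFoliation.locallyCompactSpace 𝓘(ℝ, E) (U := M)
  refine ⟨SingularFoliation.isBisubmersion_deformation hU hV, ?_⟩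
  intro _ _ _ _ _ _ _ _ t' s' hU' had _ _ _ _ j' hV' _ hsub
  exact SingularFoliation.isAdaptedTo_deformation hU hV hU' had hV' hsub
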